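/- **Definitions.** Let $\Omega$ be a domain (non-empty connected open set) in $\mathbb R\times\mathbb R^3$. A cylinder is a set $Q=I\times O$ with $I\subset\mathbb R$ an open interval and $O\subset\mathbb R^3$ open; $Q\subset\subset\Omega$ means that $\overline Q$ is a compact subset of $\Omega$. All derivatives are taken in the sense of distributions; $\nabla$, $\Delta$, $\operatorname{div}$, $\operatorname{curl}$ act in the space variable. $\mathcal D_\sigma(Q)$ is the space of smooth divergence-free vector fields with compact support in $Q$. Given a divergence-free field $f\in L^2_{\rm loc}(\Omega)$, a local weak solution on $\Omega$ of the Navier–Stokes equations with force $f$ is a vector field $u$ such that, for every cylinder $Q\subset\subset\Omega$, $u\in L^\infty_tL^2_x(Q)\cap L^2_tH^1_x(Q)$, $\operatorname{div}u=0$ on $Q$, and $$\iint_Q u\cdot(\partial_t\phi+\Delta\phi)+u\cdot(u\cdot\nabla\phi)+f\cdot\phi\;dt\,dx=0\qquad\text{for all }\phi\in\mathcal D_\sigma(Q).$$ **Hypotheses (H).** $(f_n)$ is a sequence of divergence-free vector fields on $\Omega$, each $u_n$ is a local weak solution on $\Omega$ with force $f_n$, and for every cylinder $Q\subset\subset\Omega$: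 * $f_n\in L^2_tH^1_x(Q)$ and $f_n\rightharpoonup f$ weakly in $L^2_tH^1_x(Q)$; * $(u_n)$ is bounded in $L^\infty_tL^2_x(Q)\cap L^2_tH^1_x(Q)$ and $u_n\rightharpoonup u$ weakly in $L^2_tH^1_x(Q)$; * for every $n$, $u_n\in L^\infty(Q)$ (with a bound that may depend on $n$). Put $\omega_n=\operatorname{curl}u_n$ and $\omega=\operatorname{curl}u$. **Lemma (Convergence of the non-linear term).** Under (H), for every cylinder $Q\subset\subset\Omega$, the fields $\omega_n\wedge u_n$, $\omega\wedge u$, $(u_n\cdot\nabla)u_n$, $(u\cdot\nabla)u$ are locally integrable on $Q$ and $$\omega_n\wedge u_n\rightharpoonup\omega\wedge u\quad\text{in }\mathcal D'(Q),\qquad (u_n\cdot\nabla)u_n\rightharpoonup(u\cdot\nabla)u\quad\text{in }(\mathcal D_\sigma(Q))',$$ the latter meaning $\iint_Q (u_n\cdot\nabla)u_n\cdot\phi\,dt\,dx\to\iint_Q (u\cdot\nabla)u\cdot\phi\,dt\,dx$ for every $\phi\in\mathcal D_\sigma(Q)$. On the other hand, there are $\Omega$, $(f_n)$, $(u_n)$,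 $f$, $u$ satisfying (H) and a cylinder $Q\subset\subset\Omega$ such that $(u_n\cdot\nabla)u_n$ does not converge to $(u\cdot\nabla)u$ in $\mathcal D'(Q)$. -/

import Mathlib

open MeasureTheory Filter Topology TopologicalSpace Set
open scoped Distributions ENNReal NNReal

noncomputable section

namespace LocalNS

/-- The physical space `ℝ³` with its Euclidean structure. -/
abbrev E3 : Type := EuclideanSpace ℝ (Fin 3)

/-- Space-time `ℝ × ℝ³`; points are `(t, x)`. -/
abbrev ST : Type := ℝ × E3

/-- The (classical) time derivative. -/
def dt {F : Type} [NormedAddCommGroup F] [NormedSpace ℝ F] (φ : ST → F) (z : ST) : F :=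
  fderiv ℝ φ z (1, 0)

/-- The (classical) derivative in the `j`-th space direction. -/
def dx {F : Type} [NormedAddCommGroup F] [NormedSpace ℝ F] (j : Fin 3) (φ : ST → F) (z : ST) : F :=
  fderiv ℝ φ z (0, EuclideanSpace.single j 1)

/-- The Laplacian in the space variables. -/
def laplace {F : Type} [NormedAddCommGroup F] [NormedSpace ℝ F] (φ : ST → F) (z : ST) : F :=
  ∑ j : Fin 3, dx j (dx j φ) z

/-- The cylinder `(a, b) × O` as an open subset of space-time. -/
def cylinder (a b : ℝ) (O : Opens E3) : Opens ST :=
  ⟨Ioo a b ×ˢ (O : Set E3), isOpen_Ioo.prod O.isOpen⟩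

/-- `Q ⊂⊂ Ω`: the closure of `Q` is a compact subset of `Ω`. -/
def CompactlyIn (Q Ω : Opens ST) : Prop :=
  IsCompact (closure (Q : Set ST)) ∧ closure (Q : Set ST) ⊆ Ω

/-- The function `g` is the distributional derivative of `v` in the `j`-th space direction
on `Q`. -/
structure HasWeakPartial (Q : Opens ST) (j : Fin 3) (v g : ST → E3) : Prop where
  locInt : LocallyIntegrableOn v Q
  locInt_deriv : LocallyIntegrableOn g Q
  integral_eq : ∀ φ : 𝓓(Q, ℝ), ∫ z in (Q : Set ST), dx j φ z • v z = -∫ z in (Q : Set ST), φ z • g z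

open Classical in
/-- The distributional derivative of `v` in the `j`-th space direction on `Q`, when it is a locally
integrable function (it is then unique almost everywhere on `Q`); zero otherwise. -/
def weakPartial (Q : Opens ST) (j : Fin 3) (v : ST → E3) : ST → E3 :=
  if h : ∃ g, HasWeakPartial Q j v g then h.choose else 0

/-- `v` is divergence-free on `U` in the sense of distributions. -/
def DivFree (U : Opens ST) (v : ST → E3) : Prop :=
  ∀ φ : 𝓓(U, ℝ), ∫ z in (U : Set ST), ∑ j : Fin 3, v z j * dx j φ z = 0

/-- `v ∈ L²_loc(U)`. -/
def MemL2loc (U : Opens ST) (v : ST → E3) : Prop :=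
  ∀ K : Set ST, IsCompact K → K ⊆ U → MemLp v 2 (volume.restrict K)

/-- `v ∈ L²_t H¹_x(Q)`: `v` and its distributional space derivatives are in `L²(Q)`. -/
def MemL2H1 (Q : Opens ST) (v : ST → E3) : Prop :=
  MemLp v 2 (volume.restrict (Q : Set ST)) ∧
    ∀ j : Fin 3, ∃ g, HasWeakPartial Q j v g ∧ MemLp g 2 (volume.restrict (Q : Set ST))

/-- The essential supremum over `t ∈ (a, b)` of `‖v(t, ·)‖_{L²(O)}` is at most `C`. -/
def LinftyL2Le (a b : ℝ) (O : Opens E3) (v : ST → E3) (C : ℝ≥0) : Prop :=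
  ∀ᵐ t ∂(volume.restrict (Ioo a b)),
    eLpNorm (fun x => v (t, x)) 2 (volume.restrict (O : Set E3)) ≤ C

/-- `v ∈ L^∞_t L²_x((a, b) × O)`. -/
def MemLinftyL2 (a b : ℝ) (O : Opens E3) (v : ST → E3) : Prop :=
  AEStronglyMeasurable v (volume.restrict (cylinder a b O : Set ST)) ∧
    ∃ C : ℝ≥0, LinftyL2Le a b O v C

/-- The sequence `v` is bounded in `L^∞_t L²_x ∩ L²_t H¹_x` of the cylinder `(a, b) × O`. -/
def BoundedEnergy (a b : ℝ) (O : Opens E3) (v : ℕ → ST → E3) : Prop :=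
  (∀ n, MemLinftyL2 a b O (v n) ∧ MemL2H1 (cylinder a b O) (v n)) ∧
    ∃ C : ℝ≥0, ∀ n, LinftyL2Le a b O (v n) C ∧
      eLpNorm (v n) 2 (volume.restrict (cylinder a b O : Set ST)) ≤ C ∧
      ∀ j, eLpNorm (weakPartial (cylinder a b O) j (v n)) 2
        (volume.restrict (cylinder a b O : Set ST)) ≤ C

/-- The functional `v ↦ ∫_Q v · g + ∑ⱼ ∂ⱼv · Gⱼ`. When `g` and the `Gⱼ` range over `L²(Q)`, these are
all the continuous linear functionals on `L²_t H¹_x(Q)`. -/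
def l2h1Pairing (Q : Opens ST) (v g : ST → E3) (G : Fin 3 → ST → E3) : ℝ :=
  ∫ z in (Q : Set ST), (inner ℝ (v z) (g z) + ∑ j, inner ℝ (weakPartial Q j v z) (G j z))

/-- `v n` converges to `w` weakly in `L²_t H¹_x(Q)`. -/
structure WeakConvL2H1 (Q : Opens ST) (v : ℕ → ST → E3) (w : ST → E3) : Prop where
  mem : ∀ n, MemL2H1 Q (v n)
  mem_limit : MemL2H1 Q w
  tendsto : ∀ (g : ST → E3) (G : Fin 3 → ST → E3), MemLp g 2 (volume.restrict (Q : Set ST)) →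
    (∀ j, MemLp (G j) 2 (volume.restrict (Q : Set ST))) →
    Tendsto (fun n => l2h1Pairing Q (v n) g G) atTop (𝓝 (l2h1Pairing Q w g G))

/-- `φ ∈ 𝓓_σ(Q)`: the test field `φ` is divergence-free. -/
def IsSolenoidal {Q : Opens ST} (φ : 𝓓(Q, E3)) : Prop :=
  ∀ z, ∑ j : Fin 3, dx j φ z j = 0

/-- `u` is a local weak solution on `Ω` of the Navier–Stokes equations with force `f`. -/
structure IsLocalWeakSolution (Ω : Opens ST) (f u : ST → E3) : Prop where
  force_mem : MemL2loc Ω f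
  force_divFree : DivFree Ω f
  mem_LinftyL2 : ∀ a b O, CompactlyIn (cylinder a b O) Ω → MemLinftyL2 a b O u
  mem_L2H1 : ∀ a b O, CompactlyIn (cylinder a b O) Ω → MemL2H1 (cylinder a b O) u
  divFree : ∀ a b O, CompactlyIn (cylinder a b O) Ω → DivFree (cylinder a b O) u
  weak_form : ∀ a b O, CompactlyIn (cylinder a b O) Ω →
    ∀ φ : 𝓓(cylinder a b O, E3), IsSolenoidal φ →
      ∫ z in (cylinder a b O : Set ST),
        (inner ℝ (u z) (dt φ z + laplace φ z) + inner ℝ (u z) (∑ j : Fin 3, u z j • dx j φ z)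
          + inner ℝ (f z) (φ z)) = 0

/-- The sequence `u n` of local weak solutions on the domain `Ω`, with forces `f n`, and the weak
limits `u'` and `f'`. -/
structure WeakLimitSetting (Ω : Opens ST) (f u : ℕ → ST → E3) (f' u' : ST → E3) : Prop where
  domain : IsConnected (Ω : Set ST)
  solution : ∀ n, IsLocalWeakSolution Ω (f n) (u n)
  force_conv : ∀ a b O, CompactlyIn (cylinder a b O) Ω → WeakConvL2H1 (cylinder a b O) f f'
  bounded : ∀ a b O, CompactlyIn (cylinder a b O) Ω → BoundedEnergy a b O u
  conv : ∀ a b O, CompactlyIn (cylinder a b O) Ω → WeakConvL2H1 (cylinder a b O) u u'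
  /-- Each `u n` is essentially bounded on `Q`, with a bound that may depend on `n`. -/
  regular : ∀ a b O, CompactlyIn (cylinder a b O) Ω →
    ∀ n, MemLp (u n) ∞ (volume.restrict (cylinder a b O : Set ST))

/-- The vector product on `ℝ³`. -/
def wedge (v w : E3) : E3 := WithLp.toLp 2 (crossProduct v.ofLp w.ofLp)

/-- The vorticity `curl v` on `Q`. -/
def vorticity (Q : Opens ST) (v : ST → E3) (z : ST) : E3 :=
  !₂[weakPartial Q 1 v z 2 - weakPartial Q 2 v z 1,
     weakPartial Q 2 v z 0 - weakPartial Q 0 v z 2,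
     weakPartial Q 0 v z 1 - weakPartial Q 1 v z 0]

/-- The field `(v · ∇) v = ∑ⱼ vⱼ ∂ⱼv` on `Q`. -/
def advection (Q : Opens ST) (v : ST → E3) (z : ST) : E3 :=
  ∑ j : Fin 3, v z j • weakPartial Q j v z

/-- The value `⟨F, φ⟩ = ∫_Q F · φ` on the test field `φ` of the distribution defined by `F`. -/
def pairing {Q : Opens ST} (F : ST → E3) (φ : 𝓓(Q, E3)) : ℝ :=
  ∫ z in (Q : Set ST), inner ℝ (F z) (φ z)

/-- The locally integrable fields `F n` converge to the locally integrable field `G` in the dual of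
the set `P` of test fields on `Q`. -/
def ConvergesInDual (Q : Opens ST) (P : Set 𝓓(Q, E3)) (F : ℕ → ST → E3) (G : ST → E3) : Prop :=
  (∀ n, LocallyIntegrableOn (F n) Q) ∧ LocallyIntegrableOn G Q ∧
    ∀ φ ∈ P, Tendsto (fun n => pairing (F n) φ) atTop (𝓝 (pairing G φ))

end LocalNS

end

set_option linter.unusedSectionVars false

noncomputable section

namespace LocalNS

/-! A product of two weakly convergent sequences passes to the limit when one factor is controlled
in time and the other in space. The velocity is controlled in space, by its `L²` gradient. The
velocity itself has no usable control in time because of the pressure, but the vorticity has: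
testing the equation with the solenoidal fields `∂ₚΨ e_q - ∂_qΨ eₚ` removes the pressure and bounds
`∂ₜωₙ`, uniformly in `n`, against functions `Ψ` with three bounded space derivatives
(`abs_integral_vorticity_mul_dt_le`).

The core is `tendsto_integral_mul_zero`, applied to `gₙ`, a component of `ωₙ`, and `wₙ`, a component
of `φ(uₙ - u)`. Convolve `wₙ` with a product kernel `α ⊗ ρ`. The error is small if `ρ` is
concentrated at a small space scale, uniformly in `n`, and if `α` is short enough in time, depending
on `n`. Replacing `α` by a kernel `β` of fixed length `δ` changes `wₙ` by an exact time derivative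
`∂ₜ((Γ ⊗ ρ) * wₙ)` with `Γ' = α - β`; the bound on `∂ₜωₙ` makes this cost of order `√δ`, whatever
the length of `α`. Convolution with the fixed kernel `β ⊗ ρ` turns weak convergence into strong
convergence. Hence `ωₙ ∧ uₙ` converges in the sense of distributions
(`tendsto_integral_curlComp_mul`).

For the advection term, `(v · ∇)v = ω ∧ v + ∇|v|²/2`, and the gradient is invisible to solenoidal
test fields; at this regularity the integration by parts is `MemL2H1.integral_mul_mul_weakPartial`.

The gradient part is where convergence in `𝓓'` fails. The potential flow `cos(nt) ∇((x₀² - x₁²)/2)`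
is an exact solution with zero force and tends weakly to zero, but its advection term is `cos²(nt)
(x₀, x₁, 0)`, which tends to `(x₀, x₁, 0)/2`. -/

open scoped Convolution ContDiff Pointwise

/-! ### Cauchy–Schwarz in `L²`, in terms of `lpNorm`. -/

section SquareIntegrable

variable {α : Type*} [MeasurableSpace α] {μ : Measure α}

theorem norm_toLp_eq_lpNorm {f : α → ℝ} (hf : MemLp f 2 μ) : ‖hf.toLp f‖ = lpNorm f 2 μ := by
  rw [Lp.norm_toLp, toReal_eLpNorm hf.1]

theorem inner_toLp_eq_integral {f g : α → ℝ} (hf : MemLp f 2 μ) (hg : MemLp g 2 μ) :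
    inner ℝ (hf.toLp f) (hg.toLp g) = ∫ x, f x * g x ∂μ := by
  rw [L2.inner_def]
  refine integral_congr_ae ?_
  filter_upwards [hf.coeFn_toLp, hg.coeFn_toLp] with x h1 h2
  simp [h1, h2, mul_comm]

theorem abs_integral_mul_le {f g : α → ℝ} (hf : MemLp f 2 μ) (hg : MemLp g 2 μ) :
    |∫ x, f x * g x ∂μ| ≤ lpNorm f 2 μ * lpNorm g 2 μ := by
  rw [← inner_toLp_eq_integral hf hg, ← norm_toLp_eq_lpNorm hf, ← norm_toLp_eq_lpNorm hg]
  exact abs_real_inner_le_norm _ _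

theorem integral_abs_mul_le {f g : α → ℝ} (hf : MemLp f 2 μ) (hg : MemLp g 2 μ) :
    ∫ x, |f x * g x| ∂μ ≤ lpNorm f 2 μ * lpNorm g 2 μ := by
  have h := abs_integral_mul_le hf.norm hg.norm
  rw [lpNorm_norm hf.1, lpNorm_norm hg.1] at h
  simp only [abs_mul]
  exact (le_abs_self _).trans h

theorem integrable_mul_of_memLp_two {f g : α → ℝ} (hf : MemLp f 2 μ) (hg : MemLp g 2 μ) :
    Integrable (fun x => f x * g x) μ :=
  hf.integrable_mul hg

theorem sq_lpNorm_two {f : α → ℝ} (hf : MemLp f 2 μ) : lpNorm f 2 μ ^ 2 = ∫ x, f x ^ 2 ∂μ := by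
  rw [← norm_toLp_eq_lpNorm hf, ← real_inner_self_eq_norm_sq, inner_toLp_eq_integral]
  simp only [sq]

end SquareIntegrable

/-! ### Translations, duality and smooth convolutions in `L²`. -/

section Translation

variable {V : Type*} [NormedAddCommGroup V] [NormedSpace ℝ V] [FiniteDimensional ℝ V]
  [MeasurableSpace V] [BorelSpace V] {μ : Measure V} [μ.IsAddHaarMeasure]

theorem memLp_translate {w : V → ℝ} (hw : MemLp w 2 μ) (y : V) :
    MemLp (fun z => w (z - y)) 2 μ :=
  hw.comp_measurePreserving (measurePreserving_sub_right μ y)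

theorem lpNorm_translate {w : V → ℝ} (hw : MemLp w 2 μ) (y : V) :
    lpNorm (fun z => w (z - y)) 2 μ = lpNorm w 2 μ := by
  rw [← toReal_eLpNorm (memLp_translate hw y).1, ← toReal_eLpNorm hw.1]
  congr 1
  exact eLpNorm_comp_measurePreserving hw.1 (measurePreserving_sub_right μ y)

/-- Translation is continuous in `L²`. -/
theorem tendsto_lpNorm_translate_sub {w : V → ℝ} (hw : MemLp w 2 μ) :
    Tendsto (fun y => lpNorm (fun z => w (z - y) - w z) 2 μ) (𝓝 0) (𝓝 0) := by
  have hc : Continuous (fun y : V => (⟨fun z => z - y, by fun_prop⟩ : C(V, V))) :=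
    ContinuousMap.continuous_of_continuous_uncurry _ (by
      change Continuous fun p : V × V => p.2 - p.1
      fun_prop)
  have hmp : ∀ y : V, MeasurePreserving (⟨fun z => z - y, by fun_prop⟩ : C(V, V)) μ μ :=
    fun y => measurePreserving_sub_right μ y
  have h := (continuous_const (y := hw.toLp w)).compMeasurePreservingLp hc hmp (by simp)
  have h0 : Lp.compMeasurePreserving (⟨fun z => z - 0, by fun_prop⟩ : C(V, V)) (hmp 0)
      (hw.toLp w) = hw.toLp w := by
    rw [Lp.toLp_compMeasurePreserving]
    congr 1
    ext z
    simp
  have h2 := (h.tendsto 0).sub_const (hw.toLp w)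
  rw [h0, sub_self] at h2
  have h3 := h2.norm
  rw [norm_zero] at h3
  refine h3.congr fun y => ?_
  rw [Lp.toLp_compMeasurePreserving, ← MemLp.toLp_sub, norm_toLp_eq_lpNorm]
  rfl

/-- Smooth compactly supported functions are dense in `L²`, so the bound extends to every `G` in
`L²`; with `G = F` it reads `‖F‖² ≤ C ‖F‖`. -/
theorem lpNorm_le_of_forall_contDiff {F : V → ℝ} {C : ℝ} (hF : MemLp F 2 μ) (hC : 0 ≤ C)
    (h : ∀ ψ : V → ℝ, ContDiff ℝ ∞ ψ → HasCompactSupport ψ →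
      |∫ z, ψ z * F z ∂μ| ≤ C * lpNorm ψ 2 μ) : lpNorm F 2 μ ≤ C := by
  have key : ∀ G : Lp ℝ 2 μ, |inner ℝ G (hF.toLp F)| ≤ C * ‖G‖ := by
    have hcl : IsClosed {G : Lp ℝ 2 μ | |inner ℝ G (hF.toLp F)| ≤ C * ‖G‖} :=
      isClosed_le (by fun_prop) (by fun_prop)
    have hd := Lp.dense_hasCompactSupport_contDiff (E := V) (F := ℝ) (μ := μ) (p := 2) (by simp)
    intro G
    refine hcl.closure_subset_iff.2 ?_ (hd G)
    rintro G ⟨ψ, hG, hψc, hψ⟩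
    have hψ2 : MemLp ψ 2 μ := hψ.continuous.memLp_of_hasCompactSupport hψc
    have : G = hψ2.toLp ψ := Lp.ext (hG.trans hψ2.coeFn_toLp.symm)
    change |inner ℝ G (hF.toLp F)| ≤ C * ‖G‖
    rw [this, inner_toLp_eq_integral, norm_toLp_eq_lpNorm]
    exact h ψ hψ hψc
  have h1 := key (hF.toLp F)
  rw [real_inner_self_eq_norm_sq, abs_of_nonneg (by positivity), norm_toLp_eq_lpNorm] at h1
  rcases (lpNorm_nonneg (f := F) (p := 2) (μ := μ)).eq_or_lt with h0 | h0
  · rwa [← h0]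
  · nlinarith

/-- The function `g` is the distributional derivative of `w` in the direction `v` on the whole
space. -/
def HasWeakDeriv (μ : Measure V) (v : V) (w g : V → ℝ) : Prop :=
  ∀ ψ : V → ℝ, ContDiff ℝ ∞ ψ → HasCompactSupport ψ →
    ∫ z, fderiv ℝ ψ z v * w z ∂μ = -∫ z, ψ z * g z ∂μ

theorem hasCompactSupport_fderiv_apply {k : V → ℝ} (hk : HasCompactSupport k) (v : V) :
    HasCompactSupport (fun y => fderiv ℝ k y v) :=
  hk.fderiv_apply ℝ v

theorem contDiff_fderiv_apply' {k : V → ℝ} (hk : ContDiff ℝ ∞ k) (v : V) :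
    ContDiff ℝ ∞ (fun y => fderiv ℝ k y v) :=
  (hk.fderiv_right (m := ∞) (by simp)).clm_apply contDiff_const

theorem fderiv_convolution_apply {k w : V → ℝ} (hk : ContDiff ℝ ∞ k)
    (hkc : HasCompactSupport k) (hw : LocallyIntegrable w μ) (z v : V) :
    fderiv ℝ (k ⋆[ContinuousLinearMap.lsmul ℝ ℝ, μ] w) z v
      = ((fun y => fderiv ℝ k y v) ⋆[ContinuousLinearMap.lsmul ℝ ℝ, μ] w) z := by
  have h := hkc.hasFDerivAt_convolution_left (ContinuousLinearMap.lsmul ℝ ℝ)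
    (hk.of_le (by simp)) hw z
  rw [h.fderiv]
  -- Flipping the bilinear map exchanges the two factors, so that evaluation at `v` can be moved
  -- inside the convolution.
  have e : ContinuousLinearMap.precompL V (ContinuousLinearMap.lsmul ℝ ℝ)
      = (ContinuousLinearMap.precompR V
          (ContinuousLinearMap.lsmul ℝ ℝ : ℝ →L[ℝ] ℝ →L[ℝ] ℝ).flip).flip := rfl
  rw [e, convolution_flip, convolution_precompR_apply _ hw (hkc.fderiv ℝ)
    (hk.continuous_fderiv (by simp)), ← convolution_flip]
  rfl

theorem contDiff_convolution {k w : V → ℝ} (hk : ContDiff ℝ ∞ k)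
    (hkc : HasCompactSupport k) (hw : LocallyIntegrable w μ) :
    ContDiff ℝ ∞ (k ⋆[ContinuousLinearMap.lsmul ℝ ℝ, μ] w) :=
  hkc.contDiff_convolution_left (n := ⊤) _ hk hw

end Translation

/-! ### Mollification errors and the compactness of convolution. -/

section Mollification

variable {V : Type*} [NormedAddCommGroup V] [NormedSpace ℝ V] [FiniteDimensional ℝ V]
  [MeasurableSpace V] [BorelSpace V] {μ : Measure V} [μ.IsAddHaarMeasure]

theorem locallyIntegrable_of_memLp_two {w : V → ℝ} (hw : MemLp w 2 μ) : LocallyIntegrable w μ :=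
  hw.locallyIntegrable (by norm_num)

/-- A function with square integrable derivative in the direction `v` moves little, in `L²`, under
the translation by `v`. -/
theorem lpNorm_translate_sub_le {w g : V → ℝ} {v : V} (hw : MemLp w 2 μ) (hg : MemLp g 2 μ)
    (h : HasWeakDeriv μ v w g) :
    lpNorm (fun z => w (z - v) - w z) 2 μ ≤ lpNorm g 2 μ := by
  refine lpNorm_le_of_forall_contDiff ((memLp_translate hw v).sub hw) lpNorm_nonneg ?_
  intro ψ hψ hψc
  have hψ2 : MemLp ψ 2 μ := hψ.continuous.memLp_of_hasCompactSupport hψc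
  -- The bound is obtained by duality. Reflecting `ψ` makes the pairings of `ψ` with the translates
  -- of `w` the values of one smooth function `H`, whose derivative along `v` is a pairing of a
  -- translate of `ψ` with `g`.
  set ψ' : V → ℝ := fun y => ψ (-y) with hψ'
  have hψ's : ContDiff ℝ ∞ ψ' := hψ.comp contDiff_neg
  have hψ'c : HasCompactSupport ψ' := hψc.comp_homeomorph (Homeomorph.neg V)
  set H := ψ' ⋆[ContinuousLinearMap.lsmul ℝ ℝ, μ] w with hH
  have hHs : ContDiff ℝ ∞ H := contDiff_convolution hψ's hψ'c (locallyIntegrable_of_memLp_two hw)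
  have hHv : ∀ x, H x = ∫ t, ψ (t - x) * w t ∂μ := by
    intro x
    rw [hH, convolution_eq_swap]
    simp [hψ']
  have hder : ∀ x, |fderiv ℝ H x v| ≤ lpNorm ψ 2 μ * lpNorm g 2 μ := by
    intro x
    set χ : V → ℝ := fun t => ψ (t - x) with hχ
    have hχs : ContDiff ℝ ∞ χ := hψ.comp (contDiff_id.sub contDiff_const)
    have hχc : HasCompactSupport χ := hψc.comp_homeomorph (Homeomorph.subRight x)
    have hfd : ∀ t, fderiv ℝ ψ' (x - t) v = -fderiv ℝ χ t v := by
      intro t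
      have hd : DifferentiableAt ℝ ψ (t - x) := hψ.differentiable (by simp) _
      have e1 : HasFDerivAt χ (fderiv ℝ ψ (t - x)) t := by
        exact (hd.hasFDerivAt.comp t ((hasFDerivAt_id (𝕜 := ℝ) t).sub_const x)).congr_fderiv
          (by ext; simp)
      have e2 : HasFDerivAt ψ' ((fderiv ℝ ψ (t - x)).comp (-(ContinuousLinearMap.id ℝ V)))
          (x - t) := by
        have h3 : HasFDerivAt (fun y : V => -y) (-(ContinuousLinearMap.id ℝ V)) (x - t) :=
          (hasFDerivAt_id (𝕜 := ℝ) (x - t)).neg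
        have h4 : HasFDerivAt ψ (fderiv ℝ ψ (t - x)) (-(x - t)) := by
          rw [neg_sub]; exact hd.hasFDerivAt
        exact h4.comp (x - t) h3
      rw [e1.fderiv, e2.fderiv]
      simp
    have e : fderiv ℝ H x v = ∫ t, χ t * g t ∂μ := by
      rw [hH, fderiv_convolution_apply hψ's hψ'c (locallyIntegrable_of_memLp_two hw),
        convolution_eq_swap]
      have := h χ hχs hχc
      simp only [ContinuousLinearMap.lsmul_apply, smul_eq_mul, hfd, neg_mul, integral_neg, this,
        neg_neg]
    have h5 := abs_integral_mul_le (memLp_translate hψ2 x) hg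
    rwa [lpNorm_translate hψ2, ← e] at h5
  -- The mean value inequality along the segment from `0` to `-v` bounds `H (-v) - H 0`, which is
  -- the pairing to be estimated.
  have hmv := norm_image_sub_le_of_norm_deriv_le_segment_01' (f := fun s : ℝ => H (-(s • v)))
    (f' := fun s => -fderiv ℝ H (-(s • v)) v) (C := lpNorm ψ 2 μ * lpNorm g 2 μ)
    (fun s _ => by
      have h1 : HasDerivAt (fun s : ℝ => -(s • v)) (-v) s := by
        exact ((hasDerivAt_id s).smul_const v).neg.congr_deriv (by simp)
      have h2 := (hHs.differentiable (by simp) (-(s • v))).hasFDerivAt.comp_hasDerivAt s h1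
      exact (h2.congr_deriv (by simp)).hasDerivWithinAt)
    (fun s _ => by simpa using hder _)
  simp only [one_smul, zero_smul, neg_zero] at hmv
  have hv : ∫ z, ψ z * (w (z - v) - w z) ∂μ = H (-v) - H 0 := by
    have i1 : Integrable (fun z => ψ z * w (z - v)) μ :=
      integrable_mul_of_memLp_two hψ2 (memLp_translate hw v)
    simp only [mul_sub]
    rw [integral_sub i1 (integrable_mul_of_memLp_two hψ2 hw), hHv, hHv,
      ← integral_sub_right_eq_self (fun t => ψ (t - -v) * w t) v]
    simp
  rw [hv, mul_comm]
  exact hmv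

theorem convolution_apply_mul (k w : V → ℝ) (z : V) :
    (k ⋆[ContinuousLinearMap.lsmul ℝ ℝ, μ] w) z = ∫ y, k y * w (z - y) ∂μ := rfl

theorem convolution_apply_mul_swap (k w : V → ℝ) (z : V) :
    (k ⋆[ContinuousLinearMap.lsmul ℝ ℝ, μ] w) z = ∫ y, k (z - y) * w y ∂μ := by
  rw [convolution_eq_swap]
  rfl

theorem memLp_reflect {w : V → ℝ} (hw : MemLp w 2 μ) (z : V) :
    MemLp (fun y => w (z - y)) 2 μ :=
  hw.comp_measurePreserving (Measure.measurePreserving_sub_left μ z)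

theorem lpNorm_reflect {w : V → ℝ} (hw : MemLp w 2 μ) (z : V) :
    lpNorm (fun y => w (z - y)) 2 μ = lpNorm w 2 μ := by
  rw [← toReal_eLpNorm (memLp_reflect hw z).1, ← toReal_eLpNorm hw.1]
  congr 1
  exact eLpNorm_comp_measurePreserving hw.1 (Measure.measurePreserving_sub_left μ z)

theorem abs_convolution_le {k w : V → ℝ} (hk : MemLp k 2 μ) (hw : MemLp w 2 μ) (z : V) :
    |(k ⋆[ContinuousLinearMap.lsmul ℝ ℝ, μ] w) z| ≤ lpNorm k 2 μ * lpNorm w 2 μ := by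
  rw [convolution_apply_mul, ← lpNorm_reflect hw z]
  exact abs_integral_mul_le hk (memLp_reflect hw z)

/-- Since `k` has mass one, `k * w - w` is the average of the differences `w(· - y) - w` with weight
`k y`; Fubini and Cauchy–Schwarz conclude. Only translations by `y` in the support of `k` matter. -/
theorem abs_integral_mul_convolution_sub_le {k g w : V → ℝ} {M : ℝ} (hk : Continuous k)
    (hkc : HasCompactSupport k) (hk0 : ∀ y, 0 ≤ k y) (hk1 : ∫ y, k y ∂μ = 1)
    (hg : MemLp g 2 μ) (hw : MemLp w 2 μ)
    (hM : ∀ y, k y ≠ 0 → lpNorm (fun z => w (z - y) - w z) 2 μ ≤ M) :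
    |∫ z, g z * ((k ⋆[ContinuousLinearMap.lsmul ℝ ℝ, μ] w) z - w z) ∂μ| ≤ lpNorm g 2 μ * M := by
  have hk2 : MemLp k 2 μ := hk.memLp_of_hasCompactSupport hkc
  have hki : Integrable k μ := hk.integrable_of_hasCompactSupport hkc
  have hd : ∀ y, MemLp (fun z => w (z - y) - w z) 2 μ := fun y => (memLp_translate hw y).sub hw
  set F : V × V → ℝ := fun p => g p.1 * (k p.2 * (w (p.1 - p.2) - w p.1)) with hF
  have hFm : AEStronglyMeasurable F (μ.prod μ) := by
    have h1 : AEStronglyMeasurable (fun p : V × V => k p.2 * w (p.1 - p.2)) (μ.prod μ) :=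
      AEStronglyMeasurable.convolution_integrand (ContinuousLinearMap.lsmul ℝ ℝ) hki.1 hw.1
    have h2 : AEStronglyMeasurable (fun p : V × V => k p.2 * w p.1) (μ.prod μ) :=
      (hki.1.comp_snd).mul hw.1.comp_fst
    refine ((hg.1.comp_fst (ν := μ)).mul (h1.sub h2)).congr (Eventually.of_forall fun p => ?_)
    simp [hF, mul_sub]
  have hinner : ∀ y, ∫ z, |F (z, y)| ∂μ ≤ k y * (lpNorm g 2 μ * M) := by
    intro y
    by_cases hy : k y = 0
    · simp [hF, hy]
    have e : ∀ z, |F (z, y)| = k y * |g z * (w (z - y) - w z)| := by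
      intro z
      simp only [hF, abs_mul, abs_of_nonneg (hk0 y)]
      ring
    simp only [e, integral_const_mul]
    refine mul_le_mul_of_nonneg_left ?_ (hk0 y)
    exact (integral_abs_mul_le hg (hd y)).trans
      (mul_le_mul_of_nonneg_left (hM y hy) lpNorm_nonneg)
  have hFi : Integrable F (μ.prod μ) := by
    rw [integrable_prod_iff' hFm]
    refine ⟨Eventually.of_forall fun y => ?_, ?_⟩
    · refine ((integrable_mul_of_memLp_two hg (hd y)).const_mul (k y)).congr
        (Eventually.of_forall fun z => ?_)
      simp only [hF]
      ring
    · refine (hki.mul_const (lpNorm g 2 μ * M)).mono' hFm.norm.prod_swap.integral_prod_right'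
        (Eventually.of_forall fun y => ?_)
      · rw [Real.norm_of_nonneg (integral_nonneg fun z => norm_nonneg _)]
        exact hinner y
  have hleft : ∀ z, ∫ y, F (z, y) ∂μ
      = g z * ((k ⋆[ContinuousLinearMap.lsmul ℝ ℝ, μ] w) z - w z) := by
    intro z
    simp only [hF, integral_const_mul]
    simp only [mul_sub (k _)]
    rw [integral_sub (integrable_mul_of_memLp_two hk2 (memLp_reflect hw z)) (hki.mul_const _),
      integral_mul_const, hk1, one_mul, convolution_apply_mul]
  simp only [← hleft]
  rw [integral_integral_swap hFi]
  calc |∫ y, ∫ z, F (z, y) ∂μ ∂μ| ≤ ∫ y, k y * (lpNorm g 2 μ * M) ∂μ := by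
        rw [← Real.norm_eq_abs]
        refine norm_integral_le_of_norm_le (hki.mul_const _) (Eventually.of_forall fun y => ?_)
        exact (norm_integral_le_integral_norm _).trans (hinner y)
    _ = lpNorm g 2 μ * M := by rw [integral_mul_const, hk1, one_mul]

/-- The value of `k * wₙ` at `z` is the pairing of `wₙ` with the fixed function `k(z - ·)`, so weak
convergence gives pointwise convergence. A uniform bound and a common compact support allow
dominated convergence. -/
theorem tendsto_lpNorm_convolution_zero {k : V → ℝ} {w : ℕ → V → ℝ} {K : Set V} {C : ℝ}
    (hk : ContDiff ℝ ∞ k) (hkc : HasCompactSupport k) (hK : IsCompact K)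
    (hw : ∀ n, MemLp (w n) 2 μ) (hwK : ∀ n, ∀ z ∉ K, w n z = 0) (hwC : ∀ n, lpNorm (w n) 2 μ ≤ C)
    (hweak : ∀ h : V → ℝ, MemLp h 2 μ → Tendsto (fun n => ∫ z, h z * w n z ∂μ) atTop (𝓝 0)) :
    Tendsto (fun n => lpNorm (k ⋆[ContinuousLinearMap.lsmul ℝ ℝ, μ] w n) 2 μ) atTop (𝓝 0) := by
  have hk2 : MemLp k 2 μ := hk.continuous.memLp_of_hasCompactSupport hkc
  have hwc : ∀ n, HasCompactSupport (w n) := fun n => HasCompactSupport.intro hK (hwK n)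
  have hcont : ∀ n, Continuous (k ⋆[ContinuousLinearMap.lsmul ℝ ℝ, μ] w n) := fun n =>
    (contDiff_convolution hk hkc (locallyIntegrable_of_memLp_two (hw n))).continuous
  have hm : ∀ n, MemLp (k ⋆[ContinuousLinearMap.lsmul ℝ ℝ, μ] w n) 2 μ := fun n =>
    (hcont n).memLp_of_hasCompactSupport (hkc.convolution _ (hwc n))
  have hK' : IsCompact (K + tsupport k) := hK.add hkc
  have hzero : ∀ n, ∀ z ∉ K + tsupport k,
      (k ⋆[ContinuousLinearMap.lsmul ℝ ℝ, μ] w n) z = 0 := by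
    intro n z hz
    by_contra hne
    obtain ⟨a, ha, b, hb, rfl⟩ := support_convolution_subset _ (Function.mem_support.2 hne)
    refine hz ⟨b, ?_, a, subset_tsupport _ ha, add_comm _ _⟩
    by_contra hbK
    exact hb (hwK n b hbK)
  have hsq : Tendsto (fun n => ∫ z, (k ⋆[ContinuousLinearMap.lsmul ℝ ℝ, μ] w n) z ^ 2 ∂μ) atTop
      (𝓝 (∫ _, (0 : ℝ) ∂μ)) := by
    refine tendsto_integral_of_dominated_convergence
      ((K + tsupport k).indicator fun _ => (lpNorm k 2 μ * C) ^ 2)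
      (fun n => ((hcont n).pow 2).aestronglyMeasurable) ?_ ?_ ?_
    · exact (integrable_indicator_iff hK'.measurableSet).2
        (integrableOn_const (hK'.measure_lt_top.ne))
    · intro n
      refine Eventually.of_forall fun z => ?_
      by_cases hz : z ∈ K + tsupport k
      · rw [indicator_of_mem hz, norm_pow]
        refine pow_le_pow_left₀ (norm_nonneg _) ?_ 2
        exact (abs_convolution_le hk2 (hw n) z).trans
          (mul_le_mul_of_nonneg_left (hwC n) lpNorm_nonneg)
      · rw [hzero n z hz, indicator_of_notMem hz]
        simp
    · refine Eventually.of_forall fun z => ?_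
      have := (hweak (fun y => k (z - y)) (memLp_reflect hk2 z)).pow 2
      simpa [convolution_apply_mul_swap] using this
  have h2 := hsq.sqrt
  simp only [integral_zero, Real.sqrt_zero] at h2
  refine h2.congr fun n => ?_
  rw [← sq_lpNorm_two (hm n), Real.sqrt_sq lpNorm_nonneg]

end Mollification

instance isAddHaarMeasure_volume_ST : (volume : Measure ST).IsAddHaarMeasure :=
  inferInstanceAs ((volume : Measure ℝ).prod (volume : Measure E3)).IsAddHaarMeasure

/-! ### Mollifying kernels that are products of a time factor and a space factor. -/

section Kernels

theorem exists_mollifier (V : Type*) [NormedAddCommGroup V] [NormedSpace ℝ V]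
    [FiniteDimensional ℝ V] [MeasurableSpace V] [BorelSpace V] (μ : Measure V)
    [μ.IsAddHaarMeasure] {r : ℝ} (hr : 0 < r) :
    ∃ ρ : V → ℝ, ContDiff ℝ ∞ ρ ∧ HasCompactSupport ρ ∧ (∀ y, 0 ≤ ρ y) ∧ ∫ y, ρ y ∂μ = 1 ∧
      ∀ y, ρ y ≠ 0 → ‖y‖ < r := by
  let b : ContDiffBump (0 : V) := ⟨r / 2, r, by positivity, by linarith⟩
  refine ⟨b.normed μ, b.contDiff_normed, b.hasCompactSupport_normed, b.nonneg_normed,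
    b.integral_normed, fun y hy => ?_⟩
  have : y ∈ Function.support (b.normed μ) := hy
  rw [b.support_normed_eq] at this
  simpa using this

/-- Take `Γ` the primitive of `α - β` from `-δ`. The equal masses make it vanish after `δ`, and it
is a difference of two functions with values in `[0, 1]`. Its bound does not depend on how
concentrated `α` is. -/
theorem exists_primitive_sub {α β : ℝ → ℝ} {δ : ℝ} (hα : ContDiff ℝ ∞ α) (hβ : ContDiff ℝ ∞ β)
    (hα0 : ∀ t, 0 ≤ α t) (hβ0 : ∀ t, 0 ≤ β t) (hα1 : ∫ t, α t = 1) (hβ1 : ∫ t, β t = 1)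
    (hαs : ∀ t, α t ≠ 0 → ‖t‖ < δ) (hβs : ∀ t, β t ≠ 0 → ‖t‖ < δ) :
    ∃ Γ : ℝ → ℝ, ContDiff ℝ ∞ Γ ∧ (∀ t, HasDerivAt Γ (α t - β t) t) ∧ (∀ t, |Γ t| ≤ 1) ∧
      ∀ t, Γ t ≠ 0 → ‖t‖ ≤ δ := by
  have hδ : 0 < δ := by
    by_contra h
    have : ∀ t, α t = 0 := fun t => by
      by_contra h'
      exact h ((norm_nonneg t).trans_lt (hαs t h'))
    simp [this] at hα1
  have hsub : ∀ γ : ℝ → ℝ, (∀ t, γ t ≠ 0 → ‖t‖ < δ) → ∀ t, δ ≤ t →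
      ∫ s in (-δ)..t, γ s = ∫ s, γ s := by
    intro γ hγ t ht
    refine intervalIntegral.integral_eq_integral_of_support_subset fun s hs => ?_
    have := abs_lt.1 (hγ s hs)
    exact ⟨this.1, this.2.le.trans ht⟩
  have hbd : ∀ γ : ℝ → ℝ, ContDiff ℝ ∞ γ → (∀ t, 0 ≤ γ t) → ∫ s, γ s = 1 → ∀ t, -δ ≤ t →
      0 ≤ ∫ s in (-δ)..t, γ s ∧ ∫ s in (-δ)..t, γ s ≤ 1 := by
    intro γ hγ h0 h1 t ht
    refine ⟨intervalIntegral.integral_nonneg ht fun s _ => h0 s, ?_⟩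
    rw [intervalIntegral.integral_of_le ht, ← h1]
    refine setIntegral_le_integral ?_ (Eventually.of_forall h0)
    by_contra hi
    rw [integral_undef hi] at h1
    exact zero_ne_one h1
  have hc : Continuous fun s => α s - β s := hα.continuous.sub hβ.continuous
  have hd : ∀ t, HasDerivAt (fun t => ∫ s in (-δ)..t, (α s - β s)) (α t - β t) t := fun t =>
    intervalIntegral.integral_hasDerivAt_right (hc.intervalIntegrable _ _)
      (hc.stronglyMeasurableAtFilter _ _) hc.continuousAt
  have hsplit : ∀ t, ∫ s in (-δ)..t, (α s - β s)
      = (∫ s in (-δ)..t, α s) - ∫ s in (-δ)..t, β s := fun t =>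
    intervalIntegral.integral_sub (hα.continuous.intervalIntegrable _ _)
      (hβ.continuous.intervalIntegrable _ _)
  have hneg : ∀ t, t ≤ -δ → ∫ s in (-δ)..t, (α s - β s) = 0 := by
    intro t ht
    rw [intervalIntegral.integral_congr (g := fun _ => 0)]
    · simp
    intro s hs
    rw [uIcc_of_ge ht] at hs
    have hs' : ¬ ‖s‖ < δ := by
      rw [Real.norm_eq_abs, abs_lt]
      intro h
      linarith [hs.2]
    have h1 : α s = 0 := by_contra fun h => hs' (hαs s h)
    have h2 : β s = 0 := by_contra fun h => hs' (hβs s h)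
    simp [h1, h2]
  refine ⟨fun t => ∫ s in (-δ)..t, (α s - β s), ?_, hd, fun t => ?_, fun t ht => ?_⟩
  · rw [contDiff_infty_iff_deriv]
    refine ⟨fun t => (hd t).differentiableAt, ?_⟩
    rw [funext fun t => (hd t).deriv]
    exact hα.sub hβ
  · rcases le_total t (-δ) with h | h
    · simp [hneg t h]
    · have h1 := hbd α hα hα0 hα1 t h
      have h2 := hbd β hβ hβ0 hβ1 t h
      simp only [hsplit]
      rw [abs_le]
      constructor <;> linarith [h1.1, h1.2, h2.1, h2.2]
  · by_contra hlt
    rw [not_le, Real.norm_eq_abs, lt_abs] at hlt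
    rcases hlt with h | h
    · refine ht ?_
      simp only [hsplit]
      rw [hsub α hαs t h.le, hsub β hβs t h.le, hα1, hβ1, sub_self]
    · exact ht (hneg t (by linarith))

/-- The tensor product of a function of time and a function of space. -/
def tensor (a : ℝ → ℝ) (b : E3 → ℝ) (z : ST) : ℝ := a z.1 * b z.2

/-- The derivative of a function of space in the `j`-th direction. -/
def spaceDeriv (j : Fin 3) (b : E3 → ℝ) (x : E3) : ℝ :=
  fderiv ℝ b x (EuclideanSpace.single j 1)

theorem contDiff_spaceDeriv {b : E3 → ℝ} (hb : ContDiff ℝ ∞ b) (j : Fin 3) :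
    ContDiff ℝ ∞ (spaceDeriv j b) :=
  contDiff_fderiv_apply' hb _

theorem hasCompactSupport_spaceDeriv {b : E3 → ℝ} (hb : HasCompactSupport b) (j : Fin 3) :
    HasCompactSupport (spaceDeriv j b) :=
  hasCompactSupport_fderiv_apply hb _

theorem contDiff_tensor {a : ℝ → ℝ} {b : E3 → ℝ} (ha : ContDiff ℝ ∞ a) (hb : ContDiff ℝ ∞ b) :
    ContDiff ℝ ∞ (tensor a b) :=
  (ha.comp contDiff_fst).mul (hb.comp contDiff_snd)

theorem hasCompactSupport_tensor {a : ℝ → ℝ} {b : E3 → ℝ} (ha : HasCompactSupport a)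
    (hb : HasCompactSupport b) : HasCompactSupport (tensor a b) := by
  refine HasCompactSupport.intro (IsCompact.prod (s := tsupport a) (t := tsupport b) ha hb) ?_
  rintro ⟨t, x⟩ hz
  by_contra hne
  refine hz ⟨subset_tsupport _ ?_, subset_tsupport _ ?_⟩
  · exact fun h => hne (by simp_all [tensor])
  · exact fun h => hne (by simp_all [tensor])

theorem fderiv_tensor {a : ℝ → ℝ} {b : E3 → ℝ} (ha : ContDiff ℝ ∞ a) (hb : ContDiff ℝ ∞ b)
    (z : ST) (s : ℝ) (h : E3) :
    fderiv ℝ (tensor a b) z (s, h) = s * deriv a z.1 * b z.2 + a z.1 * fderiv ℝ b z.2 h := by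
  have h1 : HasFDerivAt (fun z : ST => a z.1)
      ((fderiv ℝ a z.1).comp (ContinuousLinearMap.fst ℝ ℝ E3)) z :=
    (ha.differentiable (by simp) z.1).hasFDerivAt.comp z hasFDerivAt_fst
  have h2 : HasFDerivAt (fun z : ST => b z.2)
      ((fderiv ℝ b z.2).comp (ContinuousLinearMap.snd ℝ ℝ E3)) z :=
    (hb.differentiable (by simp) z.2).hasFDerivAt.comp z hasFDerivAt_snd
  have h3 := (h1.mul h2).fderiv
  have h4 : fderiv ℝ a z.1 s = s * deriv a z.1 := by
    rw [← fderiv_apply_one_eq_deriv, ← smul_eq_mul, ← map_smul]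
    simp
  change fderiv ℝ ((fun z : ST => a z.1) * fun z : ST => b z.2) z (s, h) = _
  rw [h3]
  simp [h4]
  ring

theorem dx_tensor_convolution {a : ℝ → ℝ} {b : E3 → ℝ} {w : ST → ℝ} (ha : ContDiff ℝ ∞ a)
    (hac : HasCompactSupport a) (hb : ContDiff ℝ ∞ b) (hbc : HasCompactSupport b)
    (hw : LocallyIntegrable w) (j : Fin 3) :
    dx j (tensor a b ⋆[ContinuousLinearMap.lsmul ℝ ℝ, volume] w)
      = tensor a (spaceDeriv j b) ⋆[ContinuousLinearMap.lsmul ℝ ℝ, volume] w := by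
  ext z
  rw [dx, fderiv_convolution_apply (contDiff_tensor ha hb) (hasCompactSupport_tensor hac hbc) hw]
  simp only [fderiv_tensor ha hb, zero_mul, zero_add]
  rfl

theorem dt_tensor_convolution {a a' : ℝ → ℝ} {b : E3 → ℝ} {w : ST → ℝ} (ha : ContDiff ℝ ∞ a)
    (hac : HasCompactSupport a) (hb : ContDiff ℝ ∞ b) (hbc : HasCompactSupport b)
    (ha' : ∀ t, HasDerivAt a (a' t) t) (hw : LocallyIntegrable w) :
    dt (tensor a b ⋆[ContinuousLinearMap.lsmul ℝ ℝ, volume] w)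
      = tensor a' b ⋆[ContinuousLinearMap.lsmul ℝ ℝ, volume] w := by
  ext z
  rw [dt, fderiv_convolution_apply (contDiff_tensor ha hb) (hasCompactSupport_tensor hac hbc) hw]
  simp only [fderiv_tensor ha hb, map_zero, mul_zero, add_zero, one_mul, (ha' _).deriv]
  rfl

theorem memLp_tensor {a : ℝ → ℝ} {b : E3 → ℝ} (ha : ContDiff ℝ ∞ a) (hac : HasCompactSupport a)
    (hb : ContDiff ℝ ∞ b) (hbc : HasCompactSupport b) : MemLp (tensor a b) 2 volume :=
  (contDiff_tensor ha hb).continuous.memLp_of_hasCompactSupport (hasCompactSupport_tensor hac hbc)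

theorem lpNorm_tensor {a : ℝ → ℝ} {b : E3 → ℝ} (ha : ContDiff ℝ ∞ a) (hac : HasCompactSupport a)
    (hb : ContDiff ℝ ∞ b) (hbc : HasCompactSupport b) :
    lpNorm (tensor a b) 2 volume = lpNorm a 2 volume * lpNorm b 2 volume := by
  have h2 := sq_lpNorm_two (memLp_tensor ha hac hb hbc)
  have e : ∫ z, tensor a b z ^ 2 = (∫ t, a t ^ 2) * ∫ x, b x ^ 2 := by
    simp only [tensor, mul_pow]
    exact integral_prod_mul (fun t => a t ^ 2) (fun x => b x ^ 2)
  rw [e, ← sq_lpNorm_two (ha.continuous.memLp_of_hasCompactSupport hac),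
    ← sq_lpNorm_two (hb.continuous.memLp_of_hasCompactSupport hbc), ← mul_pow] at h2
  exact (pow_left_inj₀ lpNorm_nonneg (mul_nonneg lpNorm_nonneg lpNorm_nonneg) two_ne_zero).1 h2

/-- Applied to the primitive `Γ`, this is the source of the small factor `√(2δ)`. -/
theorem lpNorm_le_sqrt_of_abs_le_one {a : ℝ → ℝ} {δ : ℝ} (hδ : 0 ≤ δ) (ha : ContDiff ℝ ∞ a)
    (hac : HasCompactSupport a) (h1 : ∀ t, |a t| ≤ 1) (hs : ∀ t, a t ≠ 0 → ‖t‖ ≤ δ) :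
    lpNorm a 2 volume ≤ √(2 * δ) := by
  refine Real.le_sqrt_of_sq_le ?_
  have hm := ha.continuous.memLp_of_hasCompactSupport (p := 2) (μ := volume) hac
  rw [sq_lpNorm_two hm]
  calc ∫ t, a t ^ 2 ≤ ∫ t, (Icc (-δ) δ).indicator (fun _ => (1 : ℝ)) t := by
        refine integral_mono hm.integrable_sq
          ((integrable_indicator_iff measurableSet_Icc).2 (integrableOn_const (by simp)))
          fun t => ?_
        by_cases ht : t ∈ Icc (-δ) δ
        · rw [indicator_of_mem ht]
          exact (sq_le_one_iff_abs_le_one _).2 (h1 t)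
        · have : a t = 0 := by_contra fun h => ht (abs_le.1 (hs t h))
          rw [indicator_of_notMem ht]
          simp [this]
    _ = 2 * δ := by
        rw [integral_indicator measurableSet_Icc]
        simp
        rw [max_eq_left (by linarith)]
        ring

end Kernels

/-! ### The compactness argument: time control on one factor, space control on the other. -/

/-- All the space derivatives of `Ψ` of orders one, two and three are bounded by `M`. -/
def SpaceDerivsLe (Ψ : ST → ℝ) (M : ℝ) : Prop :=
  (∀ i z, |dx i Ψ z| ≤ M) ∧ (∀ i j z, |dx i (dx j Ψ) z| ≤ M) ∧
    ∀ i j l z, |dx i (dx j (dx l Ψ)) z| ≤ M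

theorem exists_bound_space_derivs {ρ : E3 → ℝ} :
    ∃ B : ℝ, 0 ≤ B ∧ (∀ i, lpNorm (spaceDeriv i ρ) 2 volume ≤ B) ∧
      (∀ i j, lpNorm (spaceDeriv i (spaceDeriv j ρ)) 2 volume ≤ B) ∧
      ∀ i j l, lpNorm (spaceDeriv i (spaceDeriv j (spaceDeriv l ρ))) 2 volume ≤ B := by
  set A : Fin 3 → ℝ := fun i => lpNorm (spaceDeriv i ρ) 2 volume
  set A₂ : Fin 3 × Fin 3 → ℝ := fun p => lpNorm (spaceDeriv p.1 (spaceDeriv p.2 ρ)) 2 volume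
  set A₃ : Fin 3 × Fin 3 × Fin 3 → ℝ := fun p =>
    lpNorm (spaceDeriv p.1 (spaceDeriv p.2.1 (spaceDeriv p.2.2 ρ))) 2 volume
  have hA : ∀ i, 0 ≤ A i := fun i => lpNorm_nonneg
  have hA₂ : ∀ i, 0 ≤ A₂ i := fun i => lpNorm_nonneg
  have hA₃ : ∀ i, 0 ≤ A₃ i := fun i => lpNorm_nonneg
  have s1 := Finset.sum_nonneg fun i (_ : i ∈ Finset.univ) => hA i
  have s2 := Finset.sum_nonneg fun i (_ : i ∈ Finset.univ) => hA₂ i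
  have s3 := Finset.sum_nonneg fun i (_ : i ∈ Finset.univ) => hA₃ i
  refine ⟨∑ i, A i + ∑ i, A₂ i + ∑ i, A₃ i, by positivity, fun i => ?_, fun i j => ?_,
    fun i j l => ?_⟩
  · have := Finset.single_le_sum (fun i _ => hA i) (Finset.mem_univ i)
    linarith
  · have := Finset.single_le_sum (fun i _ => hA₂ i) (Finset.mem_univ (i, j))
    linarith
  · have := Finset.single_le_sum (fun i _ => hA₃ i) (Finset.mem_univ (i, j, l))
    linarith

/-- Space derivatives fall on `b` alone, so the time factor enters only through its `L²` norm;
Cauchy–Schwarz gives the pointwise bound. -/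
theorem spaceDerivsLe_tensor_convolution {a : ℝ → ℝ} {b : E3 → ℝ} {w : ST → ℝ} {A B C : ℝ}
    (ha : ContDiff ℝ ∞ a) (hac : HasCompactSupport a) (hb : ContDiff ℝ ∞ b)
    (hbc : HasCompactSupport b) (hw : MemLp w 2 volume) (hA : lpNorm a 2 volume ≤ A)
    (hwC : lpNorm w 2 volume ≤ C) (hB0 : 0 ≤ B) (hB1 : ∀ i, lpNorm (spaceDeriv i b) 2 volume ≤ B)
    (hB2 : ∀ i j, lpNorm (spaceDeriv i (spaceDeriv j b)) 2 volume ≤ B)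
    (hB3 : ∀ i j l, lpNorm (spaceDeriv i (spaceDeriv j (spaceDeriv l b))) 2 volume ≤ B) :
    SpaceDerivsLe (tensor a b ⋆[ContinuousLinearMap.lsmul ℝ ℝ, volume] w) (A * B * C) := by
  have hwl := locallyIntegrable_of_memLp_two hw
  have key : ∀ c : E3 → ℝ, ContDiff ℝ ∞ c → HasCompactSupport c → lpNorm c 2 volume ≤ B → ∀ z,
      |(tensor a c ⋆[ContinuousLinearMap.lsmul ℝ ℝ, volume] w) z| ≤ A * B * C := by
    intro c hc hcc hcB z
    refine (abs_convolution_le (memLp_tensor ha hac hc hcc) hw z).trans ?_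
    rw [lpNorm_tensor ha hac hc hcc]
    have h0 : 0 ≤ A := lpNorm_nonneg.trans hA
    have h1 : 0 ≤ lpNorm c 2 volume := lpNorm_nonneg
    have h3 := mul_nonneg h0 hB0
    have h2 : 0 ≤ lpNorm w 2 volume := lpNorm_nonneg
    gcongr
  have s1 : ∀ i, ContDiff ℝ ∞ (spaceDeriv i b) := fun i => contDiff_spaceDeriv hb i
  have c1 : ∀ i, HasCompactSupport (spaceDeriv i b) := fun i => hasCompactSupport_spaceDeriv hbc i
  have s2 : ∀ i j, ContDiff ℝ ∞ (spaceDeriv i (spaceDeriv j b)) := fun i j =>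
    contDiff_spaceDeriv (s1 j) i
  have c2 : ∀ i j, HasCompactSupport (spaceDeriv i (spaceDeriv j b)) := fun i j =>
    hasCompactSupport_spaceDeriv (c1 j) i
  refine ⟨fun i z => ?_, fun i j z => ?_, fun i j l z => ?_⟩
  · rw [dx_tensor_convolution ha hac hb hbc hwl]
    exact key _ (s1 i) (c1 i) (hB1 i) z
  · rw [dx_tensor_convolution ha hac hb hbc hwl, dx_tensor_convolution ha hac (s1 j) (c1 j) hwl]
    exact key _ (s2 i j) (c2 i j) (hB2 i j) z
  · rw [dx_tensor_convolution ha hac hb hbc hwl, dx_tensor_convolution ha hac (s1 l) (c1 l) hwl,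
      dx_tensor_convolution ha hac (s2 j l) (c2 j l) hwl]
    exact key _ (contDiff_spaceDeriv (s2 j l) i) (hasCompactSupport_spaceDeriv (c2 j l) i)
      (hB3 i j l) z

/-- This keeps a mollification with a short kernel inside `Q`, where it can serve as a test
function. -/
theorem tsupport_convolution_subset_cthickening {k w : ST → ℝ} {K : Set ST} {r : ℝ}
    (hk : ∀ y, k y ≠ 0 → ‖y‖ ≤ r) (hw : ∀ z ∉ K, w z = 0) :
    tsupport (k ⋆[ContinuousLinearMap.lsmul ℝ ℝ, volume] w) ⊆ Metric.cthickening r K := by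
  refine closure_minimal ?_ Metric.isClosed_cthickening
  intro z hz
  obtain ⟨a, ha, b, hb, rfl⟩ := support_convolution_subset _ hz
  refine Metric.mem_cthickening_of_dist_le _ b _ _ (by_contra fun h => hb (hw b h)) ?_
  simpa [dist_eq_norm] using hk a ha

theorem memLp_convolution {k w : ST → ℝ} {K : Set ST} (hk : ContDiff ℝ ∞ k)
    (hkc : HasCompactSupport k) (hK : IsCompact K) (hw : MemLp w 2 volume)
    (hwK : ∀ z ∉ K, w z = 0) :
    MemLp (k ⋆[ContinuousLinearMap.lsmul ℝ ℝ, volume] w) 2 volume :=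
  (contDiff_convolution hk hkc (locallyIntegrable_of_memLp_two hw)).continuous
    |>.memLp_of_hasCompactSupport (hkc.convolution _ (HasCompactSupport.intro hK hwK))

theorem hasCompactSupport_of_norm_le {V : Type*} [NormedAddCommGroup V] [NormedSpace ℝ V]
    [FiniteDimensional ℝ V] {a : V → ℝ} {δ : ℝ} (h : ∀ t, a t ≠ 0 → ‖t‖ ≤ δ) :
    HasCompactSupport a := by
  have := FiniteDimensional.proper_real V
  refine HasCompactSupport.intro (isCompact_closedBall 0 δ) fun t ht => ?_
  by_contra h'
  exact ht (by simpa using h t h')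

/-- If `∂ₜgₙ` is bounded in the dual of the functions with three bounded space derivatives and `wₙ`
tends weakly to zero with some uniform smoothness in space, then `gₙwₙ` tends to zero. -/
theorem tendsto_integral_mul_zero {Q : Opens ST} {K : Set ST} (hK : IsCompact K)
    (hKQ : K ⊆ Q) {g w : ℕ → ST → ℝ} {C : ℝ} (hg : ∀ n, MemLp (g n) 2 volume)
    (hgC : ∀ n, lpNorm (g n) 2 volume ≤ C) (hw : ∀ n, MemLp (w n) 2 volume)
    (hwC : ∀ n, lpNorm (w n) 2 volume ≤ C) (hwK : ∀ n, ∀ z ∉ K, w n z = 0)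
    (hweak : ∀ h : ST → ℝ, MemLp h 2 volume →
      Tendsto (fun n => ∫ z, h z * w n z) atTop (𝓝 0))
    (hshift : ∀ n (h : E3),
      lpNorm (fun z => w n (z - (0, h)) - w n z) 2 volume ≤ C * ‖h‖)
    (hdt : ∀ n (Ψ : 𝓓(Q, ℝ)) (M : ℝ), SpaceDerivsLe Ψ M → |∫ z, g n z * dt Ψ z| ≤ C * M) :
    Tendsto (fun n => ∫ z, g n z * w n z) atTop (𝓝 0) := by
  have hC : 0 ≤ C := lpNorm_nonneg.trans (hgC 0)
  obtain ⟨r, hr, hrQ⟩ := hK.exists_cthickening_subset_open Q.isOpen hKQ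
  rw [Metric.tendsto_atTop]
  intro η hη
  -- In `C * ε + ε`, the first term pays for space translations of length `ε`, through `hshift`, and
  -- the second for the very short time translations.
  obtain ⟨ε, hε, hεr, hεη⟩ : ∃ ε > 0, ε ≤ r ∧ C * (C * ε + ε) ≤ η / 4 := by
    refine ⟨min r (η / 4 / (C * (C + 1) + 1)), by positivity, min_le_left _ _, ?_⟩
    have h1 : min r (η / 4 / (C * (C + 1) + 1)) ≤ η / 4 / (C * (C + 1) + 1) := min_le_right _ _
    set e := min r (η / 4 / (C * (C + 1) + 1))
    rw [le_div_iff₀ (by positivity)] at h1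
    have : 0 ≤ e := by positivity
    nlinarith
  obtain ⟨ρ, hρ, hρc, hρ0, hρ1, hρs⟩ := exists_mollifier E3 volume hε
  obtain ⟨B, hB0, hB1, hB2, hB3⟩ := exists_bound_space_derivs (ρ := ρ)
  -- `B` depends on `ρ`, hence on `ε`, and may be large; `δ` is chosen after it to compensate.
  obtain ⟨δ, hδ, hδr, hδη⟩ : ∃ δ > 0, δ ≤ r ∧ C * (√(2 * δ) * B * C) ≤ η / 4 := by
    have hcont : Tendsto (fun δ : ℝ => C * (√(2 * δ) * B * C)) (𝓝[>] 0) (𝓝 0) := by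
      have : Continuous fun δ : ℝ => C * (√(2 * δ) * B * C) := by fun_prop
      simpa using (this.tendsto 0).mono_left nhdsWithin_le_nhds
    have h1 := hcont.eventually (ge_mem_nhds (show (0 : ℝ) < η / 4 by positivity))
    have h2 : ∀ᶠ δ : ℝ in 𝓝[>] 0, δ ∈ Ioc 0 r := Ioc_mem_nhdsGT hr
    obtain ⟨δ, h3, h4⟩ := (h1.and h2).exists
    exact ⟨δ, h4.1, h4.2, h3⟩
  obtain ⟨β, hβ, hβc, hβ0, hβ1, hβs⟩ := exists_mollifier ℝ volume hδ
  have hkβ := contDiff_tensor hβ hρ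
  have hkβc := hasCompactSupport_tensor hβc hρc
  have hT3 : ∀ᶠ n in atTop,
      C * lpNorm (tensor β ρ ⋆[ContinuousLinearMap.lsmul ℝ ℝ, volume] w n) 2 volume < η / 4 := by
    have := (tendsto_lpNorm_convolution_zero hkβ hkβc hK hw hwK hwC hweak).const_mul C
    rw [mul_zero] at this
    exact this.eventually (gt_mem_nhds (by positivity))
  obtain ⟨N, hN⟩ := eventually_atTop.1 hT3
  refine ⟨N, fun n hn => ?_⟩
  rw [Real.dist_eq, sub_zero]
  -- `κ` depends on `n`, as no uniform continuity in time is available for `w n`. This is harmless: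
  -- the bounds on `Γ` below involve `δ` and not `κ`.
  obtain ⟨κ, hκ, hκδ, hκs⟩ : ∃ κ > 0, κ ≤ δ ∧ ∀ s : ℝ, ‖s‖ < κ →
      lpNorm (fun z => w n (z - (s, 0)) - w n z) 2 volume ≤ ε := by
    have h1 := tendsto_lpNorm_translate_sub (hw n)
    have h2 := h1.eventually (ge_mem_nhds hε)
    obtain ⟨κ, hκ, h3⟩ := Metric.eventually_nhds_iff.1 h2
    refine ⟨min κ δ, by positivity, min_le_right _ _, fun s hs => h3 ?_⟩
    rw [dist_zero_right, Prod.norm_mk, norm_zero, max_eq_left (norm_nonneg _)]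
    exact hs.trans_le (min_le_left _ _)
  obtain ⟨α, hα, hαc, hα0, hα1, hαs⟩ := exists_mollifier ℝ volume hκ
  have hkα := contDiff_tensor hα hρ
  have hkαc := hasCompactSupport_tensor hαc hρc
  obtain ⟨Γ, hΓ, hΓd, hΓ1, hΓs⟩ := exists_primitive_sub hα hβ hα0 hβ0 hα1 hβ1
    (fun t ht => (hαs t ht).trans_le hκδ) hβs
  have hΓc : HasCompactSupport Γ := hasCompactSupport_of_norm_le hΓs
  have hwl := locallyIntegrable_of_memLp_two (hw n)
  have hmα := memLp_convolution hkα hkαc hK (hw n) (hwK n)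
  have hmβ := memLp_convolution hkβ hkβc hK (hw n) (hwK n)
  -- the error made by a mollification which is very short in time
  have T1 : |∫ z, g n z * ((tensor α ρ ⋆[ContinuousLinearMap.lsmul ℝ ℝ, volume] w n) z - w n z)|
      ≤ η / 4 := by
    have h := abs_integral_mul_convolution_sub_le (M := C * ε + ε) hkα.continuous hkαc
      (fun y => mul_nonneg (hα0 _) (hρ0 _))
      (by
        have := integral_prod_mul (μ := volume) (ν := volume) α ρ
        rw [hα1, hρ1, one_mul] at this
        exact this) (hg n) (hw n) ?_
    · refine h.trans (le_trans ?_ hεη)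
      exact mul_le_mul_of_nonneg_right (hgC n) (by positivity)
    · rintro ⟨s, x⟩ hy
      have hs : ‖s‖ < κ := hαs s (left_ne_zero_of_mul hy)
      have hx : ‖x‖ < ε := hρs x (right_ne_zero_of_mul hy)
      have hd := memLp_translate (hw n) ((s, 0) : ST)
      -- The translation is split into a space step, bounded by `hshift`, and a time step, bounded
      -- by the choice of `κ`.
      have e : (fun z => w n (z - (s, x)) - w n z)
          = (fun z => (fun z' : ST => w n (z' - (0, x)) - w n z') (z - (s, 0)))
            + fun z => w n (z - (s, 0)) - w n z := by
        ext z
        simp only [Pi.add_apply]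
        have : z - (s, x) = z - (s, 0) - (0, x) := by
          rw [sub_sub]; simp
        rw [this]
        ring
      have hx2 : MemLp (fun z' : ST => w n (z' - (0, x)) - w n z') 2 volume :=
        (memLp_translate (hw n) _).sub (hw n)
      rw [e]
      refine (lpNorm_add_le (memLp_translate hx2 _) (by norm_num)).trans ?_
      rw [lpNorm_translate hx2]
      refine add_le_add ((hshift n x).trans ?_) (hκs s hs)
      gcongr
  -- the cost of a longer mollification in time, through the equation
  have hsupp : ∀ y, tensor Γ ρ y ≠ 0 → ‖y‖ ≤ r := by
    rintro ⟨s, x⟩ hy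
    exact max_le ((hΓs s (left_ne_zero_of_mul hy)).trans hδr)
      ((hρs x (right_ne_zero_of_mul hy)).le.trans hεr)
  have hkΓ := contDiff_tensor hΓ hρ
  have hkΓc := hasCompactSupport_tensor hΓc hρc
  let Ψ : 𝓓(Q, ℝ) := ⟨tensor Γ ρ ⋆[ContinuousLinearMap.lsmul ℝ ℝ, volume] w n,
    contDiff_convolution hkΓ hkΓc hwl,
    hkΓc.convolution _ (HasCompactSupport.intro hK (hwK n)),
    (tsupport_convolution_subset_cthickening hsupp (hwK n)).trans hrQ⟩
  have hdtΨ : ∀ z, dt Ψ z = (tensor α ρ ⋆[ContinuousLinearMap.lsmul ℝ ℝ, volume] w n) z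
      - (tensor β ρ ⋆[ContinuousLinearMap.lsmul ℝ ℝ, volume] w n) z := by
    intro z
    change dt (tensor Γ ρ ⋆[ContinuousLinearMap.lsmul ℝ ℝ, volume] w n) z = _
    rw [dt_tensor_convolution hΓ hΓc hρ hρc hΓd hwl]
    simp only [convolution_apply_mul]
    rw [← integral_sub (integrable_mul_of_memLp_two (memLp_tensor hα hαc hρ hρc)
      (memLp_reflect (hw n) z)) (integrable_mul_of_memLp_two (memLp_tensor hβ hβc hρ hρc)
      (memLp_reflect (hw n) z))]
    congr 1
    ext y
    simp only [tensor]
    ring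
  have T2 : |∫ z, g n z * dt Ψ z| ≤ η / 4 :=
    (hdt n Ψ _ (spaceDerivsLe_tensor_convolution hΓ hΓc hρ hρc (hw n)
      (lpNorm_le_sqrt_of_abs_le_one hδ.le hΓ hΓc hΓ1 hΓs) (hwC n) hB0 hB1 hB2 hB3)).trans hδη
  have T3 : |∫ z, g n z * (tensor β ρ ⋆[ContinuousLinearMap.lsmul ℝ ℝ, volume] w n) z| < η / 4 :=
    ((abs_integral_mul_le (hg n) hmβ).trans
      (mul_le_mul_of_nonneg_right (hgC n) lpNorm_nonneg)).trans_lt (hN n hn)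
  have iw := integrable_mul_of_memLp_two (hg n) (hw n)
  have iα := integrable_mul_of_memLp_two (hg n) hmα
  have iβ := integrable_mul_of_memLp_two (hg n) hmβ
  -- The integral is the sum of three errors, each at most `η / 4`.
  simp only [mul_sub] at T1
  rw [integral_sub iα iw] at T1
  simp only [hdtΨ, mul_sub] at T2
  rw [integral_sub iα iβ] at T2
  rw [abs_le] at T1 T2
  rw [abs_lt] at T3 ⊢
  constructor <;> linarith [T1.1, T1.2, T2.1, T2.2, T3.1, T3.2]

/-! ### Vector fields in `L²` and the boundedness of weakly convergent sequences. -/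

section VectorValued

variable {α : Type*} [MeasurableSpace α] {μ : Measure α}

theorem memLp_coord {v : α → E3} {p : ℝ≥0∞} (hv : MemLp v p μ) (i : Fin 3) :
    MemLp (fun z => v z i) p μ := by
  refine hv.mono ((EuclideanSpace.proj i : E3 →L[ℝ] ℝ).continuous
    |>.comp_aestronglyMeasurable hv.1) (Eventually.of_forall fun z => PiLp.norm_apply_le (v z) i)

theorem lpNorm_coord_le {v : α → E3} (hv : MemLp v 2 μ) (i : Fin 3) :
    lpNorm (fun z => v z i) 2 μ ≤ lpNorm v 2 μ := by
  rw [← lpNorm_norm hv.1]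
  exact lpNorm_mono_real hv.norm fun z => PiLp.norm_apply_le (v z) i

theorem sq_lpNorm_two_vec {v : α → E3} (hv : MemLp v 2 μ) :
    lpNorm v 2 μ ^ 2 = ∫ x, ‖v x‖ ^ 2 ∂μ := by
  rw [← lpNorm_norm hv.1, sq_lpNorm_two hv.norm]

theorem lpNorm_le_of_eLpNorm_le {F : Type*} [NormedAddCommGroup F] {v : α → F} {C : ℝ≥0}
    (hv : AEStronglyMeasurable v μ) (h : eLpNorm v 2 μ ≤ C) : lpNorm v 2 μ ≤ C := by
  rw [← toReal_eLpNorm hv]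
  exact ENNReal.toReal_le_coe_of_le_coe h

/-- A weakly convergent sequence in `L²` is bounded. -/
theorem exists_lpNorm_le_of_weak_tendsto {v : ℕ → α → E3} (hv : ∀ n, MemLp (v n) 2 μ)
    (h : ∀ g : α → E3, MemLp g 2 μ →
      ∃ l, Tendsto (fun n => ∫ z, inner ℝ (v n z) (g z) ∂μ) atTop (𝓝 l)) :
    ∃ C, ∀ n, lpNorm (v n) 2 μ ≤ C := by
  obtain ⟨C, hC⟩ := banach_steinhaus (g := fun n => innerSL ℝ ((hv n).toLp (v n))) (by
    intro G
    obtain ⟨l, hl⟩ := h G (Lp.memLp G)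
    obtain ⟨C, hC⟩ := hl.norm.bddAbove_range
    refine ⟨C, fun n => ?_⟩
    refine le_trans (le_of_eq ?_) (hC ⟨n, rfl⟩)
    simp only [innerSL_apply_apply]
    rw [L2.inner_def]
    congr 1
    refine integral_congr_ae ?_
    filter_upwards [(hv n).coeFn_toLp] with z hz
    rw [hz])
  refine ⟨C, fun n => ?_⟩
  have := hC n
  rwa [innerSL_apply_norm, Lp.norm_toLp, toReal_eLpNorm (hv n).1] at this

end VectorValued

/-! ### Operations on test functions and extension by zero. -/

section TestFunctions

variable {Q : Opens ST}

theorem TestFunction_eq_zero {F : Type} [NormedAddCommGroup F] [NormedSpace ℝ F] (φ : 𝓓(Q, F))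
    {z : ST} (hz : z ∉ Q) : φ z = 0 :=
  image_eq_zero_of_notMem_tsupport fun h => hz (φ.tsupport_subset h)

/-- The derivative of a test function in a given direction, as a test function. -/
def derivTest (v : ST) (φ : 𝓓(Q, ℝ)) : 𝓓(Q, ℝ) where
  toFun z := fderiv ℝ φ z v
  contDiff' := contDiff_fderiv_apply' φ.contDiff v
  hasCompactSupport' := hasCompactSupport_fderiv_apply φ.hasCompactSupport v
  tsupport_subset' := (tsupport_fderiv_apply_subset ℝ v).trans φ.tsupport_subset

/-- The test function `∂ⱼφ`. -/
def dxTest (j : Fin 3) (φ : 𝓓(Q, ℝ)) : 𝓓(Q, ℝ) := derivTest (0, EuclideanSpace.single j 1) φ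

/-- The test function `∂ₜφ`. -/
def dtTest (φ : 𝓓(Q, ℝ)) : 𝓓(Q, ℝ) := derivTest (1, 0) φ

theorem coe_dxTest (j : Fin 3) (φ : 𝓓(Q, ℝ)) : ⇑(dxTest j φ) = dx j φ := rfl

theorem coe_dtTest (φ : 𝓓(Q, ℝ)) : ⇑(dtTest φ) = dt φ := rfl

/-- The product of a test function and a smooth function. -/
def mulTest (ψ : ST → ℝ) (hψ : ContDiff ℝ ∞ ψ) (φ : 𝓓(Q, ℝ)) : 𝓓(Q, ℝ) where
  toFun z := ψ z * φ z
  contDiff' := hψ.mul φ.contDiff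
  hasCompactSupport' := φ.hasCompactSupport.mul_left
  tsupport_subset' := (tsupport_mul_subset_right).trans φ.tsupport_subset

theorem exists_abs_le (φ : 𝓓(Q, ℝ)) : ∃ B, 0 ≤ B ∧ ∀ z, |φ z| ≤ B := by
  obtain ⟨B, hB⟩ := φ.continuous.bounded_above_of_compact_support φ.hasCompactSupport
  exact ⟨B, (norm_nonneg _).trans (hB 0), hB⟩

theorem memLp_testFunction {p : ℝ≥0∞} (φ : 𝓓(Q, ℝ)) (μ : Measure ST)
    [IsFiniteMeasureOnCompacts μ] : MemLp φ p μ :=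
  φ.continuous.memLp_of_hasCompactSupport φ.hasCompactSupport

theorem testFunction_mul_eq_indicator (φ : 𝓓(Q, ℝ)) (f : ST → ℝ) :
    (fun z => φ z * f z) = (Q : Set ST).indicator fun z => φ z * f z := by
  ext z
  by_cases hz : z ∈ (Q : Set ST)
  · rw [indicator_of_mem hz]
  · rw [indicator_of_notMem hz, TestFunction_eq_zero φ hz, zero_mul]

theorem integral_testFunction_mul (φ : 𝓓(Q, ℝ)) (f : ST → ℝ) :
    ∫ z in (Q : Set ST), φ z * f z = ∫ z, φ z * f z :=
  setIntegral_eq_integral_of_forall_compl_eq_zero fun z hz => by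
    rw [TestFunction_eq_zero φ hz, zero_mul]

theorem memLp_testFunction_mul (φ : 𝓓(Q, ℝ)) {f : ST → ℝ}
    (hf : MemLp f 2 (volume.restrict (Q : Set ST))) : MemLp (fun z => φ z * f z) 2 volume := by
  rw [testFunction_mul_eq_indicator, memLp_indicator_iff_restrict Q.isOpen.measurableSet]
  exact hf.mul (memLp_testFunction (p := ∞) φ _)

theorem lpNorm_testFunction_mul_le (φ : 𝓓(Q, ℝ)) {f : ST → ℝ} {B : ℝ} (hB : 0 ≤ B)
    (hφ : ∀ z, |φ z| ≤ B)
    (hf : MemLp f 2 (volume.restrict (Q : Set ST))) :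
    lpNorm (fun z => φ z * f z) 2 volume ≤ B * lpNorm f 2 (volume.restrict (Q : Set ST)) := by
  have h1 := memLp_testFunction_mul φ hf
  rw [← toReal_eLpNorm h1.1, ← toReal_eLpNorm hf.1, testFunction_mul_eq_indicator,
    eLpNorm_indicator_eq_eLpNorm_restrict Q.isOpen.measurableSet]
  have h2 := eLpNorm_le_mul_eLpNorm_of_ae_le_mul (f := fun z => φ z * f z) (g := f) (c := B)
    (μ := volume.restrict (Q : Set ST)) (p := 2)
    (Eventually.of_forall fun z => by
      rw [norm_mul]
      exact mul_le_mul_of_nonneg_right (hφ z) (norm_nonneg _))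
  have h3 := ENNReal.toReal_mono (ENNReal.mul_ne_top ENNReal.ofReal_ne_top hf.eLpNorm_ne_top) h2
  rwa [ENNReal.toReal_mul, ENNReal.toReal_ofReal hB] at h3

end TestFunctions

/-! ### Weak derivatives: uniqueness, localization and `L²` translation bounds. -/

section WeakDerivatives

variable {Q : Opens ST} {v : ST → E3}

theorem HasWeakPartial.ae_eq {j : Fin 3} {g g' : ST → E3} (h : HasWeakPartial Q j v g)
    (h' : HasWeakPartial Q j v g') : g =ᵐ[volume.restrict (Q : Set ST)] g' := by
  have key := Q.isOpen.ae_eq_zero_of_integral_contDiff_smul_eq_zero (μ := volume)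
    (h.locInt_deriv.sub h'.locInt_deriv) (by
      intro ψ hψ hψc hψQ
      let φ : 𝓓(Q, ℝ) := ⟨ψ, hψ, hψc, hψQ⟩
      have e : ∫ z in (Q : Set ST), φ z • g z = ∫ z in (Q : Set ST), φ z • g' z := by
        have := (h.integral_eq φ).symm.trans (h'.integral_eq φ)
        exact neg_injective this
      have hint : ∀ f : ST → E3, LocallyIntegrableOn f Q →
          IntegrableOn (fun z => φ z • f z) Q := by
        intro f hf
        exact (φ.integrable_bilin (ContinuousLinearMap.lsmul ℝ ℝ) hf).integrableOn
      have hz : ∀ z ∉ (Q : Set ST), ψ z • (g - g') z = 0 := fun z hz => by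
        have : ψ z = 0 := TestFunction_eq_zero φ hz
        rw [this, zero_smul]
      rw [← setIntegral_eq_integral_of_forall_compl_eq_zero hz]
      have := integral_sub (hint g h.locInt_deriv) (hint g' h'.locInt_deriv)
      simp only [Pi.sub_apply, smul_sub]
      refine this.trans ?_
      rw [e, sub_self])
  rw [Filter.EventuallyEq, ae_restrict_iff' Q.isOpen.measurableSet]
  filter_upwards [key] with z hz hzQ
  exact sub_eq_zero.1 (hz hzQ)

theorem hasWeakPartial_weakPartial {j : Fin 3} {g : ST → E3} (h : HasWeakPartial Q j v g) :
    HasWeakPartial Q j v (weakPartial Q j v) := by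
  have hex : ∃ g, HasWeakPartial Q j v g := ⟨g, h⟩
  rw [weakPartial, dif_pos hex]
  exact hex.choose_spec

/-- `weakPartial` is an arbitrary choice; this allows it to be replaced by any explicit weak
derivative, as is done for `saddleFlow`. -/
theorem weakPartial_ae_eq {j : Fin 3} {g : ST → E3} (h : HasWeakPartial Q j v g) :
    weakPartial Q j v =ᵐ[volume.restrict (Q : Set ST)] g :=
  (hasWeakPartial_weakPartial h).ae_eq h

theorem MemL2H1.hasWeakPartial (h : MemL2H1 Q v) (j : Fin 3) :
    HasWeakPartial Q j v (weakPartial Q j v) :=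
  hasWeakPartial_weakPartial (h.2 j).choose_spec.1

theorem MemL2H1.memLp_weakPartial (h : MemL2H1 Q v) (j : Fin 3) :
    MemLp (weakPartial Q j v) 2 (volume.restrict (Q : Set ST)) := by
  obtain ⟨g, hg, hg2⟩ := h.2 j
  exact hg2.ae_eq (weakPartial_ae_eq hg).symm

theorem integral_apply_coord {α : Type*} [MeasurableSpace α] {μ : Measure α} {F : α → E3}
    (hF : Integrable F μ) (i : Fin 3) : (∫ z, F z ∂μ) i = ∫ z, F z i ∂μ :=
  ((EuclideanSpace.proj i : E3 →L[ℝ] ℝ).integral_comp_comm hF).symm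

theorem MemL2H1.integral_dx_mul (h : MemL2H1 Q v) (j i : Fin 3) (φ : 𝓓(Q, ℝ)) :
    ∫ z, dx j φ z * v z i = -∫ z, φ z * weakPartial Q j v z i := by
  have h1 := congrArg (fun y : E3 => y i) ((h.hasWeakPartial j).integral_eq φ)
  have i1 : Integrable (fun z => dx j φ z • v z) (volume.restrict (Q : Set ST)) :=
    memLp_one_iff_integrable.1 (h.1.smul (memLp_testFunction (p := 2) (dxTest j φ) _))
  have i2 : Integrable (fun z => φ z • weakPartial Q j v z) (volume.restrict (Q : Set ST)) :=
    memLp_one_iff_integrable.1 ((h.memLp_weakPartial j).smul (memLp_testFunction (p := 2) φ _))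
  simp only [PiLp.neg_apply, integral_apply_coord i1, integral_apply_coord i2, PiLp.smul_apply,
    smul_eq_mul] at h1
  rw [← integral_testFunction_mul φ, ← h1, ← coe_dxTest, integral_testFunction_mul]

theorem dx_mul {ψ φ : ST → ℝ} (hψ : ContDiff ℝ ∞ ψ) (hφ : ContDiff ℝ ∞ φ) (j : Fin 3) (z : ST) :
    dx j (fun z => ψ z * φ z) z = ψ z * dx j φ z + dx j ψ z * φ z := by
  have := ((hψ.differentiable (by simp) z).hasFDerivAt.mul
    (hφ.differentiable (by simp) z).hasFDerivAt).fderiv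
  change fderiv ℝ (ψ * φ) z _ = _
  rw [this]
  simp [dx]
  ring

/-- The product of a field in `L²H¹(Q)` and a test function has square integrable derivatives on the
whole space-time. -/
theorem MemL2H1.hasWeakDeriv_mul (h : MemL2H1 Q v) (j i : Fin 3) (φ : 𝓓(Q, ℝ)) :
    HasWeakDeriv volume (0, EuclideanSpace.single j 1) (fun z => φ z * v z i)
      (fun z => dx j φ z * v z i + φ z * weakPartial Q j v z i) := by
  intro ψ hψ hψc
  have h1 := h.integral_dx_mul j i (mulTest ψ hψ φ)
  have hψ2 : MemLp ψ 2 volume := hψ.continuous.memLp_of_hasCompactSupport hψc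
  have hdψ2 : MemLp (dx j ψ) 2 volume :=
    (contDiff_fderiv_apply' hψ _).continuous.memLp_of_hasCompactSupport
      (hasCompactSupport_fderiv_apply hψc _)
  have m1 := memLp_testFunction_mul φ (memLp_coord h.1 i)
  have m2 := memLp_testFunction_mul (dxTest j φ) (memLp_coord h.1 i)
  have m3 := memLp_testFunction_mul φ (memLp_coord (h.memLp_weakPartial j) i)
  have i1 := integrable_mul_of_memLp_two hdψ2 m1
  have i2 := integrable_mul_of_memLp_two hψ2 m2
  have i3 := integrable_mul_of_memLp_two hψ2 m3
  have e : ∀ z, dx j (mulTest ψ hψ φ) z * v z i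
      = ψ z * (dx j φ z * v z i) + dx j ψ z * (φ z * v z i) := by
    intro z
    change dx j (fun z => ψ z * φ z) z * v z i = _
    rw [dx_mul hψ φ.contDiff]
    ring
  have e2 : ∀ z, mulTest ψ hψ φ z * weakPartial Q j v z i
      = ψ z * (φ z * weakPartial Q j v z i) := fun z => mul_assoc _ _ _
  simp only [e, e2] at h1
  have h2 := integral_add i2 i1
  have h3 := integral_add i2 i3
  simp only [coe_dxTest] at h2 h3
  rw [h2] at h1
  simp only [mul_add]
  rw [h3]
  change ∫ z, dx j ψ z * (φ z * v z i) = _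
  linarith

theorem hasWeakDeriv_space {w : ST → ℝ} {G : Fin 3 → ST → ℝ} (hw : MemLp w 2 volume)
    (hG : ∀ j, MemLp (G j) 2 volume)
    (h : ∀ j, HasWeakDeriv volume (0, EuclideanSpace.single j 1) w (G j)) (y : E3) :
    HasWeakDeriv volume (0, y) w (fun z => ∑ j, y j * G j z) := by
  intro ψ hψ hψc
  have hψ2 : MemLp ψ 2 volume := hψ.continuous.memLp_of_hasCompactSupport hψc
  have hdψ2 : ∀ j : Fin 3, MemLp (fun z => fderiv ℝ ψ z (0, EuclideanSpace.single j 1)) 2 volume :=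
    fun j => (contDiff_fderiv_apply' hψ _).continuous.memLp_of_hasCompactSupport
      (hasCompactSupport_fderiv_apply hψc _)
  have e : ((0, y) : ST) = ∑ j, y j • ((0, EuclideanSpace.single j 1) : ST) := by
    refine Prod.ext (by simp [Prod.fst_sum]) ?_
    simp only [Prod.snd_sum, Prod.smul_snd]
    ext i
    simp [Fin.sum_univ_three]
    fin_cases i <;> simp
  have e1 : ∀ z, fderiv ℝ ψ z (0, y) * w z
      = ∑ j, y j * (fderiv ℝ ψ z (0, EuclideanSpace.single j 1) * w z) := by
    intro z
    rw [e, map_sum, Finset.sum_mul]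
    simp only [map_smul, smul_eq_mul, mul_assoc]
  have e2 : ∀ z, ψ z * ∑ j, y j * G j z = ∑ j, y j * (ψ z * G j z) := by
    intro z
    rw [Finset.mul_sum]
    exact Finset.sum_congr rfl fun j _ => by ring
  simp only [e1, e2]
  rw [integral_finsetSum _ fun j _ => (integrable_mul_of_memLp_two (hdψ2 j) hw).const_mul _,
    integral_finsetSum _ fun j _ => (integrable_mul_of_memLp_two hψ2 (hG j)).const_mul _]
  simp only [integral_const_mul, h _ ψ hψ hψc, mul_neg, Finset.sum_neg_distrib]

/-- The translation bound is used with the vector `(0, y)` itself, whose directional derivative `∑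
j, y j * G j` is linear in `y`; this produces the factor `‖y‖`. -/
theorem lpNorm_translate_space_le {w : ST → ℝ} {G : Fin 3 → ST → ℝ} (hw : MemLp w 2 volume)
    (hG : ∀ j, MemLp (G j) 2 volume)
    (h : ∀ j, HasWeakDeriv volume (0, EuclideanSpace.single j 1) w (G j)) (y : E3) :
    lpNorm (fun z => w (z - (0, y)) - w z) 2 volume ≤ (∑ j, lpNorm (G j) 2 volume) * ‖y‖ := by
  have hm : ∀ j, MemLp (fun z => y j * G j z) 2 volume := fun j => (hG j).const_mul _
  have hs : (fun z => ∑ j, y j * G j z) = ∑ j, fun z => y j * G j z := by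
    ext z
    simp
  have hsum : MemLp (fun z => ∑ j, y j * G j z) 2 volume := memLp_finsetSum _ fun j _ => hm j
  refine (lpNorm_translate_sub_le hw hsum (hasWeakDeriv_space hw hG h y)).trans ?_
  rw [hs]
  refine (lpNorm_sum_le (fun j _ => hm j) (by norm_num)).trans ?_
  rw [Finset.sum_mul]
  refine Finset.sum_le_sum fun j _ => ?_
  have : lpNorm (fun z => y j * G j z) 2 volume = ‖y j‖₊ * lpNorm (G j) 2 volume :=
    lpNorm_const_smul (y j) (G j) volume
  rw [this, mul_comm]
  exact mul_le_mul_of_nonneg_left (PiLp.norm_apply_le y j) lpNorm_nonneg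

end WeakDerivatives

/-! ### The vorticity equation in weak form. -/

section VorticityEquation

variable {Q : Opens ST}

/-- The `j`-th vector of the canonical basis of `ℝ³`. -/
def basisVec (j : Fin 3) : E3 := EuclideanSpace.single j 1

theorem norm_basisVec (j : Fin 3) : ‖basisVec j‖ = 1 := by simp [basisVec]

theorem inner_basisVec (v : E3) (j : Fin 3) : inner ℝ v (basisVec j) = v j := by
  simp [basisVec, EuclideanSpace.inner_single_right]

theorem fderiv_smul_sub_smul {χ χ' : ST → ℝ} (hχ : ContDiff ℝ ∞ χ) (hχ' : ContDiff ℝ ∞ χ')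
    (e e' : E3) (z v : ST) :
    fderiv ℝ (fun z => χ z • e - χ' z • e') z v = fderiv ℝ χ z v • e - fderiv ℝ χ' z v • e' := by
  have h1 := (hχ.differentiable (by simp) z).hasFDerivAt.smul_const e
  have h2 := (hχ'.differentiable (by simp) z).hasFDerivAt.smul_const e'
  have h3 : HasFDerivAt (fun z => χ z • e - χ' z • e') _ z := h1.sub h2
  rw [h3.fderiv]
  simp

theorem fderiv_fderiv_apply_comm {ψ : ST → ℝ} (hψ : ContDiff ℝ ∞ ψ) (z v v' : ST) :
    fderiv ℝ (fun y => fderiv ℝ ψ y v) z v' = fderiv ℝ (fun y => fderiv ℝ ψ y v') z v := by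
  have hd : DifferentiableAt ℝ (fderiv ℝ ψ) z :=
    (hψ.fderiv_right (m := ∞) (by simp)).differentiable (by simp) z
  have key : ∀ v v' : ST,
      fderiv ℝ (fun y => fderiv ℝ ψ y v) z v' = fderiv ℝ (fderiv ℝ ψ) z v' v := by
    intro v v'
    rw [fderiv_clm_apply hd (differentiableAt_const v)]
    simp
  rw [key, key]
  exact (hψ.contDiffAt.isSymmSndFDerivAt (by simpa using WithTop.coe_le_coe.2 (le_top : (2 : ℕ∞) ≤ ⊤))) v' v

/-- The solenoidal test field `∂ₚΨ e_q - ∂_qΨ eₚ`. -/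
def curlTest (p q : Fin 3) (Ψ : 𝓓(Q, ℝ)) : 𝓓(Q, E3) where
  toFun z := dx p Ψ z • basisVec q - dx q Ψ z • basisVec p
  contDiff' := ((dxTest p Ψ).contDiff.smul contDiff_const).sub
    ((dxTest q Ψ).contDiff.smul contDiff_const)
  hasCompactSupport' := by
    exact ((dxTest p Ψ).hasCompactSupport.smul_right).sub
      ((dxTest q Ψ).hasCompactSupport.smul_right)
  tsupport_subset' := by
    refine (tsupport_sub _ _).trans (union_subset ?_ ?_)
    · exact (tsupport_smul_subset_left _ _).trans (dxTest p Ψ).tsupport_subset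
    · exact (tsupport_smul_subset_left _ _).trans (dxTest q Ψ).tsupport_subset

variable (p q : Fin 3) (Ψ : 𝓓(Q, ℝ))

theorem dx_curlTest (j : Fin 3) : dx j (curlTest p q Ψ)
    = fun z => dx j (dx p Ψ) z • basisVec q - dx j (dx q Ψ) z • basisVec p := by
  ext1 z
  exact fderiv_smul_sub_smul (dxTest p Ψ).contDiff (dxTest q Ψ).contDiff _ _ z _

theorem dx_dx_curlTest (i j : Fin 3) : dx i (dx j (curlTest p q Ψ))
    = fun z => dx i (dx j (dx p Ψ)) z • basisVec q - dx i (dx j (dx q Ψ)) z • basisVec p := by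
  ext1 z
  rw [dx_curlTest]
  exact fderiv_smul_sub_smul (dxTest j (dxTest p Ψ)).contDiff (dxTest j (dxTest q Ψ)).contDiff
    _ _ z _

/-- The derivatives are commuted so that the weak space derivatives of the velocity can be tested
against `dtTest Ψ`. -/
theorem dt_curlTest (z : ST) : dt (curlTest p q Ψ) z
    = dx p (dtTest Ψ) z • basisVec q - dx q (dtTest Ψ) z • basisVec p := by
  have h := fderiv_smul_sub_smul (dxTest p Ψ).contDiff (dxTest q Ψ).contDiff
    (basisVec q) (basisVec p) z (1, 0)
  refine h.trans ?_
  congr 2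
  · exact fderiv_fderiv_apply_comm Ψ.contDiff z _ _
  · exact fderiv_fderiv_apply_comm Ψ.contDiff z _ _

/-- Only the components `p` and `q` contribute to the divergence, and they cancel by the symmetry of
second derivatives. -/
theorem isSolenoidal_curlTest : IsSolenoidal (curlTest p q Ψ) := by
  intro z
  have hs : dx q (dx p Ψ) z = dx p (dx q Ψ) z := fderiv_fderiv_apply_comm Ψ.contDiff z _ _
  have e : ∀ j : Fin 3, dx j (curlTest p q Ψ) z j
      = (if j = q then dx j (dx p Ψ) z else 0) - (if j = p then dx j (dx q Ψ) z else 0) := by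
    intro j
    simp [dx_curlTest, basisVec, PiLp.single_apply]
  simp only [e, Finset.sum_sub_distrib, Finset.sum_ite_eq', Finset.mem_univ, if_true, hs, sub_self]

theorem norm_smul_sub_smul_basisVec_le {s t M : ℝ} (hs : |s| ≤ M) (ht : |t| ≤ M) :
    ‖s • basisVec q - t • basisVec p‖ ≤ 2 * M := by
  refine (norm_sub_le _ _).trans ?_
  simp only [norm_smul, norm_basisVec, mul_one, Real.norm_eq_abs]
  linarith

/-- The vorticity equation, as a bound of `∂ₜ curl u` in the dual of a space of functions which are
three times differentiable in space. -/
theorem abs_integral_vorticity_mul_dt_le {u f : ST → E3} {M : ℝ}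
    (hQ : volume (Q : Set ST) ≠ ⊤) (hu : MemL2H1 Q u)
    (hf : MemLp f 2 (volume.restrict (Q : Set ST)))
    (hweak : ∀ φ : 𝓓(Q, E3), IsSolenoidal φ →
      ∫ z in (Q : Set ST),
        (inner ℝ (u z) (dt φ z + laplace φ z) + inner ℝ (u z) (∑ j : Fin 3, u z j • dx j φ z)
          + inner ℝ (f z) (φ z)) = 0)
    (hM : SpaceDerivsLe Ψ M) :
    |∫ z in (Q : Set ST), (weakPartial Q p u z q - weakPartial Q q u z p) * dt Ψ z|
      ≤ (8 * volume.real (Q : Set ST) + 12 * lpNorm u 2 (volume.restrict (Q : Set ST)) ^ 2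
          + 2 * lpNorm f 2 (volume.restrict (Q : Set ST)) ^ 2) * M := by
  have hM0 : 0 ≤ M := (abs_nonneg _).trans (hM.1 0 0)
  set φ := curlTest p q Ψ with hφ
  have hw := hweak φ (isSolenoidal_curlTest p q Ψ)
  set R : ST → ℝ := fun z => inner ℝ (u z) (laplace φ z)
    + inner ℝ (u z) (∑ j : Fin 3, u z j • dx j φ z) + inner ℝ (f z) (φ z) with hR
  have hφM : ∀ z, ‖φ z‖ ≤ 2 * M := fun z =>
    norm_smul_sub_smul_basisVec_le p q (hM.1 p z) (hM.1 q z)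
  have hdφM : ∀ j z, ‖dx j φ z‖ ≤ 2 * M := fun j z => by
    rw [hφ, dx_curlTest]
    exact norm_smul_sub_smul_basisVec_le p q (hM.2.1 j p z) (hM.2.1 j q z)
  have hlφM : ∀ z, ‖laplace φ z‖ ≤ 6 * M := fun z => by
    have : ∀ j, ‖dx j (dx j φ) z‖ ≤ 2 * M := fun j => by
      rw [hφ, dx_dx_curlTest]
      exact norm_smul_sub_smul_basisVec_le p q (hM.2.2 j j p z) (hM.2.2 j j q z)
    refine (norm_sum_le _ _).trans ((Finset.sum_le_sum fun j _ => this j).trans ?_)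
    simp
    linarith
  have hnl : ∀ z, ‖∑ j : Fin 3, u z j • dx j φ z‖ ≤ 6 * M * ‖u z‖ := fun z => by
    have : ∀ j, ‖u z j • dx j φ z‖ ≤ ‖u z‖ * (2 * M) := fun j => by
      rw [norm_smul]
      exact mul_le_mul (PiLp.norm_apply_le (u z) j) (hdφM j z) (norm_nonneg _) (norm_nonneg _)
    refine (norm_sum_le _ _).trans ((Finset.sum_le_sum fun j _ => this j).trans ?_)
    simp
    linarith
  -- The viscous, convective and force terms are at most `6M‖u‖`, `6M‖u‖²` and `2M‖f‖`. Bounding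
  -- `‖u‖` by `1 + ‖u‖²`, and likewise `‖f‖`, gives the constants 8, 12 and 2.
  have hRb : ∀ z, ‖R z‖ ≤ (8 + 12 * ‖u z‖ ^ 2 + 2 * ‖f z‖ ^ 2) * M := by
    intro z
    have h1 : ‖inner ℝ (u z) (laplace φ z)‖ ≤ ‖u z‖ * (6 * M) :=
      (norm_inner_le_norm _ _).trans (mul_le_mul_of_nonneg_left (hlφM z) (norm_nonneg _))
    have h2 : ‖inner ℝ (u z) (∑ j : Fin 3, u z j • dx j φ z)‖ ≤ ‖u z‖ * (6 * M * ‖u z‖) :=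
      (norm_inner_le_norm _ _).trans (mul_le_mul_of_nonneg_left (hnl z) (norm_nonneg _))
    have h3 : ‖inner ℝ (f z) (φ z)‖ ≤ ‖f z‖ * (2 * M) :=
      (norm_inner_le_norm _ _).trans (mul_le_mul_of_nonneg_left (hφM z) (norm_nonneg _))
    have h4 := norm_add₃_le (a := inner ℝ (u z) (laplace φ z))
      (b := inner ℝ (u z) (∑ j : Fin 3, u z j • dx j φ z)) (c := inner ℝ (f z) (φ z))
    have h5 : ‖u z‖ ≤ 1 + ‖u z‖ ^ 2 := by nlinarith [sq_nonneg (‖u z‖ - 1)]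
    have h6 : ‖f z‖ ≤ 1 + ‖f z‖ ^ 2 := by nlinarith [sq_nonneg (‖f z‖ - 1)]
    have h7 := mul_le_mul_of_nonneg_right h5 hM0
    have h8 := mul_le_mul_of_nonneg_right h6 hM0
    refine h4.trans ?_
    nlinarith
  have hbi : Integrable (fun z => (8 + 12 * ‖u z‖ ^ 2 + 2 * ‖f z‖ ^ 2) * M)
      (volume.restrict (Q : Set ST)) :=
    (((integrableOn_const hQ).add (hu.1.norm.integrable_sq.const_mul 12)).add
      (hf.norm.integrable_sq.const_mul 2)).mul_const M
  have hcont : ∀ j, Continuous (dx j φ) := fun j => by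
    rw [hφ, dx_curlTest]
    exact ((dxTest j (dxTest p Ψ)).continuous.smul continuous_const).sub
      ((dxTest j (dxTest q Ψ)).continuous.smul continuous_const)
  have hcont2 : ∀ j, Continuous (dx j (dx j φ)) := fun j => by
    rw [hφ, dx_dx_curlTest]
    exact ((dxTest j (dxTest j (dxTest p Ψ))).continuous.smul continuous_const).sub
      ((dxTest j (dxTest j (dxTest q Ψ))).continuous.smul continuous_const)
  have hRm : AEStronglyMeasurable R (volume.restrict (Q : Set ST)) := by
    refine ((hu.1.1.inner ?_).add (hu.1.1.inner ?_)).add (hf.1.inner ?_)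
    · exact (continuous_finsetSum _ fun j _ => hcont2 j).aestronglyMeasurable
    · exact Finset.aestronglyMeasurable_fun_sum _ fun j _ =>
        (memLp_coord hu.1 j).1.smul (hcont j).aestronglyMeasurable
    · exact φ.continuous.aestronglyMeasurable
  have hRi : Integrable R (volume.restrict (Q : Set ST)) :=
    hbi.mono' hRm (Eventually.of_forall hRb)
  set T : ST → ℝ := fun z => dx p (dtTest Ψ) z * u z q - dx q (dtTest Ψ) z * u z p with hT
  have hTe : ∀ z, inner ℝ (u z) (dt φ z) = T z := by
    intro z
    rw [hφ, dt_curlTest, inner_sub_right, inner_smul_right, inner_smul_right, inner_basisVec,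
      inner_basisVec]
  have iT : ∀ i j : Fin 3, Integrable (fun z => dx i (dtTest Ψ) z * u z j)
      (volume.restrict (Q : Set ST)) := fun i j =>
    integrable_mul_of_memLp_two (memLp_testFunction (dxTest i (dtTest Ψ)) _) (memLp_coord hu.1 j)
  have hTi : Integrable T (volume.restrict (Q : Set ST)) := (iT p q).sub (iT q p)
  have e1 : ∫ z in (Q : Set ST), T z = -∫ z in (Q : Set ST), R z := by
    rw [eq_neg_iff_add_eq_zero, ← integral_add hTi hRi, ← hw]
    refine integral_congr_ae (Eventually.of_forall fun z => ?_)
    simp only [hR, inner_add_right, hTe]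
    ring
  have iP : ∀ i j : Fin 3, Integrable (fun z => dtTest Ψ z * weakPartial Q i u z j)
      (volume.restrict (Q : Set ST)) := fun i j =>
    integrable_mul_of_memLp_two (memLp_testFunction (dtTest Ψ) _)
      (memLp_coord (hu.memLp_weakPartial i) j)
  have e2 : ∀ i j : Fin 3, ∫ z in (Q : Set ST), dx i (dtTest Ψ) z * u z j
      = -∫ z in (Q : Set ST), dtTest Ψ z * weakPartial Q i u z j := by
    intro i j
    rw [integral_testFunction_mul, ← hu.integral_dx_mul, ← coe_dxTest, integral_testFunction_mul]
  -- The weak formulation makes the time term `T` have integral `-∫ R`; moving the space derivative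
  -- onto `u` changes the sign once more.
  have e3 : ∫ z in (Q : Set ST), (weakPartial Q p u z q - weakPartial Q q u z p) * dt Ψ z
      = ∫ z in (Q : Set ST), R z := by
    have h1 := integral_sub (iT p q) (iT q p)
    have h2 := integral_sub (iP p q) (iP q p)
    rw [e2, e2] at h1
    have h3 : ∫ z in (Q : Set ST), (weakPartial Q p u z q - weakPartial Q q u z p) * dt Ψ z
        = ∫ z in (Q : Set ST), (dtTest Ψ z * weakPartial Q p u z q
          - dtTest Ψ z * weakPartial Q q u z p) := by
      refine integral_congr_ae (Eventually.of_forall fun z => ?_)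
      simp only [coe_dtTest]
      ring
    rw [h3, h2]
    have h4 : ∫ z in (Q : Set ST), T z = _ := h1
    linarith
  rw [e3, ← Real.norm_eq_abs]
  refine (norm_integral_le_of_norm_le hbi (Eventually.of_forall hRb)).trans (le_of_eq ?_)
  rw [integral_mul_const, integral_add, integral_add, integral_const_mul, integral_const_mul,
    ← sq_lpNorm_two_vec hu.1, ← sq_lpNorm_two_vec hf]
  · simp [mul_comm]
  · exact integrableOn_const hQ
  · exact hu.1.norm.integrable_sq.const_mul 12
  · exact (integrableOn_const hQ).add (hu.1.norm.integrable_sq.const_mul 12)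
  · exact hf.norm.integrable_sq.const_mul 2

end VorticityEquation

theorem HasWeakDeriv.sub {v : ST} {w w' g g' : ST → ℝ} (h : HasWeakDeriv volume v w g)
    (h' : HasWeakDeriv volume v w' g') (hw : MemLp w 2 volume) (hw' : MemLp w' 2 volume)
    (hg : MemLp g 2 volume) (hg' : MemLp g' 2 volume) :
    HasWeakDeriv volume v (fun z => w z - w' z) (fun z => g z - g' z) := by
  intro ψ hψ hψc
  have hψ2 : MemLp ψ 2 volume := hψ.continuous.memLp_of_hasCompactSupport hψc
  have hdψ2 : MemLp (fun z => fderiv ℝ ψ z v) 2 volume :=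
    (contDiff_fderiv_apply' hψ _).continuous.memLp_of_hasCompactSupport
      (hasCompactSupport_fderiv_apply hψc _)
  simp only [mul_sub]
  rw [integral_sub (integrable_mul_of_memLp_two hdψ2 hw) (integrable_mul_of_memLp_two hdψ2 hw'),
    integral_sub (integrable_mul_of_memLp_two hψ2 hg) (integrable_mul_of_memLp_two hψ2 hg'),
    h ψ hψ hψc, h' ψ hψ hψc]
  ring

/-! ### Passage to the limit in the product of vorticity and velocity. -/

section Compactness

variable {Q : Opens ST}

/-- The component `∂ₚv_q - ∂_qvₚ` of the vorticity of `v`. -/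
def curlComp (Q : Opens ST) (p q : Fin 3) (v : ST → E3) (z : ST) : ℝ :=
  weakPartial Q p v z q - weakPartial Q q v z p

theorem MemL2H1.memLp_curlComp {v : ST → E3} (h : MemL2H1 Q v) (p q : Fin 3) :
    MemLp (curlComp Q p q v) 2 (volume.restrict (Q : Set ST)) :=
  (memLp_coord (h.memLp_weakPartial p) q).sub (memLp_coord (h.memLp_weakPartial q) p)

theorem memLp_smul_basisVec {α : Type*} [MeasurableSpace α] {μ : Measure α} {h : α → ℝ}
    (hh : MemLp h 2 μ) (i : Fin 3) : MemLp (fun z => h z • basisVec i) 2 μ := by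
  refine hh.mono (hh.1.smul_const _) (Eventually.of_forall fun z => ?_)
  rw [norm_smul, norm_basisVec, mul_one]

theorem WeakConvL2H1.tendsto_integral_mul {v : ℕ → ST → E3} {w : ST → E3}
    (h : WeakConvL2H1 Q v w) {k : ST → ℝ} (hk : MemLp k 2 (volume.restrict (Q : Set ST)))
    (i : Fin 3) :
    Tendsto (fun n => ∫ z in (Q : Set ST), k z * v n z i) atTop
      (𝓝 (∫ z in (Q : Set ST), k z * w z i)) := by
  have := h.tendsto (fun z => k z • basisVec i) (fun _ _ => 0) (memLp_smul_basisVec hk i)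
    (fun _ => MemLp.zero')
  simpa only [l2h1Pairing, inner_zero_right, Finset.sum_const_zero, add_zero, inner_smul_right,
    inner_basisVec] using this

theorem WeakConvL2H1.tendsto_integral_mul_weakPartial {v : ℕ → ST → E3} {w : ST → E3}
    (h : WeakConvL2H1 Q v w) {k : ST → ℝ} (hk : MemLp k 2 (volume.restrict (Q : Set ST)))
    (j i : Fin 3) :
    Tendsto (fun n => ∫ z in (Q : Set ST), k z * weakPartial Q j (v n) z i) atTop
      (𝓝 (∫ z in (Q : Set ST), k z * weakPartial Q j w z i)) := by
  have := h.tendsto (fun _ => 0) (fun l z => if l = j then k z • basisVec i else 0) MemLp.zero'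
    (fun l => by
      by_cases hl : l = j
      · simpa only [hl, if_true] using memLp_smul_basisVec hk i
      · simpa only [hl, if_false] using MemLp.zero')
  have e : ∀ (l : Fin 3) (x : E3) (z : ST),
      inner ℝ x (if l = j then k z • basisVec i else 0) = if l = j then k z * x i else 0 := by
    intro l x z
    split_ifs
    · rw [inner_smul_right, inner_basisVec]
    · exact inner_zero_right _
  simpa only [l2h1Pairing, inner_zero_right, zero_add, e, Finset.sum_ite_eq', Finset.mem_univ,
    if_true] using this

theorem WeakConvL2H1.tendsto_integral_mul_curlComp {v : ℕ → ST → E3} {w : ST → E3}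
    (h : WeakConvL2H1 Q v w) {k : ST → ℝ} (hk : MemLp k 2 (volume.restrict (Q : Set ST)))
    (p q : Fin 3) :
    Tendsto (fun n => ∫ z in (Q : Set ST), k z * curlComp Q p q (v n) z) atTop
      (𝓝 (∫ z in (Q : Set ST), k z * curlComp Q p q w z)) := by
  have hs : ∀ x : ST → E3, MemL2H1 Q x → ∫ z in (Q : Set ST), k z * curlComp Q p q x z
      = (∫ z in (Q : Set ST), k z * weakPartial Q p x z q)
        - ∫ z in (Q : Set ST), k z * weakPartial Q q x z p := by
    intro x hx
    rw [← integral_sub (integrable_mul_of_memLp_two hk (memLp_coord (hx.memLp_weakPartial p) q))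
      (integrable_mul_of_memLp_two hk (memLp_coord (hx.memLp_weakPartial q) p))]
    simp only [curlComp, mul_sub]
  rw [hs w h.mem_limit]
  simp only [fun n => hs (v n) (h.mem n)]
  exact (h.tendsto_integral_mul_weakPartial hk p q).sub (h.tendsto_integral_mul_weakPartial hk q p)

theorem lpNorm_indicator {f : ST → ℝ} (hf : MemLp f 2 (volume.restrict (Q : Set ST))) :
    lpNorm ((Q : Set ST).indicator f) 2 volume = lpNorm f 2 (volume.restrict (Q : Set ST)) := by
  have h := (memLp_indicator_iff_restrict Q.isOpen.measurableSet).2 hf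
  rw [← toReal_eLpNorm h.1, ← toReal_eLpNorm hf.1,
    eLpNorm_indicator_eq_eLpNorm_restrict Q.isOpen.measurableSet]

/-- The product of the vorticity and the velocity passes to the limit. -/
theorem tendsto_integral_curlComp_mul {u : ℕ → ST → E3} {u' : ST → E3} {A D : ℝ} (p q i : Fin 3)
    (hconv : WeakConvL2H1 Q u u')
    (hA : ∀ n, lpNorm (u n) 2 (volume.restrict (Q : Set ST)) ≤ A)
    (hdA : ∀ n j, lpNorm (weakPartial Q j (u n)) 2 (volume.restrict (Q : Set ST)) ≤ A)
    (hA' : lpNorm u' 2 (volume.restrict (Q : Set ST)) ≤ A)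
    (hdA' : ∀ j, lpNorm (weakPartial Q j u') 2 (volume.restrict (Q : Set ST)) ≤ A)
    (hD : 0 ≤ D)
    (hdt : ∀ n (Ψ : 𝓓(Q, ℝ)) (M : ℝ), SpaceDerivsLe Ψ M →
      |∫ z in (Q : Set ST), curlComp Q p q (u n) z * dt Ψ z| ≤ D * M) (φ : 𝓓(Q, ℝ)) :
    Tendsto (fun n => ∫ z in (Q : Set ST), φ z * u n z i * curlComp Q p q (u n) z) atTop
      (𝓝 (∫ z in (Q : Set ST), φ z * u' z i * curlComp Q p q u' z)) := by
  have hA0 : 0 ≤ A := lpNorm_nonneg.trans hA'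
  obtain ⟨B, hB0, hφB, hdφB⟩ : ∃ B, 0 ≤ B ∧ (∀ z, |φ z| ≤ B) ∧ ∀ j z, |dx j φ z| ≤ B := by
    obtain ⟨B, hB, hφB⟩ := exists_abs_le φ
    choose B' hB' hφB' using fun j => exists_abs_le (dxTest j φ)
    have hs := Finset.sum_nonneg fun j (_ : j ∈ Finset.univ) => hB' j
    refine ⟨B + ∑ j, B' j, by positivity, fun z => (hφB z).trans (by linarith), fun j z => ?_⟩
    have := Finset.single_le_sum (fun j _ => hB' j) (Finset.mem_univ j)
    exact (hφB' j z).trans (by linarith)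
  have hu := hconv.mem
  have hu' := hconv.mem_limit
  -- the localized differences
  have mφ : ∀ v : ST → E3, MemL2H1 Q v → MemLp (fun z => φ z * v z i) 2 volume := fun v hv =>
    memLp_testFunction_mul φ (memLp_coord hv.1 i)
  have mG1 : ∀ v : ST → E3, MemL2H1 Q v → ∀ j, MemLp (fun z => dx j φ z * v z i) 2 volume :=
    fun v hv j => memLp_testFunction_mul (dxTest j φ) (memLp_coord hv.1 i)
  have mG2 : ∀ v : ST → E3, MemL2H1 Q v → ∀ j,
      MemLp (fun z => φ z * weakPartial Q j v z i) 2 volume :=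
    fun v hv j => memLp_testFunction_mul φ (memLp_coord (hv.memLp_weakPartial j) i)
  have mG : ∀ v : ST → E3, MemL2H1 Q v → ∀ j,
      MemLp (fun z => dx j φ z * v z i + φ z * weakPartial Q j v z i) 2 volume :=
    fun v hv j => (mG1 v hv j).add (mG2 v hv j)
  have nφ : ∀ v : ST → E3, MemL2H1 Q v → lpNorm v 2 (volume.restrict (Q : Set ST)) ≤ A →
      lpNorm (fun z => φ z * v z i) 2 volume ≤ B * A := fun v hv hvA =>
    (lpNorm_testFunction_mul_le φ hB0 hφB (memLp_coord hv.1 i)).trans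
      (mul_le_mul_of_nonneg_left ((lpNorm_coord_le hv.1 i).trans hvA) hB0)
  have nG : ∀ v : ST → E3, MemL2H1 Q v → lpNorm v 2 (volume.restrict (Q : Set ST)) ≤ A →
      (∀ j, lpNorm (weakPartial Q j v) 2 (volume.restrict (Q : Set ST)) ≤ A) → ∀ j,
      lpNorm (fun z => dx j φ z * v z i + φ z * weakPartial Q j v z i) 2 volume
        ≤ 2 * (B * A) := by
    intro v hv hvA hdvA j
    have h1 := lpNorm_testFunction_mul_le (dxTest j φ) hB0 (hdφB j) (memLp_coord hv.1 i)
    have h2 := lpNorm_testFunction_mul_le φ hB0 hφB (memLp_coord (hv.memLp_weakPartial j) i)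
    have h3 := mul_le_mul_of_nonneg_left ((lpNorm_coord_le hv.1 i).trans hvA) hB0
    have h4 := mul_le_mul_of_nonneg_left
      ((lpNorm_coord_le (hv.memLp_weakPartial j) i).trans (hdvA j)) hB0
    have h5 := lpNorm_add_le (g := fun z => φ z * weakPartial Q j v z i) (mG1 v hv j)
      (p := 2) (by norm_num)
    refine h5.trans ?_
    simp only [coe_dxTest] at h1
    linarith
  set w : ℕ → ST → ℝ := fun n z => φ z * u n z i - φ z * u' z i with hw
  set g : ℕ → ST → ℝ := fun n => (Q : Set ST).indicator (curlComp Q p q (u n)) with hg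
  have hgi : ∀ n (k : ST → ℝ), ∫ z, g n z * k z
      = ∫ z in (Q : Set ST), curlComp Q p q (u n) z * k z := by
    intro n k
    rw [← integral_indicator Q.isOpen.measurableSet]
    refine integral_congr_ae (Eventually.of_forall fun z => ?_)
    by_cases hz : z ∈ (Q : Set ST)
    · simp only [hg, indicator_of_mem hz]
    · simp only [hg, indicator_of_notMem hz, zero_mul]
  have hwm : ∀ n, MemLp (w n) 2 volume := fun n => (mφ _ (hu n)).sub (mφ _ hu')
  have core : Tendsto (fun n => ∫ z, g n z * w n z) atTop (𝓝 0) := by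
    have hBA : 0 ≤ B * A := mul_nonneg hB0 hA0
    -- One constant serves all bounds: `2A` for the vorticity component, `2BA` for `w`, `12BA = 3 ·
    -- 4BA` for the three derivatives of `w`, and `D` for the time derivative.
    refine tendsto_integral_mul_zero (Q := Q) (K := tsupport φ) (C := 2 * A + 12 * (B * A) + D)
      φ.hasCompactSupport φ.tsupport_subset (fun n => ?_) (fun n => ?_) hwm (fun n => ?_)
      (fun n z hz => ?_) (fun k hk => ?_) (fun n y => ?_) (fun n Ψ M hM => ?_)
    · exact (memLp_indicator_iff_restrict Q.isOpen.measurableSet).2 ((hu n).memLp_curlComp p q)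
    · rw [hg, lpNorm_indicator ((hu n).memLp_curlComp p q)]
      have h1 := lpNorm_sub_le (g := fun z => weakPartial Q q (u n) z p)
        (memLp_coord ((hu n).memLp_weakPartial p) q) (p := 2) (by norm_num)
      have h2 := (lpNorm_coord_le ((hu n).memLp_weakPartial p) q).trans (hdA n p)
      have h3 := (lpNorm_coord_le ((hu n).memLp_weakPartial q) p).trans (hdA n q)
      have h4 : lpNorm (curlComp Q p q (u n)) 2 (volume.restrict (Q : Set ST)) ≤ _ := h1
      linarith
    · have h1 := lpNorm_sub_le (g := fun z => φ z * u' z i) (mφ _ (hu n)) (p := 2) (by norm_num)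
      have h2 := nφ _ (hu n) (hA n)
      have h3 := nφ _ hu' hA'
      have h4 : lpNorm (w n) 2 volume ≤ _ := h1
      linarith
    · simp only [hw, image_eq_zero_of_notMem_tsupport hz, zero_mul, sub_zero]
    · have hk' : MemLp (fun z => φ z * k z) 2 (volume.restrict (Q : Set ST)) :=
        (memLp_testFunction_mul φ (hk.restrict _)).restrict _
      have h1 := (hconv.tendsto_integral_mul hk' i).sub_const
        (∫ z in (Q : Set ST), φ z * k z * u' z i)
      rw [sub_self] at h1
      refine h1.congr fun n => ?_
      have h2 : ∀ v : ST → E3, ∫ z in (Q : Set ST), φ z * k z * v z i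
          = ∫ z, k z * (φ z * v z i) := by
        intro v
        simp only [mul_assoc]
        rw [integral_testFunction_mul φ (fun z => k z * v z i)]
        refine integral_congr_ae (Eventually.of_forall fun z => ?_)
        simp only
        ring
      rw [h2, h2, ← integral_sub (integrable_mul_of_memLp_two hk (mφ _ (hu n)))
        (integrable_mul_of_memLp_two hk (mφ _ hu'))]
      simp only [hw, mul_sub]
    · have h1 := lpNorm_translate_space_le (hwm n)
        (fun j => (mG _ (hu n) j).sub (mG _ hu' j))
        (fun j => ((hu n).hasWeakDeriv_mul j i φ).sub (hu'.hasWeakDeriv_mul j i φ)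
          (mφ _ (hu n)) (mφ _ hu') (mG _ (hu n) j) (mG _ hu' j)) y
      refine h1.trans (mul_le_mul_of_nonneg_right ?_ (norm_nonneg _))
      have h2 : ∀ j ∈ Finset.univ, lpNorm ((fun z => dx j φ z * u n z i
          + φ z * weakPartial Q j (u n) z i) - fun z => dx j φ z * u' z i
          + φ z * weakPartial Q j u' z i) 2 volume ≤ 4 * (B * A) := by
        intro j _
        have h3 := lpNorm_sub_le (g := fun z => dx j φ z * u' z i
          + φ z * weakPartial Q j u' z i) (mG _ (hu n) j) (p := 2) (by norm_num)
        have h4 := nG _ (hu n) (hA n) (hdA n) j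
        have h5 := nG _ hu' hA' hdA' j
        linarith
      refine (Finset.sum_le_sum h2).trans ?_
      simp
      linarith
    · rw [hgi]
      refine (hdt n Ψ M hM).trans (mul_le_mul_of_nonneg_right ?_ ?_)
      · linarith
      · exact (abs_nonneg _).trans (hM.1 0 0)
  -- The integrand is written `ωₙ(φuₙ - φu) + ωₙφu`: the first part tends to zero by `core`, the
  -- second converges because `φu` is a fixed function of `L²`.
  have hlim := core.add (hconv.tendsto_integral_mul_curlComp ((mφ _ hu').restrict _) p q)
  rw [zero_add] at hlim
  refine hlim.congr fun n => ?_
  rw [hgi, ← integral_add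
    (integrable_mul_of_memLp_two ((hu n).memLp_curlComp p q) ((hwm n).restrict _))
    (integrable_mul_of_memLp_two ((mφ _ hu').restrict _) ((hu n).memLp_curlComp p q))]
  refine integral_congr_ae (Eventually.of_forall fun z => ?_)
  simp only [hw]
  ring

end Compactness

/-! ### The derivative of the square of a velocity component. -/

section ProductRule

variable {Q : Opens ST}

theorem dx_convolution_of_hasWeakDeriv {k w G : ST → ℝ} {j : Fin 3} (hk : ContDiff ℝ ∞ k)
    (hkc : HasCompactSupport k) (hw : MemLp w 2 volume)
    (h : HasWeakDeriv volume (0, EuclideanSpace.single j 1) w G) (z : ST) :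
    dx j (k ⋆[ContinuousLinearMap.lsmul ℝ ℝ, volume] w) z
      = (k ⋆[ContinuousLinearMap.lsmul ℝ ℝ, volume] G) z := by
  rw [dx, fderiv_convolution_apply hk hkc (locallyIntegrable_of_memLp_two hw),
    convolution_apply_mul_swap, convolution_apply_mul_swap]
  have h1 := h (fun y => k (z - y)) (hk.comp (contDiff_const.sub contDiff_id))
    (hkc.comp_homeomorph (Homeomorph.subLeft z))
  have e : ∀ y, fderiv ℝ (fun y => k (z - y)) y (0, EuclideanSpace.single j 1)
      = -fderiv ℝ k (z - y) (0, EuclideanSpace.single j 1) := by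
    intro y
    have h2 : HasFDerivAt (fun y : ST => z - y) (-(ContinuousLinearMap.id ℝ ST)) y :=
      (hasFDerivAt_id (𝕜 := ℝ) y).const_sub z
    have h3 := ((hk.differentiable (by simp) (z - y)).hasFDerivAt.comp y h2).fderiv
    change fderiv ℝ (k ∘ fun y => z - y) y _ = _
    rw [h3]
    simp
  simp only [e, neg_mul, integral_neg, neg_inj] at h1
  exact h1

theorem dx_eq_zero_of_notMem_tsupport (φ : 𝓓(Q, ℝ)) (j : Fin 3) {z : ST} (hz : z ∉ tsupport φ) :
    dx j φ z = 0 :=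
  image_eq_zero_of_notMem_tsupport fun h => hz (tsupport_fderiv_apply_subset ℝ _ h)

/-- Formally, test the derivative of `vᵢ` with `φvᵢ`. This is not smooth, so it is mollified; its
derivative converges in `L²` along with it, since it is the mollification of `∂ⱼ(φvᵢ)`. Expanding
that derivative gives `∫ ∂ⱼφ vᵢ² + 2 ∫ φ vᵢ ∂ⱼvᵢ = 0`. -/
theorem MemL2H1.integral_mul_mul_weakPartial {v : ST → E3} (h : MemL2H1 Q v) (j i : Fin 3)
    (φ : 𝓓(Q, ℝ)) :
    ∫ z in (Q : Set ST), φ z * (v z i * weakPartial Q j v z i)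
      = -(1 / 2) * ∫ z in (Q : Set ST), dx j φ z * (v z i * v z i) := by
  set w : ST → ℝ := fun z => φ z * v z i with hw
  set G : ST → ℝ := fun z => dx j φ z * v z i + φ z * weakPartial Q j v z i with hG
  set V : ST → ℝ := (Q : Set ST).indicator fun z => v z i with hV
  set D : ST → ℝ := (Q : Set ST).indicator fun z => weakPartial Q j v z i with hD
  have mv := memLp_coord h.1 i
  have md := memLp_coord (h.memLp_weakPartial j) i
  have mw : MemLp w 2 volume := memLp_testFunction_mul φ mv
  have m1 : MemLp (fun z => dx j φ z * v z i) 2 volume := memLp_testFunction_mul (dxTest j φ) mv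
  have m2 : MemLp (fun z => φ z * weakPartial Q j v z i) 2 volume := memLp_testFunction_mul φ md
  have mG : MemLp G 2 volume := m1.add m2
  have mV : MemLp V 2 volume := (memLp_indicator_iff_restrict Q.isOpen.measurableSet).2 mv
  have mD : MemLp D 2 volume := (memLp_indicator_iff_restrict Q.isOpen.measurableSet).2 md
  have hwK : ∀ z ∉ tsupport φ, w z = 0 := fun z hz => by
    simp only [hw, image_eq_zero_of_notMem_tsupport hz, zero_mul]
  have hGK : ∀ z ∉ tsupport φ, G z = 0 := fun z hz => by
    simp only [hG, image_eq_zero_of_notMem_tsupport hz, zero_mul,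
      dx_eq_zero_of_notMem_tsupport φ j hz, add_zero]
  have hK : IsCompact (tsupport φ) := φ.hasCompactSupport
  obtain ⟨r, hr, hrQ⟩ := hK.exists_cthickening_subset_open Q.isOpen φ.tsupport_subset
  have hind : ∀ (f : ST → ℝ) (ζ : 𝓓(Q, ℝ)),
      ∫ z, (Q : Set ST).indicator f z * ζ z = ∫ z, ζ z * f z := by
    intro f ζ
    refine integral_congr_ae (Eventually.of_forall fun z => ?_)
    by_cases hz : z ∈ (Q : Set ST)
    · simp only [indicator_of_mem hz, mul_comm]
    · simp only [indicator_of_notMem hz, TestFunction_eq_zero ζ hz, zero_mul]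
  have key : ∫ z, V z * G z + D z * w z = 0 := by
    rw [integral_add (integrable_mul_of_memLp_two mV mG) (integrable_mul_of_memLp_two mD mw)]
    refine abs_eq_zero.1 (le_antisymm (le_of_forall_pos_le_add fun η hη => ?_) (abs_nonneg _))
    have hV0 := lpNorm_nonneg (f := V) (p := 2) (μ := volume)
    have hD0 := lpNorm_nonneg (f := D) (p := 2) (μ := volume)
    obtain ⟨η₁, hη₁, hη₁V⟩ : ∃ η₁ > 0, lpNorm V 2 volume * η₁ ≤ η / 2 := by
      refine ⟨η / 2 / (lpNorm V 2 volume + 1), by positivity, ?_⟩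
      rw [mul_div_assoc', div_le_iff₀ (by positivity)]
      nlinarith
    obtain ⟨η₂, hη₂, hη₂D⟩ : ∃ η₂ > 0, lpNorm D 2 volume * η₂ ≤ η / 2 := by
      refine ⟨η / 2 / (lpNorm D 2 volume + 1), by positivity, ?_⟩
      rw [mul_div_assoc', div_le_iff₀ (by positivity)]
      nlinarith
    obtain ⟨s, hs, hsG⟩ := Metric.eventually_nhds_iff.1
      (((tendsto_lpNorm_translate_sub mG).eventually (ge_mem_nhds hη₁)).and
        ((tendsto_lpNorm_translate_sub mw).eventually (ge_mem_nhds hη₂)))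
    -- The radius `s` controls the two mollification errors; `r` keeps the mollified function
    -- supported in `Q`.
    obtain ⟨k, hk, hkc, hk0, hk1, hks⟩ := exists_mollifier ST volume (lt_min hs hr)
    have hGb : ∀ y, k y ≠ 0 → lpNorm (fun z => G (z - y) - G z) 2 volume ≤ η₁ := fun y hy =>
      (hsG (by rw [dist_zero_right]; exact (hks y hy).trans_le (min_le_left _ _))).1
    have hwb : ∀ y, k y ≠ 0 → lpNorm (fun z => w (z - y) - w z) 2 volume ≤ η₂ := fun y hy =>
      (hsG (by rw [dist_zero_right]; exact (hks y hy).trans_le (min_le_left _ _))).2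
    have T1 := abs_integral_mul_convolution_sub_le hk.continuous hkc hk0 hk1 mV mG hGb
    have T2 := abs_integral_mul_convolution_sub_le hk.continuous hkc hk0 hk1 mD mw hwb
    let ζ : 𝓓(Q, ℝ) := ⟨k ⋆[ContinuousLinearMap.lsmul ℝ ℝ, volume] w,
      contDiff_convolution hk hkc (locallyIntegrable_of_memLp_two mw),
      hkc.convolution _ (HasCompactSupport.intro hK hwK),
      (tsupport_convolution_subset_cthickening
        (fun y hy => ((hks y hy).trans_le (min_le_right _ _)).le) hwK).trans hrQ⟩
    have hζ := h.integral_dx_mul j i ζ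
    rw [← coe_dxTest, ← hind, ← hind] at hζ
    have e1 : ∀ z, dxTest j ζ z = (k ⋆[ContinuousLinearMap.lsmul ℝ ℝ, volume] G) z := fun z =>
      dx_convolution_of_hasWeakDeriv hk hkc mw (h.hasWeakDeriv_mul j i φ) z
    have e2 : ∀ z, ζ z = (k ⋆[ContinuousLinearMap.lsmul ℝ ℝ, volume] w) z := fun z => rfl
    simp only [e1, e2] at hζ
    simp only [mul_sub] at T1 T2
    rw [integral_sub (integrable_mul_of_memLp_two mV (memLp_convolution hk hkc hK mG hGK))
      (integrable_mul_of_memLp_two mV mG)] at T1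
    rw [integral_sub (integrable_mul_of_memLp_two mD (memLp_convolution hk hkc hK mw hwK))
      (integrable_mul_of_memLp_two mD mw)] at T2
    rw [abs_le] at T1 T2 ⊢
    constructor <;> linarith [T1.1, T1.2, T2.1, T2.2]
  have i1 : Integrable (fun z => dx j φ z * v z i * V z) volume :=
    integrable_mul_of_memLp_two m1 mV
  have i2 : Integrable (fun z => φ z * weakPartial Q j v z i * V z) volume :=
    integrable_mul_of_memLp_two m2 mV
  have i1' : IntegrableOn (fun z => dx j φ z * (v z i * v z i)) Q := by
    refine (i1.integrableOn (s := (Q : Set ST))).congr_fun (fun z hz => ?_) Q.isOpen.measurableSet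
    simp only [hV, indicator_of_mem hz, mul_assoc]
  have i2' : IntegrableOn (fun z => φ z * (v z i * weakPartial Q j v z i)) Q := by
    refine (i2.integrableOn (s := (Q : Set ST))).congr_fun (fun z hz => ?_) Q.isOpen.measurableSet
    simp only [hV, indicator_of_mem hz]
    ring
  have key2 : ∫ z in (Q : Set ST), (dx j φ z * (v z i * v z i)
      + 2 * (φ z * (v z i * weakPartial Q j v z i))) = 0 := by
    rw [← key, ← integral_indicator Q.isOpen.measurableSet]
    refine integral_congr_ae (Eventually.of_forall fun z => ?_)
    by_cases hz : z ∈ (Q : Set ST)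
    · simp only [hV, hD, hG, hw, indicator_of_mem hz]
      ring
    · simp only [hV, hD, indicator_of_notMem hz]
      ring
  rw [integral_add i1' (i2'.const_mul 2), integral_const_mul] at key2
  linarith

end ProductRule

/-! ### The fields `ω ∧ v` and `(v · ∇)v`: integrability and the identity relating them. -/

section Fields

variable {Q : Opens ST}

/-- The `i`-th component of a test field. -/
def compTest (i : Fin 3) (φ : 𝓓(Q, E3)) : 𝓓(Q, ℝ) where
  toFun z := φ z i
  contDiff' := (EuclideanSpace.proj i : E3 →L[ℝ] ℝ).contDiff.comp φ.contDiff
  hasCompactSupport' :=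
    φ.hasCompactSupport.comp_left (g := fun x : E3 => x i) (by simp)
  tsupport_subset' :=
    (tsupport_comp_subset (g := fun x : E3 => x i) (by simp) φ).trans φ.tsupport_subset

theorem dx_compTest (i j : Fin 3) (φ : 𝓓(Q, E3)) (z : ST) :
    dx j (compTest i φ) z = dx j φ z i := by
  have h1 := (EuclideanSpace.proj i : E3 →L[ℝ] ℝ).hasFDerivAt.comp z
    (φ.contDiff.differentiable (by simp) z).hasFDerivAt
  change fderiv ℝ ((EuclideanSpace.proj i : E3 →L[ℝ] ℝ) ∘ φ) z _ = _
  rw [h1.fderiv]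
  simp [dx]

theorem integrable_of_coord {α : Type*} [MeasurableSpace α] {μ : Measure α} {F : α → E3}
    (h : ∀ i, Integrable (fun z => F z i) μ) : Integrable F μ := by
  have e : F = fun z => ∑ i, F z i • basisVec i := by
    ext z i
    simp [basisVec, Fin.sum_univ_three]
    fin_cases i <;> simp
  rw [e]
  exact integrable_finsetSum _ fun i _ => (h i).smul_const _

theorem inner_eq_sum (x y : E3) : inner ℝ x y = x 0 * y 0 + x 1 * y 1 + x 2 * y 2 := by
  simp [PiLp.inner_apply, Fin.sum_univ_three, mul_comm]

theorem wedge_vorticity_apply (v : ST → E3) (z : ST) :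
    wedge (vorticity Q v z) (v z)
      = !₂[curlComp Q 2 0 v z * v z 2 - curlComp Q 0 1 v z * v z 1,
        curlComp Q 0 1 v z * v z 0 - curlComp Q 1 2 v z * v z 2,
        curlComp Q 1 2 v z * v z 1 - curlComp Q 2 0 v z * v z 0] := by
  ext i
  fin_cases i <;> simp [wedge, vorticity, cross_apply, curlComp]

theorem MemL2H1.integrable_wedge {v : ST → E3} (h : MemL2H1 Q v) :
    Integrable (fun z => wedge (vorticity Q v z) (v z)) (volume.restrict (Q : Set ST)) := by
  have key : ∀ p q i : Fin 3, Integrable (fun z => curlComp Q p q v z * v z i)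
      (volume.restrict (Q : Set ST)) := fun p q i =>
    integrable_mul_of_memLp_two (h.memLp_curlComp p q) (memLp_coord h.1 i)
  refine integrable_of_coord fun i => ?_
  simp only [wedge_vorticity_apply]
  fin_cases i
  · exact (key 2 0 2).sub (key 0 1 1)
  · exact (key 0 1 0).sub (key 1 2 2)
  · exact (key 1 2 1).sub (key 2 0 0)

theorem advection_apply (v : ST → E3) (z : ST) (i : Fin 3) :
    advection Q v z i = ∑ j, v z j * weakPartial Q j v z i := by
  simp [advection]

theorem MemL2H1.integrable_advection {v : ST → E3} (h : MemL2H1 Q v) :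
    Integrable (advection Q v) (volume.restrict (Q : Set ST)) := by
  refine integrable_of_coord fun i => ?_
  simp only [advection_apply]
  exact integrable_finsetSum _ fun j _ =>
    integrable_mul_of_memLp_two (memLp_coord h.1 j) (memLp_coord (h.memLp_weakPartial j) i)

theorem inner_wedge_vorticity (v : ST → E3) (φ : 𝓓(Q, E3)) (z : ST) :
    inner ℝ (wedge (vorticity Q v z) (v z)) (φ z)
      = compTest 0 φ z * v z 2 * curlComp Q 2 0 v z - compTest 0 φ z * v z 1 * curlComp Q 0 1 v z
        + (compTest 1 φ z * v z 0 * curlComp Q 0 1 v z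
          - compTest 1 φ z * v z 2 * curlComp Q 1 2 v z)
        + (compTest 2 φ z * v z 1 * curlComp Q 1 2 v z
          - compTest 2 φ z * v z 0 * curlComp Q 2 0 v z) := by
  rw [inner_eq_sum, wedge_vorticity_apply]
  change _ = φ z 0 * v z 2 * curlComp Q 2 0 v z - φ z 0 * v z 1 * curlComp Q 0 1 v z
        + (φ z 1 * v z 0 * curlComp Q 0 1 v z - φ z 1 * v z 2 * curlComp Q 1 2 v z)
        + (φ z 2 * v z 1 * curlComp Q 1 2 v z - φ z 2 * v z 0 * curlComp Q 2 0 v z)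
  simp
  ring

theorem integral_sub_add_sub_add_sub {α : Type*} [MeasurableSpace α] {μ : Measure α}
    {f₁ f₂ f₃ f₄ f₅ f₆ : α → ℝ} (h₁ : Integrable f₁ μ) (h₂ : Integrable f₂ μ)
    (h₃ : Integrable f₃ μ) (h₄ : Integrable f₄ μ) (h₅ : Integrable f₅ μ) (h₆ : Integrable f₆ μ) :
    ∫ z, (f₁ z - f₂ z + (f₃ z - f₄ z) + (f₅ z - f₆ z)) ∂μ
      = (∫ z, f₁ z ∂μ) - (∫ z, f₂ z ∂μ) + ((∫ z, f₃ z ∂μ) - ∫ z, f₄ z ∂μ)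
        + ((∫ z, f₅ z ∂μ) - ∫ z, f₆ z ∂μ) := by
  have h₁₂ : Integrable (fun z => f₁ z - f₂ z) μ := h₁.sub h₂
  have h₃₄ : Integrable (fun z => f₃ z - f₄ z) μ := h₃.sub h₄
  have h₅₆ : Integrable (fun z => f₅ z - f₆ z) μ := h₅.sub h₆
  have h₁₄ : Integrable (fun z => f₁ z - f₂ z + (f₃ z - f₄ z)) μ := h₁₂.add h₃₄
  rw [integral_add h₁₄ h₅₆, integral_add h₁₂ h₃₄, integral_sub h₁ h₂, integral_sub h₃ h₄,
    integral_sub h₅ h₆]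

/-- This reduces the vector product to six scalar integrals of the form treated by
`tendsto_integral_curlComp_mul`. -/
theorem MemL2H1.pairing_wedge {v : ST → E3} (h : MemL2H1 Q v) (φ : 𝓓(Q, E3)) :
    pairing (fun z => wedge (vorticity Q v z) (v z)) φ
      = (∫ z in (Q : Set ST), compTest 0 φ z * v z 2 * curlComp Q 2 0 v z)
        - (∫ z in (Q : Set ST), compTest 0 φ z * v z 1 * curlComp Q 0 1 v z)
        + ((∫ z in (Q : Set ST), compTest 1 φ z * v z 0 * curlComp Q 0 1 v z)
          - ∫ z in (Q : Set ST), compTest 1 φ z * v z 2 * curlComp Q 1 2 v z)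
        + ((∫ z in (Q : Set ST), compTest 2 φ z * v z 1 * curlComp Q 1 2 v z)
          - ∫ z in (Q : Set ST), compTest 2 φ z * v z 0 * curlComp Q 2 0 v z) := by
  have key : ∀ l i p q : Fin 3, Integrable (fun z => compTest l φ z * v z i * curlComp Q p q v z)
      (volume.restrict (Q : Set ST)) := fun l i p q =>
    integrable_mul_of_memLp_two ((memLp_testFunction_mul (compTest l φ)
      (memLp_coord h.1 i)).restrict _) (h.memLp_curlComp p q)
  simp only [pairing, inner_wedge_vorticity]
  exact integral_sub_add_sub_add_sub (key _ _ _ _) (key _ _ _ _) (key _ _ _ _) (key _ _ _ _)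
    (key _ _ _ _) (key _ _ _ _)

/-- This is `(v · ∇)v = ω ∧ v + ∇|v|²/2`, with the gradient written as `∑ⱼ vⱼ ∂ᵢvⱼ`, a sum of
products of `L²` functions. -/
theorem inner_advection (v : ST → E3) (φ : 𝓓(Q, E3)) (z : ST) :
    inner ℝ (advection Q v z) (φ z) = inner ℝ (wedge (vorticity Q v z) (v z)) (φ z)
      + ∑ i, ∑ j, compTest i φ z * (v z j * weakPartial Q i v z j) := by
  change _ = _ + ∑ i, ∑ j, φ z i * (v z j * weakPartial Q i v z j)
  rw [inner_eq_sum, inner_eq_sum, wedge_vorticity_apply]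
  simp only [advection_apply, Fin.sum_univ_three, curlComp]
  simp
  ring

/-- By the product rule, the gradient part integrates to `-1/2 ∫ (div φ)|v|²`, which vanishes. -/
theorem MemL2H1.pairing_advection {v : ST → E3} (h : MemL2H1 Q v) (φ : 𝓓(Q, E3))
    (hφ : IsSolenoidal φ) :
    pairing (advection Q v) φ = pairing (fun z => wedge (vorticity Q v z) (v z)) φ := by
  have key : ∀ i j : Fin 3, Integrable
      (fun z => compTest i φ z * (v z j * weakPartial Q i v z j))
      (volume.restrict (Q : Set ST)) := fun i j => by
    have := integrable_mul_of_memLp_two ((memLp_testFunction_mul (compTest i φ)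
      (memLp_coord h.1 j)).restrict (Q : Set ST)) (memLp_coord (h.memLp_weakPartial i) j)
    simpa only [mul_assoc] using this
  have key' : ∀ i j : Fin 3, Integrable (fun z => dx i (compTest i φ) z * (v z j * v z j))
      (volume.restrict (Q : Set ST)) := fun i j => by
    have := integrable_mul_of_memLp_two ((memLp_testFunction_mul (dxTest i (compTest i φ))
      (memLp_coord h.1 j)).restrict (Q : Set ST)) (memLp_coord h.1 j)
    simpa only [mul_assoc, coe_dxTest] using this
  have hsum : ∫ z in (Q : Set ST), ∑ i, ∑ j, compTest i φ z * (v z j * weakPartial Q i v z j)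
      = 0 := by
    have hz : ∀ z, ∑ i, ∑ j, dx i (compTest i φ) z * (v z j * v z j) = 0 := by
      intro z
      simp only [dx_compTest, ← Finset.mul_sum]
      rw [← Finset.sum_mul, hφ z, zero_mul]
    calc ∫ z in (Q : Set ST), ∑ i, ∑ j, compTest i φ z * (v z j * weakPartial Q i v z j)
        = ∑ i, ∑ j, ∫ z in (Q : Set ST), compTest i φ z * (v z j * weakPartial Q i v z j) := by
          rw [integral_finsetSum _ fun i _ => integrable_finsetSum _ fun j _ => key i j]
          exact Finset.sum_congr rfl fun i _ => integral_finsetSum _ fun j _ => key i j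
      _ = -(1 / 2) * ∑ i, ∑ j, ∫ z in (Q : Set ST), dx i (compTest i φ) z * (v z j * v z j) := by
          simp only [h.integral_mul_mul_weakPartial, ← Finset.mul_sum]
      _ = -(1 / 2) * ∫ z in (Q : Set ST), ∑ i, ∑ j, dx i (compTest i φ) z * (v z j * v z j) := by
          rw [integral_finsetSum _ fun i _ => integrable_finsetSum _ fun j _ => key' i j]
          congr 1
          exact Finset.sum_congr rfl fun i _ => (integral_finsetSum _ fun j _ => key' i j).symm
      _ = 0 := by simp only [hz, integral_zero, mul_zero]
  have hi : Integrable (fun z => inner ℝ (wedge (vorticity Q v z) (v z)) (φ z))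
      (volume.restrict (Q : Set ST)) := by
    have := φ.integrable_bilin (innerSL ℝ)
      (h.integrable_wedge.locallyIntegrable.locallyIntegrableOn (Q : Set ST))
    refine this.congr (Eventually.of_forall fun z => ?_)
    exact real_inner_comm (wedge (vorticity Q v z) (v z)) (φ z)
  simp only [pairing, inner_advection]
  rw [integral_add hi (integrable_finsetSum _ fun i _ => integrable_finsetSum _ fun j _ => key i j),
    hsum, add_zero]

end Fields

theorem WeakConvL2H1.exists_lpNorm_le {Q : Opens ST} {f : ℕ → ST → E3} {f' : ST → E3}
    (h : WeakConvL2H1 Q f f') :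
    ∃ C, ∀ n, lpNorm (f n) 2 (volume.restrict (Q : Set ST)) ≤ C := by
  refine exists_lpNorm_le_of_weak_tendsto (fun n => (h.mem n).1) fun g hg =>
    ⟨l2h1Pairing Q f' g fun _ _ => 0, ?_⟩
  have := h.tendsto g (fun _ _ => 0) hg fun _ => MemLp.zero'
  refine this.congr fun n => ?_
  simp only [l2h1Pairing, inner_zero_right, Finset.sum_const_zero, add_zero]

/-! ### The two convergence statements. -/

section Limit

variable {Ω : Opens ST} {f u : ℕ → ST → E3} {f' u' : ST → E3} {a b : ℝ} {O : Opens E3}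

theorem WeakLimitSetting.tendsto_integral_curlComp_mul (h : WeakLimitSetting Ω f u f' u')
    (hQ : CompactlyIn (cylinder a b O) Ω) (p q i : Fin 3) (φ : 𝓓(cylinder a b O, ℝ)) :
    Tendsto (fun n => ∫ z in (cylinder a b O : Set ST),
        φ z * u n z i * curlComp (cylinder a b O) p q (u n) z) atTop
      (𝓝 (∫ z in (cylinder a b O : Set ST),
        φ z * u' z i * curlComp (cylinder a b O) p q u' z)) := by
  have hconv := h.conv a b O hQ
  have hforce := h.force_conv a b O hQ
  have hfin : volume (cylinder a b O : Set ST) ≠ ⊤ :=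
    ((measure_mono subset_closure).trans_lt hQ.1.measure_lt_top).ne
  obtain ⟨Cf, hCf⟩ := hforce.exists_lpNorm_le
  obtain ⟨-, C, hC⟩ := h.bounded a b O hQ
  have hCu : ∀ n, lpNorm (u n) 2 (volume.restrict (cylinder a b O : Set ST)) ≤ C := fun n =>
    lpNorm_le_of_eLpNorm_le (hconv.mem n).1.1 (hC n).2.1
  have hCd : ∀ n j, lpNorm (weakPartial (cylinder a b O) j (u n)) 2
      (volume.restrict (cylinder a b O : Set ST)) ≤ C := fun n j =>
    lpNorm_le_of_eLpNorm_le ((hconv.mem n).memLp_weakPartial j).1 ((hC n).2.2 j)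
  set A' : ℝ := ∑ j, lpNorm (weakPartial (cylinder a b O) j u') 2
    (volume.restrict (cylinder a b O : Set ST)) with hA'
  have hA'0 : 0 ≤ A' := Finset.sum_nonneg fun j _ => lpNorm_nonneg
  have hu0 : 0 ≤ lpNorm u' 2 (volume.restrict (cylinder a b O : Set ST)) := lpNorm_nonneg
  have hC0 : (0 : ℝ) ≤ C := C.2
  -- `A` dominates the norms of the sequence and of its limit. `D` comes from the vorticity
  -- equation, with `Cf` the uniform bound on the forces given by their weak convergence.
  refine LocalNS.tendsto_integral_curlComp_mul
    (A := C + (lpNorm u' 2 (volume.restrict (cylinder a b O : Set ST)) + A'))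
    (D := 8 * volume.real (cylinder a b O : Set ST) + 12 * (C : ℝ) ^ 2 + 2 * Cf ^ 2)
    p q i hconv (fun n => (hCu n).trans (by linarith)) (fun n j => (hCd n j).trans (by linarith))
    (by linarith) (fun j => ?_) (by positivity) (fun n Ψ M hM => ?_) φ
  · have := Finset.single_le_sum (f := fun j => lpNorm (weakPartial (cylinder a b O) j u') 2
      (volume.restrict (cylinder a b O : Set ST))) (fun j _ => lpNorm_nonneg) (Finset.mem_univ j)
    simp only [← hA'] at this
    linarith
  · refine (abs_integral_vorticity_mul_dt_le p q Ψ hfin (hconv.mem n) (hforce.mem n).1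
      ((h.solution n).weak_form a b O hQ) hM).trans
      (mul_le_mul_of_nonneg_right ?_ ((abs_nonneg _).trans (hM.1 0 0)))
    have h1 := pow_le_pow_left₀ lpNorm_nonneg (hCu n) 2
    have h2 := pow_le_pow_left₀ lpNorm_nonneg (hCf n) 2
    linarith

theorem WeakLimitSetting.tendsto_pairing_wedge (h : WeakLimitSetting Ω f u f' u')
    (hQ : CompactlyIn (cylinder a b O) Ω) (φ : 𝓓(cylinder a b O, E3)) :
    Tendsto (fun n => pairing (fun z => wedge (vorticity (cylinder a b O) (u n) z) (u n z)) φ)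
      atTop (𝓝 (pairing (fun z => wedge (vorticity (cylinder a b O) u' z) (u' z)) φ)) := by
  have hconv := h.conv a b O hQ
  have key := fun (p q i l : Fin 3) => h.tendsto_integral_curlComp_mul hQ p q i (compTest l φ)
  rw [hconv.mem_limit.pairing_wedge]
  simp only [fun n => (hconv.mem n).pairing_wedge]
  exact (((key _ _ _ _).sub (key _ _ _ _)).add ((key _ _ _ _).sub (key _ _ _ _))).add
    ((key _ _ _ _).sub (key _ _ _ _))

theorem WeakLimitSetting.convergesInDual_wedge (h : WeakLimitSetting Ω f u f' u')
    (hQ : CompactlyIn (cylinder a b O) Ω) :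
    ConvergesInDual (cylinder a b O) univ
      (fun n z => wedge (vorticity (cylinder a b O) (u n) z) (u n z))
      (fun z => wedge (vorticity (cylinder a b O) u' z) (u' z)) := by
  have hconv := h.conv a b O hQ
  exact ⟨fun n => IntegrableOn.locallyIntegrableOn (hconv.mem n).integrable_wedge,
    IntegrableOn.locallyIntegrableOn hconv.mem_limit.integrable_wedge,
    fun φ _ => h.tendsto_pairing_wedge hQ φ⟩

theorem WeakLimitSetting.convergesInDual_advection (h : WeakLimitSetting Ω f u f' u')
    (hQ : CompactlyIn (cylinder a b O) Ω) :
    ConvergesInDual (cylinder a b O) {φ | IsSolenoidal φ}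
      (fun n => advection (cylinder a b O) (u n)) (advection (cylinder a b O) u') := by
  have hconv := h.conv a b O hQ
  refine ⟨fun n => IntegrableOn.locallyIntegrableOn (hconv.mem n).integrable_advection,
    IntegrableOn.locallyIntegrableOn hconv.mem_limit.integrable_advection, fun φ hφ => ?_⟩
  rw [hconv.mem_limit.pairing_advection φ hφ]
  simp only [fun n => (hconv.mem n).pairing_advection φ hφ]
  exact h.tendsto_pairing_wedge hQ φ

end Limit

/-! ### Saddle-shaped potential flows as exact solutions. -/

section PotentialFlow

variable {Q : Opens ST}

theorem integrable_testFunction_mul_continuous (ζ : 𝓓(Q, ℝ)) {F : ST → ℝ} (hF : Continuous F) :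
    Integrable (fun z => ζ z * F z) volume :=
  (ζ.continuous.mul hF).integrable_of_hasCompactSupport ζ.hasCompactSupport.mul_right

theorem integral_fderiv_mul_eq_neg (ζ : 𝓓(Q, ℝ)) {F : ST → ℝ} (hF : ContDiff ℝ ∞ F) (v : ST) :
    ∫ z, fderiv ℝ ζ z v * F z = -∫ z, ζ z * fderiv ℝ F z v := by
  have hF' : Continuous fun z => fderiv ℝ F z v := (contDiff_fderiv_apply' hF v).continuous
  have := integral_mul_fderiv_eq_neg_fderiv_mul_of_integrable (μ := volume) (f := F) (g := ζ)
    (v := v) ?_ ?_ ?_ (fun x _ => hF.differentiable (by simp) x)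
    (fun x _ => ζ.contDiff.differentiable (by simp) x)
  · simpa only [mul_comm] using this
  · simpa only [mul_comm] using integrable_testFunction_mul_continuous ζ hF'
  · exact (integrable_testFunction_mul_continuous (derivTest v ζ) hF.continuous).congr
      (Eventually.of_forall fun z => mul_comm _ _)
  · simpa only [mul_comm] using integrable_testFunction_mul_continuous ζ hF.continuous

theorem fderiv_coord {Φ : ST → E3} {z : ST} (hΦ : DifferentiableAt ℝ Φ z) (v : ST) (i : Fin 3) :
    fderiv ℝ (fun z => Φ z i) z v = fderiv ℝ Φ z v i := by
  have h1 := (EuclideanSpace.proj i : E3 →L[ℝ] ℝ).hasFDerivAt.comp z hΦ.hasFDerivAt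
  change fderiv ℝ ((EuclideanSpace.proj i : E3 →L[ℝ] ℝ) ∘ Φ) z _ = _
  rw [h1.fderiv]
  simp

theorem inner_eq_finsetSum (x y : E3) : inner ℝ x y = ∑ i, x i * y i := by
  simp [PiLp.inner_apply, mul_comm]

theorem contDiff_coord (i : Fin 3) : ContDiff ℝ ∞ fun x : E3 => x i :=
  (EuclideanSpace.proj i : E3 →L[ℝ] ℝ).contDiff

theorem fderiv_const_mul_coord (r : ℝ) (i : Fin 3) (x h : E3) :
    fderiv ℝ (fun x : E3 => r * x i) x h = r * h i := by
  have h1 : HasFDerivAt (fun x : E3 => r * x i) (r • (EuclideanSpace.proj i : E3 →L[ℝ] ℝ)) x :=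
    (EuclideanSpace.proj i : E3 →L[ℝ] ℝ).hasFDerivAt.const_mul r
  rw [h1.fderiv]
  simp

/-- A gradient is orthogonal to the solenoidal test fields. -/
theorem integral_sum_mul_dx_eq_zero (φ : 𝓓(Q, E3)) (hφ : IsSolenoidal φ) {H : ST → ℝ}
    (hH : ContDiff ℝ ∞ H) : ∫ z, ∑ i, compTest i φ z * dx i H z = 0 := by
  have h1 : ∀ i : Fin 3, Integrable (fun z => compTest i φ z * dx i H z) volume := fun i =>
    integrable_testFunction_mul_continuous _ (contDiff_fderiv_apply' hH _).continuous
  have h2 : ∀ i : Fin 3, Integrable (fun z => dx i (compTest i φ) z * H z) volume := fun i =>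
    integrable_testFunction_mul_continuous (dxTest i (compTest i φ)) hH.continuous
  rw [integral_finsetSum _ fun i _ => h1 i]
  have h3 : ∀ i : Fin 3, ∫ z, compTest i φ z * dx i H z
      = -∫ z, dx i (compTest i φ) z * H z := fun i => by
    have := integral_fderiv_mul_eq_neg (compTest i φ) hH (0, EuclideanSpace.single i 1)
    simp only [dx]
    rw [this, neg_neg]
  simp only [h3, Finset.sum_neg_distrib]
  rw [← integral_finsetSum _ fun i _ => h2 i]
  have h4 : ∀ z, ∑ i, dx i (compTest i φ) z * H z = 0 := fun z => by
    rw [← Finset.sum_mul]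
    simp only [dx_compTest]
    rw [hφ z, zero_mul]
  simp [h4]

/-- The field is the space gradient of `γ(t) ∑ₖ rₖ xₖ²/2`. -/
theorem integral_sum_mul_linear_eq_zero (φ : 𝓓(Q, E3)) (hφ : IsSolenoidal φ) {γ : ℝ → ℝ}
    (hγ : ContDiff ℝ ∞ γ) (r : Fin 3 → ℝ) :
    ∫ z : ST, ∑ i, compTest i φ z * (γ z.1 * (r i * z.2 i)) = 0 := by
  have hb : ContDiff ℝ ∞ fun x : E3 => ∑ k, r k / 2 * (x k * x k) :=
    ContDiff.sum fun k _ => contDiff_const.mul ((contDiff_coord k).mul (contDiff_coord k))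
  rw [← integral_sum_mul_dx_eq_zero φ hφ (contDiff_tensor hγ hb)]
  congr 1
  ext z
  refine Finset.sum_congr rfl fun i _ => ?_
  congr 1
  have h1 : ∀ k : Fin 3, HasFDerivAt (fun x : E3 => x k) (EuclideanSpace.proj k : E3 →L[ℝ] ℝ) z.2 :=
    fun k => (EuclideanSpace.proj k : E3 →L[ℝ] ℝ).hasFDerivAt
  have h2 := (HasFDerivAt.fun_sum (u := Finset.univ) fun k (_ : k ∈ Finset.univ) =>
    ((h1 k).fun_mul (h1 k)).const_mul (r k / 2)).fderiv
  rw [dx, fderiv_tensor hγ hb, h2]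
  fin_cases i <;> simp [Fin.sum_univ_three] <;> ring_nf <;> simp

/-- The signs of the components of the gradient of `(x₀² - x₁²) / 2`. -/
def saddleSign : Fin 3 → ℝ := ![1, -1, 0]

/-- The potential flow `c(t) ∇((x₀² - x₁²) / 2)`. -/
def saddleFlow (c : ℝ → ℝ) (z : ST) : E3 :=
  WithLp.toLp 2 fun i => c z.1 * (saddleSign i * z.2 i)

/-- The derivative of `saddleFlow c` in the `j`-th direction. -/
def saddleGrad (c : ℝ → ℝ) (j : Fin 3) (z : ST) : E3 := (c z.1 * saddleSign j) • basisVec j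

theorem saddleFlow_apply (c : ℝ → ℝ) (z : ST) (i : Fin 3) :
    saddleFlow c z i = c z.1 * (saddleSign i * z.2 i) := rfl

theorem saddleFlow_zero : saddleFlow 0 = 0 := by
  ext z i
  simp [saddleFlow_apply]

theorem abs_saddleSign_le (i : Fin 3) : |saddleSign i| ≤ 1 := by
  fin_cases i <;> simp [saddleSign]

variable {c : ℝ → ℝ}

theorem contDiff_saddleFlow_coord (hc : ContDiff ℝ ∞ c) (i : Fin 3) : ContDiff ℝ ∞ fun z => saddleFlow c z i :=
  contDiff_tensor hc (b := fun x => saddleSign i * x i) (contDiff_const.mul (contDiff_coord i))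

theorem fderiv_saddleFlow_coord (hc : ContDiff ℝ ∞ c) (i : Fin 3) (z : ST) (s : ℝ) (h : E3) :
    fderiv ℝ (fun z => saddleFlow c z i) z (s, h)
      = s * deriv c z.1 * (saddleSign i * z.2 i) + c z.1 * (saddleSign i * h i) := by
  have := fderiv_tensor hc (b := fun x => saddleSign i * x i)
    (contDiff_const.mul (contDiff_coord i)) z s h
  rw [fderiv_const_mul_coord] at this
  exact this

theorem continuous_saddleFlow (hc : ContDiff ℝ ∞ c) : Continuous (saddleFlow c) := by
  refine (PiLp.continuous_toLp 2 _).comp (continuous_pi fun i => ?_)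
  exact (contDiff_saddleFlow_coord hc i).continuous

theorem continuous_saddleGrad (hc : ContDiff ℝ ∞ c) (j : Fin 3) : Continuous (saddleGrad c j) :=
  ((hc.continuous.comp continuous_fst).mul continuous_const).smul continuous_const

theorem hasWeakPartial_saddleFlow (hc : ContDiff ℝ ∞ c) (Q : Opens ST) (j : Fin 3) :
    HasWeakPartial Q j (saddleFlow c) (saddleGrad c j) where
  locInt := (continuous_saddleFlow hc).locallyIntegrable.locallyIntegrableOn _
  locInt_deriv := (continuous_saddleGrad hc j).locallyIntegrable.locallyIntegrableOn _
  integral_eq φ := by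
    have i1 : Integrable (fun z => dx j φ z • saddleFlow c z) (volume.restrict (Q : Set ST)) :=
      ((dxTest j φ).continuous.smul (continuous_saddleFlow hc)).integrable_of_hasCompactSupport
        (dxTest j φ).hasCompactSupport.smul_right
    have i2 : Integrable (fun z => φ z • saddleGrad c j z) (volume.restrict (Q : Set ST)) :=
      (φ.continuous.smul (continuous_saddleGrad hc j)).integrable_of_hasCompactSupport
        φ.hasCompactSupport.smul_right
    ext i
    rw [PiLp.neg_apply, integral_apply_coord i1, integral_apply_coord i2]
    simp only [PiLp.smul_apply, smul_eq_mul]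
    rw [← coe_dxTest, integral_testFunction_mul, integral_testFunction_mul]
    have h1 := integral_fderiv_mul_eq_neg φ (contDiff_saddleFlow_coord hc i)
      (0, EuclideanSpace.single j 1)
    simp only [fderiv_saddleFlow_coord hc] at h1
    refine h1.trans ?_
    congr 2
    ext z
    by_cases hij : i = j
    · subst hij
      simp [saddleGrad, basisVec]
    · simp [saddleGrad, basisVec, hij]

theorem integral_saddleFlow_sq_mul (hc : ContDiff ℝ ∞ c) (φ : 𝓓(Q, E3)) (i j : Fin 3) :
    ∫ z, dx j (compTest i φ) z * (saddleFlow c z i * saddleFlow c z j)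
      = -∫ z : ST, compTest i φ z * (c z.1 ^ 2 * saddleSign i
          * (saddleSign j * z.2 i + if i = j then saddleSign j * z.2 j else 0)) := by
  have hs := fun i => contDiff_saddleFlow_coord hc i
  have h1 := integral_fderiv_mul_eq_neg (compTest i φ) ((hs i).mul (hs j))
    (0, EuclideanSpace.single j 1)
  refine h1.trans ?_
  congr 2
  ext z
  congr 1
  have h2 := ((hs i).differentiable (by simp) z).hasFDerivAt
  have h3 := ((hs j).differentiable (by simp) z).hasFDerivAt
  rw [(h2.fun_mul h3).fderiv]
  simp only [add_apply, smul_apply,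
    fderiv_saddleFlow_coord hc, smul_eq_mul]
  by_cases hij : i = j
  · subst hij
    simp [saddleFlow_apply]
    ring
  · simp [saddleFlow_apply, hij]
    ring

/-- The viscous term vanishes because the flow is linear in `x`: after one integration by parts only
a function of time is left against a space derivative. -/
theorem integral_saddleFlow_mul_dx_dx (hc : ContDiff ℝ ∞ c) (φ : 𝓓(Q, E3)) (i j : Fin 3) :
    ∫ z, dx j (dx j (compTest i φ)) z * saddleFlow c z i = 0 := by
  have h1 := integral_fderiv_mul_eq_neg (dxTest j (compTest i φ)) (contDiff_saddleFlow_coord hc i)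
    (0, EuclideanSpace.single j 1)
  refine h1.trans ?_
  have h2 : ContDiff ℝ ∞ (tensor c fun _ =>
      saddleSign i * (EuclideanSpace.single j (1 : ℝ) : E3) i) := contDiff_tensor hc contDiff_const
  have h3 := integral_fderiv_mul_eq_neg (compTest i φ) h2 (0, EuclideanSpace.single j 1)
  simp only [fderiv_tensor hc contDiff_const, zero_mul, zero_add, fderiv_fun_const, Pi.zero_apply,
    zero_apply, mul_zero, integral_zero, neg_zero] at h3
  simp only [fderiv_saddleFlow_coord hc, zero_mul, zero_add]
  rw [neg_eq_zero]
  exact h3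

/-- After integration by parts, the time derivative is `c'(t)` times a gradient and the convective
term is `c(t)² (x₀, x₁, 0)`, again a gradient; both are orthogonal to solenoidal fields. The
pressure absorbs any amplitude `c`. -/
theorem saddleFlow_weak_form (hc : ContDiff ℝ ∞ c) (φ : 𝓓(Q, E3)) (hφ : IsSolenoidal φ) :
    ∫ z in (Q : Set ST),
        (inner ℝ (saddleFlow c z) (dt φ z + laplace φ z)
          + inner ℝ (saddleFlow c z) (∑ j : Fin 3, saddleFlow c z j • dx j φ z)
          + inner ℝ ((0 : ST → E3) z) (φ z)) = 0 := by
  have hdx : ∀ j z, DifferentiableAt ℝ (dx j φ) z := fun j z =>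
    ((φ.contDiff.fderiv_right (m := ∞) (by simp)).clm_apply contDiff_const).differentiable
      (by simp) z
  have hdt : ∀ z i, dt φ z i = dt (compTest i φ) z := fun z i =>
    (fderiv_coord (φ.contDiff.differentiable (by simp) z) _ i).symm
  have hdx2 : ∀ z i j, dx j (dx j φ) z i = dx j (dx j (compTest i φ)) z := fun z i j => by
    have : dx j (compTest i φ) = fun z => dx j φ z i := funext fun z => dx_compTest i j φ z
    rw [this]
    exact (fderiv_coord (hdx j z) _ i).symm
  have e : ∀ z, inner ℝ (saddleFlow c z) (dt φ z + laplace φ z)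
      + inner ℝ (saddleFlow c z) (∑ j : Fin 3, saddleFlow c z j • dx j φ z)
      + inner ℝ ((0 : ST → E3) z) (φ z)
      = ∑ i, (dt (compTest i φ) z * saddleFlow c z i
          + ∑ j, (dx j (dx j (compTest i φ)) z * saddleFlow c z i
            + dx j (compTest i φ) z * (saddleFlow c z i * saddleFlow c z j))) := by
    intro z
    simp only [inner_eq_finsetSum, Pi.zero_apply, PiLp.zero_apply, zero_mul, Finset.sum_const_zero,
      add_zero, PiLp.add_apply, laplace, WithLp.ofLp_sum, Finset.sum_apply, PiLp.smul_apply,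
      smul_eq_mul, hdt, hdx2, dx_compTest,
      ← Finset.sum_add_distrib]
    refine Finset.sum_congr rfl fun i _ => ?_
    simp only [Finset.sum_add_distrib, ← Finset.sum_mul, Finset.mul_sum]
    have : ∀ j, saddleFlow c z i * (saddleFlow c z j * dx j φ z i)
      = dx j φ z i * (saddleFlow c z i * saddleFlow c z j) := fun j => by ring
    simp only [this]
    ring
  have hcu := fun i => (contDiff_saddleFlow_coord hc i).continuous
  have iA : ∀ i, Integrable (fun z => dt (compTest i φ) z * saddleFlow c z i) volume := fun i =>
    integrable_testFunction_mul_continuous (dtTest (compTest i φ)) (hcu i)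
  have iB : ∀ i j, Integrable (fun z => dx j (dx j (compTest i φ)) z * saddleFlow c z i) volume :=
    fun i j => integrable_testFunction_mul_continuous (dxTest j (dxTest j (compTest i φ))) (hcu i)
  have iC : ∀ i j, Integrable (fun z => dx j (compTest i φ) z
      * (saddleFlow c z i * saddleFlow c z j)) volume := fun i j =>
    integrable_testFunction_mul_continuous (dxTest j (compTest i φ)) ((hcu i).mul (hcu j))
  have iBC : ∀ i, Integrable (fun z => ∑ j, (dx j (dx j (compTest i φ)) z * saddleFlow c z i
      + dx j (compTest i φ) z * (saddleFlow c z i * saddleFlow c z j))) volume := fun i =>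
    integrable_finsetSum _ fun j _ => (iB i j).add (iC i j)
  have iABC : ∀ i, Integrable (fun z => dt (compTest i φ) z * saddleFlow c z i
      + ∑ j, (dx j (dx j (compTest i φ)) z * saddleFlow c z i
      + dx j (compTest i φ) z * (saddleFlow c z i * saddleFlow c z j))) volume := fun i =>
    (iA i).add (iBC i)
  simp only [e]
  rw [setIntegral_eq_integral_of_forall_compl_eq_zero fun z hz => ?_]
  swap
  · have h1 : ∀ i, dt (compTest i φ) z = 0 := fun i => TestFunction_eq_zero (dtTest (compTest i φ)) hz
    have h2 : ∀ i j, dx j (dx j (compTest i φ)) z = 0 := fun i j =>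
      TestFunction_eq_zero (dxTest j (dxTest j (compTest i φ))) hz
    have h3 : ∀ i j, dx j (compTest i φ) z = 0 := fun i j =>
      TestFunction_eq_zero (dxTest j (compTest i φ)) hz
    simp [h1, h2, h3]
  have hsplit : ∀ i, ∫ z, (dt (compTest i φ) z * saddleFlow c z i
      + ∑ j, (dx j (dx j (compTest i φ)) z * saddleFlow c z i
        + dx j (compTest i φ) z * (saddleFlow c z i * saddleFlow c z j)))
      = (∫ z, dt (compTest i φ) z * saddleFlow c z i)
        + ∑ j, ∫ z, dx j (compTest i φ) z * (saddleFlow c z i * saddleFlow c z j) := by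
    intro i
    rw [integral_add (iA i) (iBC i), integral_finsetSum _ fun j _ => by
      exact (iB i j).add (iC i j)]
    congr 1
    refine Finset.sum_congr rfl fun j _ => ?_
    rw [integral_add (iB i j) (iC i j), integral_saddleFlow_mul_dx_dx hc, zero_add]
  have hA : ∀ i, ∫ z, dt (compTest i φ) z * saddleFlow c z i
      = -∫ z : ST, compTest i φ z * (deriv c z.1 * (saddleSign i * z.2 i)) := by
    intro i
    have h1 := integral_fderiv_mul_eq_neg (compTest i φ) (contDiff_saddleFlow_coord hc i) (1, 0)
    refine h1.trans ?_
    simp [fderiv_saddleFlow_coord hc]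
  rw [integral_finsetSum _ fun i _ => iABC i]
  simp only [hsplit, hA, integral_saddleFlow_sq_mul hc]
  simp only [Finset.sum_add_distrib, Finset.sum_neg_distrib]
  have hcoord : ∀ i : Fin 3, Continuous fun z : ST => z.2 i := fun i =>
    (contDiff_coord i).continuous.comp continuous_snd
  have hc1 : ContDiff ℝ ∞ (deriv c) := (contDiff_infty_iff_deriv.1 hc).2
  have g1 := integral_sum_mul_linear_eq_zero φ hφ hc1 saddleSign
  have g2 := integral_sum_mul_linear_eq_zero φ hφ (hc.pow 2) (fun i => saddleSign i ^ 2)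
  have iL : ∀ (γ : ℝ → ℝ) (r : Fin 3 → ℝ) (i : Fin 3), Continuous γ →
      Integrable (fun z : ST => compTest i φ z * (γ z.1 * (r i * z.2 i))) volume :=
    fun γ r i hγ => integrable_testFunction_mul_continuous _
      ((hγ.comp continuous_fst).mul (continuous_const.mul (hcoord i)))
  rw [integral_finsetSum _ fun i _ => iL _ _ i hc1.continuous] at g1
  have iD : ∀ i j : Fin 3, Integrable (fun z : ST => compTest i φ z * (c z.1 ^ 2 * saddleSign i
          * (saddleSign j * z.2 i + if i = j then saddleSign j * z.2 j else 0))) volume := by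
    intro i j
    refine integrable_testFunction_mul_continuous _ ?_
    refine (((hc.continuous.comp continuous_fst).pow 2).mul continuous_const).mul
      ((continuous_const.mul (hcoord i)).add ?_)
    split_ifs
    · exact continuous_const.mul (hcoord j)
    · exact continuous_const
  have hz : (∑ i, ∑ j, ∫ z : ST, compTest i φ z * (c z.1 ^ 2 * saddleSign i
      * (saddleSign j * z.2 i + if i = j then saddleSign j * z.2 j else 0))) = 0 := by
    refine Eq.trans ?_ g2
    rw [integral_finsetSum _ fun i _ =>
      iL (fun t => c t ^ 2) (fun i => saddleSign i ^ 2) i (hc.continuous.pow 2)]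
    refine Finset.sum_congr rfl fun i _ => ?_
    rw [← integral_finsetSum _ fun j _ => iD i j]
    congr 1
    ext z
    -- The signs sum to zero, as the flow is divergence-free, so only the diagonal term `saddleSign
    -- i ^ 2 * z.2 i` survives.
    rw [← Finset.mul_sum, ← Finset.mul_sum, Finset.sum_add_distrib, Finset.sum_ite_eq]
    simp [Fin.sum_univ_three, saddleSign]
    left
    ring
  rw [g1, hz]
  simp

theorem divFree_saddleFlow (hc : ContDiff ℝ ∞ c) (Q : Opens ST) : DivFree Q (saddleFlow c) := by
  intro φ
  have hcu := fun i => (contDiff_saddleFlow_coord hc i).continuous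
  have e : ∀ z, ∑ j, saddleFlow c z j * dx j φ z = ∑ j, dx j φ z * saddleFlow c z j := fun z =>
    Finset.sum_congr rfl fun j _ => mul_comm _ _
  simp only [e]
  have i1 : ∀ j, Integrable (fun z => dx j φ z * saddleFlow c z j) volume := fun j =>
    integrable_testFunction_mul_continuous (dxTest j φ) (hcu j)
  rw [integral_finsetSum _ fun j _ => (i1 j).integrableOn]
  have h1 : ∀ j : Fin 3, ∫ z in (Q : Set ST), dx j φ z * saddleFlow c z j
      = -(saddleSign j * ∫ z : ST, φ z * c z.1) := by
    intro j
    rw [← coe_dxTest, integral_testFunction_mul, ← integral_const_mul]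
    refine (integral_fderiv_mul_eq_neg φ (contDiff_saddleFlow_coord hc j)
      (0, EuclideanSpace.single j 1)).trans ?_
    simp only [fderiv_saddleFlow_coord hc]
    congr 2
    ext z
    simp
    ring
  simp only [h1]
  simp [Fin.sum_univ_three, saddleSign]

end PotentialFlow

/-! ### The counterexample: fast oscillation in time. -/

section Oscillation

variable {Q Ω : Opens ST} {a b : ℝ} {O : Opens E3} {c : ℝ → ℝ}

/-- The Riemann–Lebesgue lemma in the time variable. -/
theorem tendsto_integral_cos_mul {F : ST → ℝ} (hF : Integrable F volume) :
    Tendsto (fun n : ℕ => ∫ z : ST, Real.cos (n * z.1) * F z) atTop (𝓝 0) := by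
  have h := tendsto_integral_exp_smul_cocompact (fun z : ST => (F z : ℂ)) volume
  -- The Fourier character at frequency `n • w` is `exp(i n t)` with this normalization, and these
  -- frequencies leave every compact set.
  set w : StrongDual ℝ ST := (-(2 * Real.pi)⁻¹) • ContinuousLinearMap.fst ℝ ℝ E3 with hw
  have hw1 : ∀ z : ST, w z = -(2 * Real.pi)⁻¹ * z.1 := fun z => by simp [hw]
  have hw0 : w ≠ 0 := fun h0 => by
    have := hw1 (1, 0)
    rw [h0] at this
    simp [Real.pi_ne_zero] at this
  have h1 : Tendsto (fun r : ℝ => r • w) (cocompact ℝ) (cocompact (StrongDual ℝ ST)) :=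
    (isClosedEmbedding_smul_left hw0).tendsto_cocompact
  have h2 : Tendsto (fun n : ℕ => (n : ℝ)) atTop (cocompact ℝ) :=
    tendsto_natCast_atTop_atTop.mono_right atTop_le_cocompact
  have h3 := (Complex.continuous_re.tendsto 0).comp ((h.comp h1).comp h2)
  rw [Complex.zero_re] at h3
  refine h3.congr fun n => ?_
  simp only [Function.comp_apply]
  have hi : Integrable (fun z : ST => Real.fourierChar (-((n : ℝ) • w) z) • (F z : ℂ)) volume := by
    rw [← integrable_norm_iff]
    · simpa [Circle.norm_smul] using hF.norm
    · have hcont : Continuous fun z : ST => Real.fourierChar (-((n : ℝ) • w) z) :=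
        Real.continuous_fourierChar.comp (((n : ℝ) • w).continuous.neg)
      exact hcont.aestronglyMeasurable.smul hF.ofReal.aestronglyMeasurable
  have h4 := Complex.reCLM.integral_comp_comm hi
  refine h4.symm.trans ?_
  congr 1
  ext z
  simp only [Complex.reCLM_apply, Circle.smul_def, Real.fourierChar_apply, smul_apply, hw1,
    smul_eq_mul, Complex.re_mul_ofReal]
  congr 1
  have : 2 * Real.pi * -(n * (-(2 * Real.pi)⁻¹ * z.1)) = n * z.1 := by
    field_simp
  rw [this, Complex.exp_ofReal_mul_I_re]

theorem CompactlyIn.volume_ne_top (hQ : CompactlyIn Q Ω) : volume (Q : Set ST) ≠ ⊤ :=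
  ((measure_mono subset_closure).trans_lt hQ.1.measure_lt_top).ne

theorem CompactlyIn.exists_norm_le (hQ : CompactlyIn Q Ω) :
    ∃ R, 0 ≤ R ∧ ∀ z ∈ Q, ‖z‖ ≤ R := by
  obtain ⟨R, hR⟩ := hQ.1.isBounded.exists_norm_le
  exact ⟨max R 0, le_max_right _ _, fun z hz => (hR z (subset_closure hz)).trans (le_max_left _ _)⟩

theorem saddleFlow_eq_smul (c : ℝ → ℝ) (z : ST) : saddleFlow c z = c z.1 • saddleFlow 1 z := by
  ext i
  simp [saddleFlow_apply]

theorem saddleGrad_eq_smul (c : ℝ → ℝ) (j : Fin 3) (z : ST) :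
    saddleGrad c j z = c z.1 • saddleGrad 1 j z := by
  simp [saddleGrad, mul_smul]

theorem norm_saddleFlow_le (hc : ∀ t, |c t| ≤ 1) (z : ST) : ‖saddleFlow c z‖ ≤ ‖z‖ := by
  refine le_trans ?_ (norm_snd_le z)
  rw [EuclideanSpace.norm_eq, EuclideanSpace.norm_eq]
  refine Real.sqrt_le_sqrt (Finset.sum_le_sum fun i _ => ?_)
  rw [saddleFlow_apply, norm_mul, norm_mul]
  refine pow_le_pow_left₀ (by positivity) ?_ 2
  have h1 : ‖saddleSign i‖ * ‖z.2 i‖ ≤ ‖z.2 i‖ :=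
    mul_le_of_le_one_left (norm_nonneg _) (abs_saddleSign_le i)
  exact (mul_le_of_le_one_left (by positivity) (hc z.1)).trans h1

theorem norm_saddleGrad_le (hc : ∀ t, |c t| ≤ 1) (j : Fin 3) (z : ST) : ‖saddleGrad c j z‖ ≤ 1 := by
  rw [saddleGrad, norm_smul, norm_basisVec, mul_one, norm_mul]
  exact mul_le_one₀ (hc z.1) (norm_nonneg _) (abs_saddleSign_le j)

theorem memLp_saddleFlow (hQ : CompactlyIn Q Ω) (hc : ContDiff ℝ ∞ c) (hc1 : ∀ t, |c t| ≤ 1)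
    (p : ℝ≥0∞) : MemLp (saddleFlow c) p (volume.restrict (Q : Set ST)) := by
  obtain ⟨R, -, hR⟩ := hQ.exists_norm_le
  have : IsFiniteMeasure (volume.restrict (Q : Set ST)) :=
    isFiniteMeasure_restrict.2 hQ.volume_ne_top
  refine MemLp.of_bound (continuous_saddleFlow hc).aestronglyMeasurable R ?_
  filter_upwards [ae_restrict_mem Q.isOpen.measurableSet] with z hz
  exact (norm_saddleFlow_le hc1 z).trans (hR z hz)

theorem memLp_saddleGrad (hQ : CompactlyIn Q Ω) (hc : ContDiff ℝ ∞ c) (hc1 : ∀ t, |c t| ≤ 1)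
    (j : Fin 3) (p : ℝ≥0∞) : MemLp (saddleGrad c j) p (volume.restrict (Q : Set ST)) := by
  have : IsFiniteMeasure (volume.restrict (Q : Set ST)) :=
    isFiniteMeasure_restrict.2 hQ.volume_ne_top
  exact MemLp.of_bound (continuous_saddleGrad hc j).aestronglyMeasurable 1
    (Eventually.of_forall (norm_saddleGrad_le hc1 j))

theorem memL2H1_saddleFlow (hQ : CompactlyIn Q Ω) (hc : ContDiff ℝ ∞ c) (hc1 : ∀ t, |c t| ≤ 1) :
    MemL2H1 Q (saddleFlow c) :=
  ⟨memLp_saddleFlow hQ hc hc1 2,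
    fun j => ⟨saddleGrad c j, hasWeakPartial_saddleFlow hc Q j, memLp_saddleGrad hQ hc hc1 j 2⟩⟩

theorem exists_energy_bound_saddleFlow (hQ : CompactlyIn (cylinder a b O) Ω) :
    ∃ C : ℝ≥0, ∀ c : ℝ → ℝ, ContDiff ℝ ∞ c → (∀ t, |c t| ≤ 1) →
      LinftyL2Le a b O (saddleFlow c) C ∧
      eLpNorm (saddleFlow c) 2 (volume.restrict (cylinder a b O : Set ST)) ≤ C ∧
      ∀ j, eLpNorm (weakPartial (cylinder a b O) j (saddleFlow c)) 2
        (volume.restrict (cylinder a b O : Set ST)) ≤ C := by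
  obtain ⟨R, hR0, hR⟩ := hQ.exists_norm_le
  have hexp : 0 ≤ (2 : ℝ≥0∞).toReal⁻¹ := by positivity
  set V := volume (cylinder a b O : Set ST) ^ (2 : ℝ≥0∞).toReal⁻¹ with hV
  set W := volume (Metric.closedBall (0 : E3) R) ^ (2 : ℝ≥0∞).toReal⁻¹ with hW
  have hVt : V ≠ ⊤ := ENNReal.rpow_ne_top_of_nonneg hexp hQ.volume_ne_top
  have hWt : W ≠ ⊤ :=
    ENNReal.rpow_ne_top_of_nonneg hexp (isCompact_closedBall _ _).measure_lt_top.ne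
  -- The three terms bound the time slices, the flow on the cylinder and its derivatives. They
  -- depend on the cylinder only, so the bound is uniform over amplitudes `c` with `|c| ≤ 1`.
  have hTt : W * ENNReal.ofReal R + V * ENNReal.ofReal R + V * ENNReal.ofReal 1 ≠ ⊤ := by
    finiteness
  refine ⟨(W * ENNReal.ofReal R + V * ENNReal.ofReal R + V * ENNReal.ofReal 1).toNNReal,
    fun c hc hc1 => ?_⟩
  rw [LinftyL2Le, ENNReal.coe_toNNReal hTt]
  refine ⟨?_, ?_, fun j => ?_⟩
  · filter_upwards [ae_restrict_mem measurableSet_Ioo] with t ht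
    have hmem : ∀ x ∈ O, ‖((t, x) : ST)‖ ≤ R := fun x hx => hR _ ⟨ht, hx⟩
    refine (eLpNorm_le_of_ae_bound (C := R) ?_).trans
      ((mul_le_mul_left ?_ _).trans (le_add_right le_self_add))
    · filter_upwards [ae_restrict_mem O.isOpen.measurableSet] with x hx
      exact (norm_saddleFlow_le hc1 _).trans (hmem x hx)
    · rw [Measure.restrict_apply_univ, hW]
      refine ENNReal.rpow_le_rpow (measure_mono fun x hx => ?_) hexp
      rw [mem_closedBall_zero_iff]
      exact (norm_snd_le ((t, x) : ST)).trans (hmem x hx)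
  · refine (eLpNorm_le_of_ae_bound (C := R) ?_).trans ?_
    · filter_upwards [ae_restrict_mem (cylinder a b O).isOpen.measurableSet] with z hz
      exact (norm_saddleFlow_le hc1 z).trans (hR z hz)
    · rw [Measure.restrict_apply_univ]
      exact le_add_right le_add_self
  · rw [eLpNorm_congr_ae (weakPartial_ae_eq (hasWeakPartial_saddleFlow hc _ j))]
    refine (eLpNorm_le_of_ae_bound (C := 1)
      (Eventually.of_forall (norm_saddleGrad_le hc1 j))).trans ?_
    rw [Measure.restrict_apply_univ]
    exact le_add_self

theorem memLinftyL2_saddleFlow (hQ : CompactlyIn (cylinder a b O) Ω) (hc : ContDiff ℝ ∞ c)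
    (hc1 : ∀ t, |c t| ≤ 1) : MemLinftyL2 a b O (saddleFlow c) := by
  obtain ⟨C, hC⟩ := exists_energy_bound_saddleFlow hQ
  exact ⟨(continuous_saddleFlow hc).aestronglyMeasurable, C, (hC c hc hc1).1⟩

/-- A divergence-free potential flow solves the Navier–Stokes equations without force. -/
theorem isLocalWeakSolution_saddleFlow (Ω : Opens ST) (hc : ContDiff ℝ ∞ c)
    (hc1 : ∀ t, |c t| ≤ 1) : IsLocalWeakSolution Ω 0 (saddleFlow c) where
  force_mem _ _ _ := MemLp.zero
  force_divFree φ := by simp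
  mem_LinftyL2 _ _ _ hQ := memLinftyL2_saddleFlow hQ hc hc1
  mem_L2H1 _ _ _ hQ := memL2H1_saddleFlow hQ hc hc1
  divFree _ _ _ _ := divFree_saddleFlow hc _
  weak_form _ _ _ _ φ hφ := saddleFlow_weak_form hc φ hφ

theorem memL2H1_zero (hQ : CompactlyIn Q Ω) : MemL2H1 Q 0 := by
  rw [← saddleFlow_zero]
  exact memL2H1_saddleFlow hQ contDiff_const (by simp)

/-- The time oscillation `t ↦ cos (n t)`. -/
def oscillation (n : ℕ) (t : ℝ) : ℝ := Real.cos (n * t)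

theorem contDiff_oscillation (n : ℕ) : ContDiff ℝ ∞ (oscillation n) :=
  Real.contDiff_cos.comp (contDiff_const.mul contDiff_id)

theorem abs_oscillation_le (n : ℕ) (t : ℝ) : |oscillation n t| ≤ 1 := Real.abs_cos_le_one _

theorem integrable_inner_of_memLp_two {α : Type*} [MeasurableSpace α] {μ : Measure α}
    {v w : α → E3} (hv : MemLp v 2 μ) (hw : MemLp w 2 μ) :
    Integrable (fun x => inner ℝ (v x) (w x)) μ := by
  simp only [inner_eq_finsetSum]
  exact integrable_finsetSum _ fun i _ =>
    integrable_mul_of_memLp_two (memLp_coord hv i) (memLp_coord hw i)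

/-- The amplitude factors out of every functional, against a fixed function of space-time; weak
convergence of the oscillating flows thus becomes the Riemann–Lebesgue lemma. -/
theorem l2h1Pairing_saddleFlow (hc : ContDiff ℝ ∞ c) (g : ST → E3) (G : Fin 3 → ST → E3) :
    l2h1Pairing Q (saddleFlow c) g G = ∫ z : ST, c z.1 * (Q : Set ST).indicator (fun z =>
      inner ℝ (saddleFlow 1 z) (g z) + ∑ j, inner ℝ (saddleGrad 1 j z) (G j z)) z := by
  have e : (fun z : ST => c z.1 * (Q : Set ST).indicator (fun z =>
      inner ℝ (saddleFlow 1 z) (g z) + ∑ j, inner ℝ (saddleGrad 1 j z) (G j z)) z)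
      = (Q : Set ST).indicator fun z => c z.1 *
        (inner ℝ (saddleFlow 1 z) (g z) + ∑ j, inner ℝ (saddleGrad 1 j z) (G j z)) := by
    ext z
    by_cases hz : z ∈ (Q : Set ST) <;> simp [hz]
  rw [e, integral_indicator Q.isOpen.measurableSet, l2h1Pairing]
  refine integral_congr_ae ?_
  filter_upwards [ae_all_iff.2 fun j =>
    weakPartial_ae_eq (hasWeakPartial_saddleFlow hc Q j)] with z hz
  simp only [hz]
  rw [saddleFlow_eq_smul, real_inner_smul_left, mul_add, Finset.mul_sum]
  congr 1
  refine Finset.sum_congr rfl fun j _ => ?_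
  rw [saddleGrad_eq_smul, real_inner_smul_left]

theorem weakConvL2H1_oscillation (hQ : CompactlyIn Q Ω) :
    WeakConvL2H1 Q (fun n => saddleFlow (oscillation n)) 0 where
  mem n := memL2H1_saddleFlow hQ (contDiff_oscillation n) (abs_oscillation_le n)
  mem_limit := memL2H1_zero hQ
  tendsto g G hg hG := by
    have h1 : ∀ t : ℝ, |(1 : ℝ → ℝ) t| ≤ 1 := fun t => by simp
    have hlim : l2h1Pairing Q 0 g G = 0 := by
      rw [← saddleFlow_zero, l2h1Pairing_saddleFlow (c := 0) contDiff_const]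
      simp
    rw [hlim]
    simp only [fun n => l2h1Pairing_saddleFlow (Q := Q) (contDiff_oscillation n) g G]
    refine tendsto_integral_cos_mul ((integrable_indicator_iff Q.isOpen.measurableSet).2 ?_)
    have h2 : ContDiff ℝ ∞ (1 : ℝ → ℝ) := contDiff_const
    exact (integrable_inner_of_memLp_two (memLp_saddleFlow hQ h2 h1 2) hg).add
      (integrable_finsetSum _ fun j _ =>
        integrable_inner_of_memLp_two (memLp_saddleGrad hQ h2 h1 j 2) (hG j))

theorem weakConvL2H1_zero (hQ : CompactlyIn Q Ω) : WeakConvL2H1 Q (fun _ => 0) 0 where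
  mem _ := memL2H1_zero hQ
  mem_limit := memL2H1_zero hQ
  tendsto _ _ _ _ := tendsto_const_nhds

theorem weakLimitSetting_oscillation :
    WeakLimitSetting ⊤ (fun _ => 0) (fun n => saddleFlow (oscillation n)) 0 0 where
  domain := by
    rw [Opens.coe_top]
    exact isConnected_univ
  solution n := isLocalWeakSolution_saddleFlow ⊤ (contDiff_oscillation n) (abs_oscillation_le n)
  force_conv _ _ _ hQ := weakConvL2H1_zero hQ
  bounded a b O hQ := by
    refine ⟨fun n => ⟨memLinftyL2_saddleFlow hQ (contDiff_oscillation n) (abs_oscillation_le n),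
      memL2H1_saddleFlow hQ (contDiff_oscillation n) (abs_oscillation_le n)⟩, ?_⟩
    obtain ⟨C, hC⟩ := exists_energy_bound_saddleFlow hQ
    exact ⟨C, fun n => hC _ (contDiff_oscillation n) (abs_oscillation_le n)⟩
  conv _ _ _ hQ := weakConvL2H1_oscillation hQ
  regular _ _ _ hQ n := memLp_saddleFlow hQ (contDiff_oscillation n) (abs_oscillation_le n) ∞

theorem advection_saddleFlow_ae_eq (hc : ContDiff ℝ ∞ c) (Q : Opens ST) :
    ∀ᵐ z ∂volume.restrict (Q : Set ST), advection Q (saddleFlow c) z 0 = c z.1 ^ 2 * z.2 0 := by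
  filter_upwards [ae_all_iff.2 fun j =>
    weakPartial_ae_eq (hasWeakPartial_saddleFlow hc Q j)] with z hz
  simp only [advection, hz]
  simp [Fin.sum_univ_three, saddleGrad, saddleFlow_apply, saddleSign, basisVec]
  ring

/-- The test field `χ x₀ e₀`. -/
def coordTest (χ : 𝓓(Q, ℝ)) : 𝓓(Q, E3) where
  toFun z := χ z • (z.2 0 • basisVec 0)
  contDiff' := χ.contDiff.smul
    (((contDiff_coord 0).comp contDiff_snd).smul contDiff_const)
  hasCompactSupport' := χ.hasCompactSupport.smul_right
  tsupport_subset' := (tsupport_smul_subset_left _ _).trans χ.tsupport_subset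

theorem pairing_advection_saddleFlow (hc : ContDiff ℝ ∞ c) (χ : 𝓓(Q, ℝ)) :
    pairing (advection Q (saddleFlow c)) (coordTest χ)
      = ∫ z : ST, c z.1 ^ 2 * (χ z * (z.2 0 * z.2 0)) := by
  have h1 : pairing (advection Q (saddleFlow c)) (coordTest χ)
      = ∫ z in (Q : Set ST), χ z * (c z.1 ^ 2 * (z.2 0 * z.2 0)) := by
    refine integral_congr_ae ?_
    filter_upwards [advection_saddleFlow_ae_eq hc Q] with z hz
    change inner ℝ _ (χ z • (z.2 0 • basisVec 0)) = _
    rw [real_inner_smul_right, real_inner_smul_right, inner_basisVec, hz]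
    ring
  rw [h1, integral_testFunction_mul]
  congr 1
  ext z
  ring

/-- Since `cos² = (1 + cos 2nt)/2`, the advection term keeps a mean value one half, and the
remainder is killed by the Riemann–Lebesgue lemma along the frequencies `2n`. -/
theorem tendsto_pairing_advection_oscillation (χ : 𝓓(Q, ℝ)) :
    Tendsto (fun n => pairing (advection Q (saddleFlow (oscillation n))) (coordTest χ)) atTop
      (𝓝 ((∫ z : ST, χ z * (z.2 0 * z.2 0)) / 2)) := by
  have hcont : Continuous fun z : ST => z.2 0 * z.2 0 := by fun_prop
  have hi := integrable_testFunction_mul_continuous χ hcont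
  have h1 := (tendsto_integral_cos_mul (hi.div_const 2)).comp
    (tendsto_id.const_mul_atTop' (zero_lt_two (α := ℕ)))
  have h2 := h1.add_const ((∫ z : ST, χ z * (z.2 0 * z.2 0)) / 2)
  rw [zero_add] at h2
  refine h2.congr fun n => ?_
  rw [pairing_advection_saddleFlow (contDiff_oscillation n), ← integral_div,
    Function.comp_apply, ← integral_add]
  · congr 1
    ext z
    have : Real.cos ((2 * n : ℕ) * z.1) = 2 * Real.cos (n * z.1) ^ 2 - 1 := by
      rw [← Real.cos_two_mul]
      congr 1
      push_cast
      ring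
    simp only [id_eq, oscillation, this]
    ring
  · have hcos : Continuous fun z : ST => z.2 0 * z.2 0 / 2
        * Real.cos ((2 * id n : ℕ) * z.1) := by fun_prop
    exact (integrable_testFunction_mul_continuous χ hcos).congr
      (Eventually.of_forall fun z => by ring)
  · exact hi.div_const 2

theorem exists_cylinder_not_tendsto_advection :
    ∃ (a b : ℝ) (O : Opens E3), CompactlyIn (cylinder a b O) ⊤ ∧
      ∃ φ : 𝓓(cylinder a b O, E3),
        ¬ Tendsto (fun n => pairing (advection (cylinder a b O) (saddleFlow (oscillation n))) φ)
          atTop (𝓝 (pairing (advection (cylinder a b O) 0) φ)) := by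
  let O : Opens E3 := ⟨Metric.ball 0 1, Metric.isOpen_ball⟩
  let β : ContDiffBump (0 : ST) := ⟨1 / 4, 1 / 2, by norm_num, by norm_num⟩
  let χ : 𝓓(cylinder (-1) 1 O, ℝ) :=
    { toFun := β
      contDiff' := β.contDiff
      hasCompactSupport' := β.hasCompactSupport
      tsupport_subset' := by
        rw [β.tsupport_eq]
        intro z hz
        have hz' : ‖z‖ ≤ 1 / 2 := mem_closedBall_zero_iff.1 hz
        have h1 := abs_le.1 ((norm_fst_le z).trans hz')
        have h2 := (norm_snd_le z).trans hz'
        refine ⟨⟨by linarith [h1.1], by linarith [h1.2]⟩, ?_⟩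
        exact mem_ball_zero_iff.2 (by linarith) }
  refine ⟨-1, 1, O, ⟨?_, fun _ _ => mem_univ _⟩, coordTest χ, fun hlim => ?_⟩
  · refine ((isCompact_Icc (a := (-1 : ℝ)) (b := 1)).prod
      (isCompact_closedBall (0 : E3) 1)).closure_of_subset ?_
    exact prod_mono Ioo_subset_Icc_self Metric.ball_subset_closedBall
  -- The zero field is the saddle flow of zero amplitude, which settles the value of `advection` at
  -- it despite the choice in `weakPartial`.
  have h0 : pairing (advection (cylinder (-1) 1 O) 0) (coordTest χ) = 0 := by
    rw [← saddleFlow_zero, pairing_advection_saddleFlow (c := 0) contDiff_const]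
    simp
  rw [h0] at hlim
  have h1 := tendsto_nhds_unique hlim (tendsto_pairing_advection_oscillation χ)
  -- The integrand is nonnegative and nonzero at time `0` and position `e₀/8`: there the bump equals
  -- one and `x₀` does not vanish.
  have hpos : 0 < ∫ z : ST, χ z * (z.2 0 * z.2 0) := by
    refine Continuous.integral_pos_of_hasCompactSupport_nonneg_nonzero
      (x := ((0, EuclideanSpace.single 0 (1 / 8)) : ST))
      (χ.continuous.mul (by fun_prop)) χ.hasCompactSupport.mul_right
      (fun z => mul_nonneg β.nonneg (mul_self_nonneg _)) ?_
    have hone : χ ((0, EuclideanSpace.single 0 (1 / 8)) : ST) = 1 := by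
      refine β.one_of_mem_closedBall ?_
      rw [mem_closedBall_zero_iff, Prod.norm_mk, PiLp.norm_single]
      norm_num [β]
    rw [hone]
    simp
  linarith

end Oscillation

end LocalNS

end

open LocalNS in
theorem mainTheorem3 :
    -- Convergence of the non-linear term, in `𝓓'(Q)` and in `(𝓓_σ(Q))'`.
    (∀ (Ω : Opens ST) (f u : ℕ → ST → E3) (f' u' : ST → E3), WeakLimitSetting Ω f u f' u' →
      ∀ (a b : ℝ) (O : Opens E3), CompactlyIn (cylinder a b O) Ω →
        ConvergesInDual (cylinder a b O) univ
          (fun n z => wedge (vorticity (cylinder a b O) (u n) z) (u n z))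
          (fun z => wedge (vorticity (cylinder a b O) u' z) (u' z)) ∧
        ConvergesInDual (cylinder a b O) {φ | IsSolenoidal φ}
          (fun n => advection (cylinder a b O) (u n))
          (advection (cylinder a b O) u')) ∧
    -- Under the same hypotheses, `(uₙ · ∇) uₙ` may fail to converge to `(u · ∇) u` in `𝓓'(Q)`.
    (∃ (Ω : Opens ST) (f u : ℕ → ST → E3) (f' u' : ST → E3), WeakLimitSetting Ω f u f' u' ∧
      ∃ (a b : ℝ) (O : Opens E3), CompactlyIn (cylinder a b O) Ω ∧
        ∃ φ : 𝓓(cylinder a b O, E3),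
          ¬ Tendsto (fun n => pairing (advection (cylinder a b O) (u n)) φ) atTop
            (𝓝 (pairing (advection (cylinder a b O) u') φ))) := by
  refine ⟨fun Ω f u f' u' h a b O hQ =>
    ⟨h.convergesInDual_wedge hQ, h.convergesInDual_advection hQ⟩, ?_⟩
  exact ⟨⊤, _, _, 0, 0, weakLimitSetting_oscillation, exists_cylinder_not_tendsto_advection⟩
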